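/- Work in the upper half-space model $\mathbb H^3=\{(\zeta,w)\in\mathbb C\times\mathbb R : w>0\}$ with metric $(|d\zeta|^2+dw^2)/w^2$, with asymptotic boundary $\overline{\mathbb C}=\mathbb C\cup\{\infty\}$. Let $\Omega$ be an open neighbourhood of $0$ in $\mathbb C$, $\Omega^*=\Omega\setminus\{0\}$, and let $E$ be a Bryant surface end (mean curvature one, half the trace of the second fundamental form) with Bryant representation $F=\begin{pmatrix}A&B\\C&D\end{pmatrix}$: the entries are holomorphic functions of $\log z$, $z\in\Omega^*$ (for a disk $\Omega$, holomorphic functions on the universal cover of $\Omega^*$), with $AD-BC=1$, $dA\,dD-dB\,dC=0$, $dF\neq0$ everywhere, and $FF^*$ is single-valued on $\Omega^*$. The surface is the conformal immersion $X=(\zeta,w):\Omega^*\to\mathbb H^3$, $$\zeta=\frac{\bar AC+\bar BD}{|A|^2+|B|^2},\qquad w=\frac1{|A|^2+|B|^2}.$$ For distinct $\mathcal C,\mathcal D\in\overline{\mathbb C}$, the Killing field associated to the translation along (resp. the rotation about) the oriented geodesic $(\mathcal C,\mathcal D)$ going from $\mathcal C$ to $\mathcal D$ is the generator of the flow of translations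 of distance $t$ along (resp. of rotations of angle $\theta$, in the direct sense, about) that geodesic. The flux through $E$ of such a field $Y$ is $$\varphi=\int_\Gamma\langle\eta,Y\rangle-2\int_K\langle\nu,Y\rangle,$$ where $\Gamma$ is a regular closed $C^2$ curve on $E$ generating the fundamental group of the end (it is the image of a loop freely homotopic in $\Omega^*$ to a small circle around $0$, with either orientation), $\eta$ is its unit conormal in the direction of the puncture, $K$ is a $C^2$ disk in $\mathbb H^3$ with boundary $\Gamma$, $\Gamma$ is oriented so that $(\Gamma',\eta,-\vec H)$ is a direct basis, $\vec H$ being the mean curvature vector, and $\nu$ is the unit normal of $K$ inducing this orientation on $\Gamma$. "The flux is $\varphi$" means that such $\Gamma,K$ exist and all of them give the value $\varphi$. Put $\varphi_0=4\pi\operatorname{Res}_0(D\,dC-C\,dD)$, $\varphi_1=4\pi\operatorname{Res}_0(C\,dB-D\,dA)$, $\varphi_2=4\pi\operatorname{Res}_0(B\,dA-A\,dB)$, where $\operatorname{Res}_0$ of a one-form is $\frac1{2\pi i}$ times its integral over small positively oriented circles around $0$. **Theorem.** These residues exist, and: 1. There is a unique polynomial $P_E\in\mathbb C[X,Y]$ such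 that, for all distinct $\mathcal C,\mathcal D\in\overline{\mathbb C}$, the flux through $E$ of the Killing field associated to the translation along $(\mathcal C,\mathcal D)$ is $\operatorname{Re}\left(\frac{P_E(\mathcal C,\mathcal D)}{\mathcal C-\mathcal D}\right)$ and the flux through $E$ of the Killing field associated to the rotation about $(\mathcal C,\mathcal D)$ is $-\operatorname{Im}\left(\frac{P_E(\mathcal C,\mathcal D)}{\mathcal C-\mathcal D}\right)$. (If $\mathcal C$ or $\mathcal D$ is $\infty$, the quotient is the limit as that variable tends to $\infty$, and the limit exists.) 2. $P_E$ is symmetric, $P_E(X,Y)=\varphi_2XY+\varphi_1(X+Y)+\varphi_0$, and the flux polynomial is $\Pi_E(X)=P_E(X,X)=\varphi_2X^2+2\varphi_1X+\varphi_0$. 3. The Rossman–Umehara–Yamada flux matrix $\Phi=-\frac1{2\pi i}\int_c(dF)F^{-1}$ (for every $C^2$ loop $c$ freely homotopic in $\Omega^*$ to a small positively oriented circle around $0$) is $\Phi=\frac1{4\pi}\begin{pmatrix}\varphi_1&\varphi_2\\-\varphi_0&-\varphi_1\end{pmatrix}$. 4. Knowing $\Phi$ is equivalent to knowing the flux of the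 Killing fields associated to all translations and rotations: two ends have the same flux matrix if and only if they have the same flux for every such Killing field. -/

import Mathlib

open scoped Matrix Topology

noncomputable section

namespace Bryant

/-! ### Hyperbolic 3-space

The upper half-space model is the set of `p : ℂ × ℝ`, `p = (ζ, w)`, with `0 < p.2`, with the metric
`(|dζ|² + dw²) / w²` and the orientation of the coordinates `(Re ζ, Im ζ, w)`. -/

/-- The upper half-space. -/
def halfSpace : Set (ℂ × ℝ) := {p | 0 < p.2}

/-- The hyperbolic metric at the point `p` of the half-space, applied to tangent vectors. -/
def hypInner (p u v : ℂ × ℝ) : ℝ :=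
  ((star u.1 * v.1).re + u.2 * v.2) / p.2 ^ 2

/-- The hyperbolic norm of a tangent vector at `p`. -/
def hypNorm (p u : ℂ × ℝ) : ℝ := Real.sqrt (hypInner p u u)

/-- The determinant of three tangent vectors in the coordinates `(Re ζ, Im ζ, w)`. -/
def det3 (u v w : ℂ × ℝ) : ℝ :=
  Matrix.det !![u.1.re, u.1.im, u.2; v.1.re, v.1.im, v.2; w.1.re, w.1.im, w.2]

/-- The hyperbolic volume form at `p`. -/
def volForm (p u v w : ℂ × ℝ) : ℝ := det3 u v w / p.2 ^ 3

/-- The Christoffel term of the Levi-Civita connection of the half-space: the covariant derivative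
of a field `V` along a curve through `p` with velocity `u` is `V' + christoffel p u V`. -/
def christoffel (p u v : ℂ × ℝ) : ℂ × ℝ :=
  (-(((u.2 / p.2 : ℝ) : ℂ) * v.1 + ((v.2 / p.2 : ℝ) : ℂ) * u.1),
    ((star u.1 * v.1).re - u.2 * v.2) / p.2)

/-- The covariant derivative, in the direction `e` of the parameter plane, of the field
`dX(e)` along the parametrized surface `X`. -/
def covAccel (X : ℂ → ℂ × ℝ) (z e : ℂ) : ℂ × ℝ :=
  deriv (fun t : ℝ => fderiv ℝ X (z + t * e) e) 0
    + christoffel (X z) (fderiv ℝ X z e) (fderiv ℝ X z e)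

/-- The mean curvature vector of a conformal immersion `X` (half of the trace of the
vector-valued second fundamental form): `(∇ₓXₓ + ∇_y X_y) / (2 |Xₓ|²)` in the conformal coordinate
`x + i y`, for which this vector is normal to the surface. -/
def meanCurvatureVector (X : ℂ → ℂ × ℝ) (z : ℂ) : ℂ × ℝ :=
  (2 * hypInner (X z) (fderiv ℝ X z 1) (fderiv ℝ X z 1))⁻¹ •
    (covAccel X z 1 + covAccel X z Complex.I)

/-! ### Minkowski model and direct isometries -/

/-- The identification of the half-space with the positive definite Hermitian matrices of
determinant one. -/
def toMinkowski (p : ℂ × ℝ) : Matrix (Fin 2) (Fin 2) ℂ :=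
  ((p.2⁻¹ : ℝ) : ℂ) • !![1, star p.1; p.1, ((‖p.1‖ ^ 2 + p.2 ^ 2 : ℝ) : ℂ)]

/-- The inverse identification. For `N = F F*` with `F = (A, B; C, D)` of determinant one it gives
`ζ = (conj A * C + conj B * D) / (|A|² + |B|²)` and `w = 1 / (|A|² + |B|²)`. -/
def ofMinkowski (N : Matrix (Fin 2) (Fin 2) ℂ) : ℂ × ℝ :=
  (N 1 0 / N 0 0, ((N 0 0).re)⁻¹)

/-- The direct isometry `N ↦ P N P*` of hyperbolic space, read in the half-space. -/
def isometry (P : Matrix.SpecialLinearGroup (Fin 2) ℂ) (p : ℂ × ℝ) : ℂ × ℝ :=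
  ofMinkowski ((P : Matrix (Fin 2) (Fin 2) ℂ) * toMinkowski p *
    (P : Matrix (Fin 2) (Fin 2) ℂ)ᴴ)

/-- The quotient `a / b` as a point of the Riemann sphere. -/
def sphereDiv (a b : ℂ) : OnePoint ℂ :=
  if b = 0 then OnePoint.infty else ((a / b : ℂ) : OnePoint ℂ)

/-- The action `ζ ↦ (δ ζ + γ) / (β ζ + α)` of the direct isometry given by `P = (α, β; γ, δ)` on
the asymptotic boundary, the Riemann sphere. -/
def boundaryMap (P : Matrix.SpecialLinearGroup (Fin 2) ℂ) : OnePoint ℂ → OnePoint ℂ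
  | OnePoint.some ζ => sphereDiv (P 1 1 * ζ + P 1 0) (P 0 1 * ζ + P 0 0)
  | OnePoint.infty => sphereDiv (P 1 1) (P 0 1)

/-- `Φ t` is the translation of distance `t` along the oriented geodesic from `C` to `D`: it is
conjugate, by a direct isometry taking `0` to `C` and `∞` to `D`, to the translation
`(ζ, w) ↦ (eᵗ ζ, eᵗ w)` of distance `t` along the geodesic from `0` to `∞`. -/
def IsTranslationAlong (C D : OnePoint ℂ) (Φ : ℝ → ℂ × ℝ → ℂ × ℝ) : Prop :=
  ∃ P : Matrix.SpecialLinearGroup (Fin 2) ℂ,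
    boundaryMap P ((0 : ℂ) : OnePoint ℂ) = C ∧ boundaryMap P OnePoint.infty = D ∧
    ∀ t : ℝ, ∀ p ∈ halfSpace, Φ t p = isometry P (Real.exp t • isometry P⁻¹ p)

/-- `Φ θ` is the rotation of angle `θ`, in the direct sense, about the oriented geodesic from `C`
to `D`: it is conjugate, by a direct isometry taking `0` to `C` and `∞` to `D`, to the rotation
`(ζ, w) ↦ (e^(iθ) ζ, w)` of angle `θ` about the geodesic from `0` to `∞`. -/
def IsRotationAbout (C D : OnePoint ℂ) (Φ : ℝ → ℂ × ℝ → ℂ × ℝ) : Prop :=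
  ∃ P : Matrix.SpecialLinearGroup (Fin 2) ℂ,
    boundaryMap P ((0 : ℂ) : OnePoint ℂ) = C ∧ boundaryMap P OnePoint.infty = D ∧
    ∀ θ : ℝ, ∀ p ∈ halfSpace, Φ θ p = isometry P
      (Complex.exp (θ * Complex.I) * (isometry P⁻¹ p).1, (isometry P⁻¹ p).2)

/-- `Y` generates the flow `Φ` on hyperbolic space: `dΦ_t/dt = Y(Φ_t)`. -/
def Generates (Y : ℂ × ℝ → ℂ × ℝ) (Φ : ℝ → ℂ × ℝ → ℂ × ℝ) : Prop :=
  ∀ t : ℝ, ∀ p ∈ halfSpace, HasDerivAt (fun s => Φ s p) (Y (Φ t p)) t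

/-- `Y` is the Killing field associated to the translation along the geodesic from `C` to `D`. -/
def IsTranslationField (C D : OnePoint ℂ) (Y : ℂ × ℝ → ℂ × ℝ) : Prop :=
  ∃ Φ, IsTranslationAlong C D Φ ∧ Generates Y Φ

/-- `Y` is the Killing field associated to the rotation about the geodesic from `C` to `D`. -/
def IsRotationField (C D : OnePoint ℂ) (Y : ℂ × ℝ → ℂ × ℝ) : Prop :=
  ∃ Φ, IsRotationAbout C D Φ ∧ Generates Y Φ

/-! ### Bryant surface ends -/

/-- The entrywise complex derivative of a matrix-valued function. -/
def matDeriv (F : ℂ → Matrix (Fin 2) (Fin 2) ℂ) (s : ℂ) : Matrix (Fin 2) (Fin 2) ℂ :=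
  Matrix.of fun i j => deriv (fun u => F u i j) s

/-- A Bryant surface end parametrized by a punctured neighbourhood `Ω \ {0}` of `0`, given by its
Bryant representation `F = (A, B; C, D)`: a multivalued holomorphic null immersion of `Ω \ {0}`
into `SL₂(ℂ)`, that is `AD - BC = 1`, `dA dD - dB dC = 0` and `dF ≠ 0`, for which `F F*`
is single-valued. Multivalued functions of `z ∈ Ω \ {0}` are functions of the logarithm
`s` of `z`, where `z = exp s`; if `Ω` is a disk, then `{s | exp s ∈ Ω}` is the universal cover
of `Ω \ {0}`. The surface is the conformal immersion `X : Ω \ {0} → ℍ³` given by `F F*`. -/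
structure BryantEnd where
  /-- the neighbourhood of the puncture -/
  Ω : Set ℂ
  isOpen_Ω : IsOpen Ω
  zero_mem_Ω : (0 : ℂ) ∈ Ω
  /-- the Bryant representation, as a function of the logarithm of the parameter -/
  F : ℂ → Matrix (Fin 2) (Fin 2) ℂ
  holomorphic_F : ∀ i j, DifferentiableOn ℂ (fun s => F s i j) {s | Complex.exp s ∈ Ω}
  det_F : ∀ s, Complex.exp s ∈ Ω → (F s).det = 1
  null_F : ∀ s, Complex.exp s ∈ Ω → (matDeriv F s).det = 0
  immersion_F : ∀ s, Complex.exp s ∈ Ω → matDeriv F s ≠ 0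
  /-- the immersion into the half-space; its values outside `Ω \ {0}` are irrelevant -/
  X : ℂ → ℂ × ℝ
  X_exp : ∀ s, Complex.exp s ∈ Ω → X (Complex.exp s) = ofMinkowski (F s * (F s)ᴴ)

/-- `c` is a closed `C²` curve (with period `2π`) in `Ω \ {0}` which is freely homotopic in
`Ω \ {0}` to a small circle around `0`, positively oriented if `σ = 1` and negatively oriented if
`σ = -1`. -/
structure IsEndLoop (Ω : Set ℂ) (σ : ℝ) (c : ℝ → ℂ) : Prop where
  contDiff : ContDiff ℝ 2 c
  homotopic : ∃ r : ℝ, 0 < r ∧ Metric.closedBall (0 : ℂ) r ⊆ Ω ∧ ∃ h : ℝ × ℝ → ℂ,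
    ContDiff ℝ 2 h ∧
    (∀ s ∈ Set.Icc (0 : ℝ) 1, ∀ t : ℝ, h (s, t) ∈ Ω \ {0} ∧ h (s, t + 2 * Real.pi) = h (s, t)) ∧
    (∀ t : ℝ, h (0, t) = c t) ∧
    (∀ t : ℝ, h (1, t) = r * Complex.exp (σ * t * Complex.I))

/-! ### Flux of Killing fields -/

namespace BryantEnd

/-- The data needed to compute the flux of a Killing field through the end: a regular closed curve
`Γ = X ∘ c` that generates the fundamental group of the end, its unit conormal `η` in the
direction of the puncture, and a disk `K` with boundary `Γ`, the curve `Γ` being oriented so that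
`(Γ', η, -H)` is a direct basis, where `H` is the mean curvature vector.

The disk is any `C²` map on the closed unit disk (embedded disks need not exist, as `Γ` may have
self-intersections), with the boundary parametrization `K(e^(it)) = Γ(t)`. -/
structure IsFluxConfig (E : BryantEnd) (σ : ℝ) (c : ℝ → ℂ) (η : ℝ → ℂ × ℝ) (K : ℂ → ℂ × ℝ) :
    Prop where
  sign : σ = 1 ∨ σ = -1
  loop : IsEndLoop E.Ω σ c
  regular : ∀ t, deriv c t ≠ 0
  /-- `η` is the image of a vector `v` pointing to the left of `c` if `c` turns positively around
  the puncture, and to the right of `c` otherwise. -/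
  conormal_side : ∀ t, ∃ v : ℂ, 0 < σ * (star (deriv c t) * v).im ∧ η t = fderiv ℝ E.X (c t) v
  conormal_orthogonal : ∀ t, hypInner (E.X (c t)) (η t) (deriv (fun u => E.X (c u)) t) = 0
  conormal_unit : ∀ t, hypNorm (E.X (c t)) (η t) = 1
  orientation : ∀ t, 0 < det3 (deriv (fun u => E.X (c u)) t) (η t)
    (-meanCurvatureVector E.X (c t))
  disk_contDiff : ContDiff ℝ 2 K
  disk_mapsTo : Set.MapsTo K (Metric.closedBall 0 1) halfSpace
  disk_boundary : ∀ t : ℝ, K (Complex.exp (t * Complex.I)) = E.X (c t)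

/-- The quantity `∫_Γ ⟨η, Y⟩ - 2 ∫_K ⟨ν, Y⟩`. Here `ν` is the unit normal of `K` which induces on
the boundary the orientation of `Γ`, so that `(∂K/∂x, ∂K/∂y, ν)` is direct and `⟨ν, Y⟩` times the
area element is the volume form evaluated at `(Y, ∂K/∂x, ∂K/∂y)`. -/
def fluxIntegral (E : BryantEnd) (c : ℝ → ℂ) (η : ℝ → ℂ × ℝ) (K : ℂ → ℂ × ℝ)
    (Y : ℂ × ℝ → ℂ × ℝ) : ℝ :=
  (∫ t in (0 : ℝ)..(2 * Real.pi), hypInner (E.X (c t)) (η t) (Y (E.X (c t))) *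
      hypNorm (E.X (c t)) (deriv (fun u => E.X (c u)) t))
    - 2 * ∫ z in Metric.closedBall (0 : ℂ) 1,
      volForm (K z) (Y (K z)) (fderiv ℝ K z 1) (fderiv ℝ K z Complex.I)

/-- The flux of `Y` through the end is the number `φ`, whatever the choices of `Γ` and `K`
(and such choices exist). -/
def HasFlux (E : BryantEnd) (Y : ℂ × ℝ → ℂ × ℝ) (φ : ℝ) : Prop :=
  (∃ σ c η K, E.IsFluxConfig σ c η K) ∧
    ∀ σ c η K, E.IsFluxConfig σ c η K → E.fluxIntegral c η K Y = φ

/-- Two ends have the same fluxes for the Killing fields associated to all translations and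
rotations. -/
def SameFluxes (E E' : BryantEnd) : Prop :=
  ∀ C D : OnePoint ℂ, C ≠ D → ∀ Y, IsTranslationField C D Y ∨ IsRotationField C D Y →
    ∀ φ : ℝ, E.HasFlux Y φ ↔ E'.HasFlux Y φ

end BryantEnd

/-! ### Residues and the residue-type flux matrix -/

/-- A single-valued one-form on `Ω \ {0}`, written `f(s) ds` with `s = log z` and `f` of period
`2πi`, is `h(z) dz` with this coefficient `h`. -/
def logFormCoeff (f : ℂ → ℂ) (z : ℂ) : ℂ := f (Complex.log z) / z

/-- The residue at `0` of the one-form `h(z) dz` is `a`. -/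
def HasResidue (h : ℂ → ℂ) (a : ℂ) : Prop :=
  ∀ᶠ r in 𝓝[>] (0 : ℝ), (2 * Real.pi * Complex.I)⁻¹ * (∮ z in C(0, r), h z) = a

namespace BryantEnd

/-- The one-form `D dC - C dD`, as `f(s) ds`. -/
def form0 (E : BryantEnd) (s : ℂ) : ℂ :=
  E.F s 1 1 * matDeriv E.F s 1 0 - E.F s 1 0 * matDeriv E.F s 1 1

/-- The one-form `C dB - D dA`, as `f(s) ds`. -/
def form1 (E : BryantEnd) (s : ℂ) : ℂ :=
  E.F s 1 0 * matDeriv E.F s 0 1 - E.F s 1 1 * matDeriv E.F s 0 0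

/-- The one-form `B dA - A dB`, as `f(s) ds`. -/
def form2 (E : BryantEnd) (s : ℂ) : ℂ :=
  E.F s 0 1 * matDeriv E.F s 0 0 - E.F s 0 0 * matDeriv E.F s 0 1

/-- `Φ` is the Rossman-Umehara-Yamada flux matrix `-1/(2πi) ∫_Γ (dF) F⁻¹` of the end, whatever the
positively oriented loop `Γ` around the puncture. -/
def HasFluxMatrix (E : BryantEnd) (Φ : Matrix (Fin 2) (Fin 2) ℂ) : Prop :=
  ∀ c : ℝ → ℂ, IsEndLoop E.Ω 1 c → ∀ i j,
    -(2 * Real.pi * Complex.I)⁻¹ * (∫ t in (0 : ℝ)..(2 * Real.pi),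
      logFormCoeff (fun s => (matDeriv E.F s * (E.F s)⁻¹) i j) (c t) * deriv c t) = Φ i j

end BryantEnd

/-! ### The polynomial of an end -/

/-- `P(c, d)` for a polynomial `P` in two variables. -/
def eval2 (P : MvPolynomial (Fin 2) ℂ) (c d : ℂ) : ℂ := MvPolynomial.eval ![c, d] P

/-- `P(C, D) / (C - D) = v` for distinct points `C` and `D` of the Riemann sphere, where the
quotient is a limit if one of the points is `∞`. -/
def HasQuotient (P : MvPolynomial (Fin 2) ℂ) : OnePoint ℂ → OnePoint ℂ → ℂ → Prop
  | OnePoint.some c, OnePoint.some d, v => c ≠ d ∧ eval2 P c d / (c - d) = v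
  | OnePoint.some c, OnePoint.infty, v =>
      Filter.Tendsto (fun d => eval2 P c d / (c - d)) (Bornology.cobounded ℂ) (𝓝 v)
  | OnePoint.infty, OnePoint.some d, v =>
      Filter.Tendsto (fun c => eval2 P c d / (c - d)) (Bornology.cobounded ℂ) (𝓝 v)
  | OnePoint.infty, OnePoint.infty, _ => False

/-- For all `C ≠ D` in the Riemann sphere, the fluxes through `E` of the Killing fields associated
to the translation along, and to the rotation about, the geodesic from `C` to `D` are
`Re (P(C, D) / (C - D))` and `-Im (P(C, D) / (C - D))`. -/
def BryantEnd.IsFluxRepresentedBy (E : BryantEnd) (P : MvPolynomial (Fin 2) ℂ) : Prop :=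
  ∀ C D : OnePoint ℂ, C ≠ D → ∃ v : ℂ, HasQuotient P C D v ∧
    (∀ Y, IsTranslationField C D Y → E.HasFlux Y v.re) ∧
    (∀ Y, IsRotationField C D Y → E.HasFlux Y (-v.im))

/-- The polynomial `P(X, X)`. -/
def diagonal (P : MvPolynomial (Fin 2) ℂ) : Polynomial ℂ :=
  MvPolynomial.aeval ![Polynomial.X, Polynomial.X] P

end Bryant

end

/-! Infinitesimal direct isometries of hyperbolic space are trace-free matrices `ξ`, and
`killingField ξ` is the corresponding field. The space of such `ξ` is complex, and multiplication by
`i` exchanges translations and rotations about the same axis. The theorem rests on two identities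
that use this complex structure.

The first lives in the ambient space (`extDeriv₂_killingPotential`): the contraction of the volume
form by the field of `ξ` is exact, and a primitive is half of the one-form dual to the field of `i
ξ`. By Stokes on the disk, the term `2 ∫_K ⟨ν, Y⟩` becomes an integral over `Γ`, so the choice of
`K` is irrelevant.

The second lives on the surface (`IsNullLift.flux_density`): along a curve the resulting integrand
is twice the imaginary part of the holomorphic form `tr(ξ (dF) F⁻¹)`, whose coefficients are the
three forms `D dC - C dD`, `C dB - D dA`, `B dA - A dB`. The flux is therefore a period, independent
of `Γ` and computed by residues. The orientation convention forces `Γ` to turn negatively around the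
puncture (`sign_and_conormal`), which fixes the sign: the flux is the real part of `-4π` times the
residue of `tr(ξ (dF) F⁻¹)`. The forms descend to the punctured neighbourhood because the left side
of the identity involves only the surface, so that the monodromy of `F` never has to be examined
(`forms_unique`).

For the axis from `C` to `D`, let `P = (α, β; γ, δ)` take `0` to `C = γ/α` and `∞` to `D = δ/β`. The
translation is generated by `ξ = P diag(-1/2, 1/2) P⁻¹` and the rotation by `i ξ`. Since `C - D =
-1/(αβ)`, the pairing of `ξ` with the residues is exactly `-P_E(C, D)/(C - D)`
(`hasQuotient_fluxPolynomial`). A polynomial is determined by its values off the diagonal, which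
gives uniqueness of `P_E`. The flux matrix has the same three residues as entries, so the matrix,
the polynomial and the fluxes all carry the same information. -/

noncomputable section

namespace Bryant

open scoped ComplexConjugate

/-! ### Wirtinger derivatives -/

/-- `p` and `q` are the Wirtinger derivatives `∂f` and `∂̄f` of the real differentiable function `f`
at `z`. -/
def HasWirtingerDerivAt (f : ℂ → ℂ) (p q z : ℂ) : Prop :=
  HasFDerivAt f (p • (ContinuousLinearMap.id ℝ ℂ) + q • (Complex.conjCLE : ℂ →L[ℝ] ℂ)) z

namespace HasWirtingerDerivAt

variable {f g : ℂ → ℂ} {p q p' q' z : ℂ}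

lemma of_hasDerivAt (h : HasDerivAt f p z) : HasWirtingerDerivAt f p 0 z := by
  unfold HasWirtingerDerivAt
  convert h.complexToReal_fderiv using 1
  ext
  simp

lemma congr_deriv (h : HasWirtingerDerivAt f p q z) (hp : p = p') (hq : q = q') :
    HasWirtingerDerivAt f p' q' z := hp ▸ hq ▸ h

lemma conj_comp (h : HasWirtingerDerivAt f p q z) :
    HasWirtingerDerivAt (fun u => conj (f u)) (conj q) (conj p) z := by
  unfold HasWirtingerDerivAt
  refine ((Complex.conjCLE : ℂ →L[ℝ] ℂ).hasFDerivAt.comp z h).congr_fderiv ?_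
  ext
  simp [add_comm]

lemma add (hf : HasWirtingerDerivAt f p q z) (hg : HasWirtingerDerivAt g p' q' z) :
    HasWirtingerDerivAt (fun u => f u + g u) (p + p') (q + q') z := by
  unfold HasWirtingerDerivAt
  refine (HasFDerivAt.add hf hg).congr_fderiv ?_
  ext
  simp
  ring

lemma neg (hf : HasWirtingerDerivAt f p q z) :
    HasWirtingerDerivAt (fun u => -f u) (-p) (-q) z := by
  unfold HasWirtingerDerivAt
  refine (HasFDerivAt.neg hf).congr_fderiv ?_
  ext
  simp
  ring

lemma mul (hf : HasWirtingerDerivAt f p q z) (hg : HasWirtingerDerivAt g p' q' z) :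
    HasWirtingerDerivAt (fun u => f u * g u) (p * g z + f z * p') (q * g z + f z * q') z := by
  unfold HasWirtingerDerivAt
  refine (HasFDerivAt.mul hf hg).congr_fderiv ?_
  ext
  simp
  ring

lemma inv (hf : HasWirtingerDerivAt f p q z) (h0 : f z ≠ 0) :
    HasWirtingerDerivAt (fun u => (f u)⁻¹) (-(f z)⁻¹ ^ 2 * p) (-(f z)⁻¹ ^ 2 * q) z := by
  unfold HasWirtingerDerivAt
  refine (((hasDerivAt_inv h0).complexToReal_fderiv).comp z hf).congr_fderiv ?_
  ext
  simp
  ring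

/-- The derivative along a line. -/
lemma hasDerivAt_line (hf : HasWirtingerDerivAt f p q z) (e : ℂ) :
    HasDerivAt (fun t : ℝ => f (z + t * e)) (p * e + q * conj e) 0 := by
  have h1 : HasDerivAt (fun t : ℝ => z + t * e) e 0 := by
    simpa using ((Complex.ofRealCLM.hasDerivAt (x := (0:ℝ))).mul_const e).const_add z
  have h2 : HasFDerivAt f (p • (ContinuousLinearMap.id ℝ ℂ) + q • (Complex.conjCLE : ℂ →L[ℝ] ℂ))
      ((fun t : ℝ => z + t * e) 0) := by simpa [HasWirtingerDerivAt] using hf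
  exact (h2.comp_hasDerivAt (0 : ℝ) h1).congr_deriv (by simp)

end HasWirtingerDerivAt

/-! ### Holomorphic lifts of a surface -/

/-- The entries of a holomorphic null immersion into `SL₂(ℂ)` which represents the surface `X`
around `z`. -/
structure IsNullLift (X : ℂ → ℂ × ℝ) (A B C D : ℂ → ℂ) (z : ℂ) : Prop where
  analytic_A : AnalyticAt ℂ A z
  analytic_B : AnalyticAt ℂ B z
  analytic_C : AnalyticAt ℂ C z
  analytic_D : AnalyticAt ℂ D z
  det_eq : ∀ᶠ u in 𝓝 z, A u * D u - B u * C u = 1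
  null : ∀ᶠ u in 𝓝 z, deriv A u * deriv D u - deriv B u * deriv C u = 0
  immersed : ∀ᶠ u in 𝓝 z,
    ¬ (deriv A u = 0 ∧ deriv B u = 0 ∧ deriv C u = 0 ∧ deriv D u = 0)
  eq_X : ∀ᶠ u in 𝓝 z, X u = ofMinkowski
    (!![A u, B u; C u, D u] * (!![A u, B u; C u, D u])ᴴ)

lemma ofMinkowski_mul_conjTranspose (a b c d : ℂ) :
    ofMinkowski (!![a, b; c, d] * (!![a, b; c, d])ᴴ) =
      ((conj a * c + conj b * d) * (a * conj a + b * conj b)⁻¹,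
        ((a * conj a + b * conj b)⁻¹).re) := by
  have h : a * conj a + b * conj b = ((Complex.normSq a + Complex.normSq b : ℝ) : ℂ) := by
    rw [Complex.mul_conj, Complex.mul_conj]; push_cast; ring
  simp only [ofMinkowski, Matrix.mul_apply, Fin.sum_univ_two, Matrix.conjTranspose_apply,
    Matrix.of_apply, Matrix.cons_val', Matrix.cons_val_zero, Matrix.cons_val_one,
    Matrix.cons_val_fin_one, Complex.star_def]
  rw [h, ← Complex.ofReal_inv, Complex.ofReal_re, Complex.ofReal_re, div_eq_mul_inv,
    Complex.ofReal_inv]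
  ext1
  · simp only; ring
  · rfl

lemma normSq_row_pos {a b c d : ℂ} (h : a * d - b * c = 1) :
    0 < Complex.normSq a + Complex.normSq b := by
  by_cases ha : a = 0
  · have hb : b ≠ 0 := by rintro rfl; simp [ha] at h
    exact add_pos_of_nonneg_of_pos (Complex.normSq_nonneg _) (Complex.normSq_pos.2 hb)
  · exact add_pos_of_pos_of_nonneg (Complex.normSq_pos.2 ha) (Complex.normSq_nonneg _)

lemma mul_conj_row (a b : ℂ) :
    a * conj a + b * conj b = ((Complex.normSq a + Complex.normSq b : ℝ) : ℂ) := by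
  rw [Complex.mul_conj, Complex.mul_conj]; push_cast; ring

lemma mul_conj_row_ne_zero {a b c d : ℂ} (h : a * d - b * c = 1) :
    a * conj a + b * conj b ≠ 0 := by
  rw [mul_conj_row]; exact_mod_cast (normSq_row_pos h).ne'

lemma conj_inv_row (a b : ℂ) :
    conj ((a * conj a + b * conj b)⁻¹) = (a * conj a + b * conj b)⁻¹ := by
  simp [mul_comm]

lemma fderiv_prod_re_apply {f g : ℂ → ℂ} {p q r s z : ℂ} (hf : HasWirtingerDerivAt f p q z)
    (hg : HasWirtingerDerivAt g r s z) (e : ℂ) :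
    fderiv ℝ (fun u => (f u, (g u).re)) z e = (p * e + q * conj e, (r * e + s * conj e).re) := by
  have h2 : HasFDerivAt (fun u => (g u).re) (Complex.reCLM.comp
      (r • (ContinuousLinearMap.id ℝ ℂ) + s • (Complex.conjCLE : ℂ →L[ℝ] ℂ))) z :=
    Complex.reCLM.hasFDerivAt.comp z hg
  rw [(HasFDerivAt.prodMk hf h2).fderiv]
  simp

namespace IsNullLift

variable {X : ℂ → ℂ × ℝ} {A B C D : ℂ → ℂ} {z : ℂ}

/-- The height of the surface, as a complex number. -/
def height (A B : ℂ → ℂ) (u : ℂ) : ℂ := (A u * conj (A u) + B u * conj (B u))⁻¹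

/-- The coefficient of `A dB - B dA`, where `(A, B)` is the first row of the lift. -/
def rowForm (A B : ℂ → ℂ) (u : ℂ) : ℂ := A u * deriv B u - deriv A u * B u

/-- The Wirtinger derivative `∂ζ` divided by the squared height. -/
def horizontalDeriv (A B C D : ℂ → ℂ) (u : ℂ) : ℂ :=
  conj (A u) * conj (A u) * (deriv C u * A u + -(C u * deriv A u)) +
    conj (A u) * conj (B u) *
      (deriv C u * B u + deriv D u * A u + -(C u * deriv B u + D u * deriv A u)) +
    conj (B u) * conj (B u) * (deriv D u * B u + -(D u * deriv B u))

/-- The logarithmic derivative `-∂w / w²`. -/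
def slope (A B : ℂ → ℂ) (u : ℂ) : ℂ := deriv A u * conj (A u) + deriv B u * conj (B u)

lemma eq_explicit (h : IsNullLift X A B C D z) : ∀ᶠ u in 𝓝 z, X u =
    ((conj (A u) * C u + conj (B u) * D u) * height A B u, (height A B u).re) := by
  filter_upwards [h.eq_X] with u hu
  rw [hu, ofMinkowski_mul_conjTranspose]; rfl

lemma eventually (h : IsNullLift X A B C D z) : ∀ᶠ u in 𝓝 z,
    AnalyticAt ℂ A u ∧ AnalyticAt ℂ B u ∧ AnalyticAt ℂ C u ∧ AnalyticAt ℂ D u ∧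
      A u * D u - B u * C u = 1 :=
  h.analytic_A.eventually_analyticAt.and (h.analytic_B.eventually_analyticAt.and
    (h.analytic_C.eventually_analyticAt.and (h.analytic_D.eventually_analyticAt.and h.det_eq)))

lemma hasWirtingerDerivAt_height (hA : AnalyticAt ℂ A z) (hB : AnalyticAt ℂ B z)
    (hdet : A z * D z - B z * C z = 1) :
    HasWirtingerDerivAt (height A B) (-height A B z ^ 2 * slope A B z)
      (-height A B z ^ 2 * conj (slope A B z)) z := by
  have wA := HasWirtingerDerivAt.of_hasDerivAt hA.differentiableAt.hasDerivAt
  have wB := HasWirtingerDerivAt.of_hasDerivAt hB.differentiableAt.hasDerivAt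
  refine (((wA.mul wA.conj_comp).add (wB.mul wB.conj_comp)).inv
    (mul_conj_row_ne_zero hdet)).congr_deriv ?_ ?_
  · simp [height, slope]
  · simp [height, slope]; left; ring

/-- In the `∂̄` part the second row enters only through `A D - B C = 1`. It therefore collapses to
the conjugate of a holomorphic function of the first row, and this is why `rowForm` appears. -/
lemma hasWirtingerDerivAt_horizontal (hA : AnalyticAt ℂ A z) (hB : AnalyticAt ℂ B z)
    (hC : AnalyticAt ℂ C z) (hD : AnalyticAt ℂ D z) (hdet : A z * D z - B z * C z = 1) :
    HasWirtingerDerivAt (fun u => (conj (A u) * C u + conj (B u) * D u) * height A B u)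
      (height A B z ^ 2 * horizontalDeriv A B C D z)
      (height A B z ^ 2 * conj (rowForm A B z)) z := by
  have wA := HasWirtingerDerivAt.of_hasDerivAt hA.differentiableAt.hasDerivAt
  have wB := HasWirtingerDerivAt.of_hasDerivAt hB.differentiableAt.hasDerivAt
  have wC := HasWirtingerDerivAt.of_hasDerivAt hC.differentiableAt.hasDerivAt
  have wD := HasWirtingerDerivAt.of_hasDerivAt hD.differentiableAt.hasDerivAt
  have hn := mul_conj_row_ne_zero hdet
  have hw : height A B z * (A z * conj (A z) + B z * conj (B z)) = 1 := inv_mul_cancel₀ hn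
  refine (((wA.conj_comp.mul wC).add (wB.conj_comp.mul wD)).mul
    (hasWirtingerDerivAt_height hA hB hdet)).congr_deriv ?_ ?_
  · simp only [horizontalDeriv, slope, map_zero]
    linear_combination (-(conj (A z) * deriv C z + conj (B z) * deriv D z) * height A B z) * hw
  · simp only [rowForm, slope, map_sub, map_mul, map_add, Complex.conj_conj]
    linear_combination (-(conj (deriv A z) * C z + conj (deriv B z) * D z) * height A B z) * hw
      + height A B z ^ 2 * (conj (deriv B z) * conj (A z)
        - conj (deriv A z) * conj (B z)) * hdet

lemma fderiv_apply (h : IsNullLift X A B C D z) : ∀ᶠ u in 𝓝 z, ∀ e : ℂ, fderiv ℝ X u e =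
    (height A B u ^ 2 * horizontalDeriv A B C D u * e +
        height A B u ^ 2 * conj (rowForm A B u) * conj e,
      (-height A B u ^ 2 * slope A B u * e +
        -height A B u ^ 2 * conj (slope A B u) * conj e).re) := by
  filter_upwards [h.eventually, h.eq_explicit.eventually_nhds] with u ⟨hA, hB, hC, hD, hdet⟩ hX e
  have hX' : X =ᶠ[𝓝 u] fun u => ((conj (A u) * C u + conj (B u) * D u) * height A B u,
    (height A B u).re) := hX
  rw [hX'.fderiv_eq]
  exact fderiv_prod_re_apply (hasWirtingerDerivAt_horizontal hA hB hC hD hdet)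
    (hasWirtingerDerivAt_height hA hB hdet) e

lemma height_conj (A B : ℂ → ℂ) (u : ℂ) : conj (height A B u) = height A B u :=
  conj_inv_row _ _

lemma height_eq_ofReal (A B : ℂ → ℂ) (u : ℂ) : height A B u = ((height A B u).re : ℂ) :=
  (Complex.conj_eq_iff_re.1 (height_conj A B u)).symm

lemma height_re_pos (hdet : A z * D z - B z * C z = 1) : 0 < (height A B z).re := by
  rw [height, mul_conj_row, ← Complex.ofReal_inv, Complex.ofReal_re]
  exact inv_pos.2 (normSq_row_pos hdet)

lemma height_mul (hdet : A z * D z - B z * C z = 1) :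
    height A B z * (A z * conj (A z) + B z * conj (B z)) = 1 :=
  inv_mul_cancel₀ (mul_conj_row_ne_zero hdet)

lemma deriv_det (h : IsNullLift X A B C D z) :
    deriv A z * D z + A z * deriv D z - (deriv B z * C z + B z * deriv C z) = 0 := by
  have h1 := ((h.analytic_A.differentiableAt.hasDerivAt.mul
    h.analytic_D.differentiableAt.hasDerivAt).sub (h.analytic_B.differentiableAt.hasDerivAt.mul
    h.analytic_C.differentiableAt.hasDerivAt)).deriv
  have h2 : (A * D - B * C) =ᶠ[𝓝 z] fun _ => (1 : ℂ) := h.det_eq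
  rw [← h1, h2.deriv_eq]; simp

/-- The spinor `(a, b)` of a null immersion. -/
lemma exists_spinor (h : IsNullLift X A B C D z) : ∃ a b : ℂ, (a ≠ 0 ∨ b ≠ 0) ∧
    deriv A z = b * (a * A z + b * B z) ∧ deriv B z = -a * (a * A z + b * B z) ∧
    deriv C z = b * (a * C z + b * D z) ∧ deriv D z = -a * (a * C z + b * D z) := by
  have hd := h.deriv_det
  have hdet := h.det_eq.self_of_nhds
  have hn := h.null.self_of_nhds
  -- The matrix `F⁻¹ F'` has trace zero (derivative of the determinant) and determinant zero
  -- (nullity), so it has the form `(ab, -a²; b², -ab)`. The off-diagonal entries give `a` and `b`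
  -- up to sign.
  obtain ⟨a, ha'⟩ := IsAlgClosed.exists_pow_nat_eq (-(D z * deriv B z - B z * deriv D z))
    two_pos
  obtain ⟨b₀, hb₀'⟩ := IsAlgClosed.exists_pow_nat_eq (A z * deriv C z - C z * deriv A z) two_pos
  have ha := ha'.symm
  have hb₀ := hb₀'.symm
  have hsq : (D z * deriv A z - B z * deriv C z) ^ 2 = a ^ 2 * b₀ ^ 2 := by
    rw [← ha, ← hb₀]
    linear_combination (D z * deriv A z - B z * deriv C z) * hd - (A z * D z - B z * C z) * hn
  -- The diagonal entry is known up to sign from its square; the sign of `b` is chosen to match it.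
  obtain ⟨b, hb, hab⟩ : ∃ b, A z * deriv C z - C z * deriv A z = b ^ 2 ∧
      D z * deriv A z - B z * deriv C z = a * b := by
    rw [← mul_pow] at hsq
    rcases sq_eq_sq_iff_eq_or_eq_neg.1 hsq with h1 | h1
    · exact ⟨b₀, hb₀, h1⟩
    · exact ⟨-b₀, by rw [hb₀]; ring, by rw [h1]; ring⟩
  have eA : deriv A z = b * (a * A z + b * B z) := by
    linear_combination A z * hab + B z * hb - deriv A z * hdet
  have eB : deriv B z = -a * (a * A z + b * B z) := by
    linear_combination -B z * hab - A z * ha + B z * hd - deriv B z * hdet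
  have eC : deriv C z = b * (a * C z + b * D z) := by
    linear_combination C z * hab + D z * hb - deriv C z * hdet
  have eD : deriv D z = -a * (a * C z + b * D z) := by
    linear_combination -D z * hab - C z * ha + D z * hd - deriv D z * hdet
  refine ⟨a, b, ?_, eA, eB, eC, eD⟩
  by_contra! h0
  refine h.immersed.self_of_nhds ⟨?_, ?_, ?_, ?_⟩ <;> simp [eA, eB, eC, eD, h0]

/-- The derivatives of the surface in terms of a spinor. -/
lemma spinor_formulas {a b : ℂ} (hdet : A z * D z - B z * C z = 1)
    (eA : deriv A z = b * (a * A z + b * B z)) (eB : deriv B z = -a * (a * A z + b * B z))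
    (eC : deriv C z = b * (a * C z + b * D z)) (eD : deriv D z = -a * (a * C z + b * D z)) :
    horizontalDeriv A B C D z = (b * conj (A z) - a * conj (B z)) ^ 2 ∧
    rowForm A B z = -(a * A z + b * B z) ^ 2 ∧
    slope A B z = (a * A z + b * B z) * (b * conj (A z) - a * conj (B z)) := by
  refine ⟨?_, ?_, ?_⟩
  · rw [horizontalDeriv, eA, eB, eC, eD]
    linear_combination (b * conj (A z) - a * conj (B z)) ^ 2 * hdet
  · rw [rowForm, eA, eB]; ring
  · rw [slope, eA, eB]; ring

end IsNullLift

/-! ### Second derivatives of the surface and its mean curvature vector -/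

namespace IsNullLift

variable {X : ℂ → ℂ × ℝ} {A B C D : ℂ → ℂ} {z : ℂ}

/-- Only the `∂̄` derivative has to be explicit. The `∂` derivative is multiplied by `e²` in the
second derivative along `e`, so it cancels in the sum over `e = 1` and `e = i`. -/
lemma exists_hasWirtingerDerivAt_horizontalDeriv (h : IsNullLift X A B C D z) : ∃ P : ℂ,
    HasWirtingerDerivAt (horizontalDeriv A B C D) P
      (2 * (conj (A z) * conj (deriv A z) * (deriv C z * A z - C z * deriv A z)) +
      (conj (deriv A z) * conj (B z) + conj (A z) * conj (deriv B z)) *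
      (deriv C z * B z + deriv D z * A z - (C z * deriv B z + D z * deriv A z)) +
      2 * (conj (B z) * conj (deriv B z) * (deriv D z * B z - D z * deriv B z))) z := by
  have wA := HasWirtingerDerivAt.of_hasDerivAt h.analytic_A.differentiableAt.hasDerivAt
  have wB := HasWirtingerDerivAt.of_hasDerivAt h.analytic_B.differentiableAt.hasDerivAt
  have wC := HasWirtingerDerivAt.of_hasDerivAt h.analytic_C.differentiableAt.hasDerivAt
  have wD := HasWirtingerDerivAt.of_hasDerivAt h.analytic_D.differentiableAt.hasDerivAt
  have vA := HasWirtingerDerivAt.of_hasDerivAt h.analytic_A.deriv.differentiableAt.hasDerivAt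
  have vB := HasWirtingerDerivAt.of_hasDerivAt h.analytic_B.deriv.differentiableAt.hasDerivAt
  have vC := HasWirtingerDerivAt.of_hasDerivAt h.analytic_C.deriv.differentiableAt.hasDerivAt
  have vD := HasWirtingerDerivAt.of_hasDerivAt h.analytic_D.deriv.differentiableAt.hasDerivAt
  refine ⟨_, ((((wA.conj_comp.mul wA.conj_comp).mul ((vC.mul wA).add (wC.mul vA).neg)).add
    ((wA.conj_comp.mul wB.conj_comp).mul (((vC.mul wB).add (vD.mul wA)).add
      ((wC.mul vB).add (wD.mul vA)).neg))).add
    ((wB.conj_comp.mul wB.conj_comp).mul ((vD.mul wB).add (wD.mul vB).neg))).congr_deriv rfl ?_⟩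
  ring

lemma exists_hasWirtingerDerivAt_slope (h : IsNullLift X A B C D z) : ∃ P : ℂ,
    HasWirtingerDerivAt (slope A B) P
      (deriv A z * conj (deriv A z) + deriv B z * conj (deriv B z)) z := by
  have wA := HasWirtingerDerivAt.of_hasDerivAt h.analytic_A.differentiableAt.hasDerivAt
  have wB := HasWirtingerDerivAt.of_hasDerivAt h.analytic_B.differentiableAt.hasDerivAt
  have vA := HasWirtingerDerivAt.of_hasDerivAt h.analytic_A.deriv.differentiableAt.hasDerivAt
  have vB := HasWirtingerDerivAt.of_hasDerivAt h.analytic_B.deriv.differentiableAt.hasDerivAt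
  refine ⟨_, ((vA.mul wA.conj_comp).add (vB.mul wB.conj_comp)).congr_deriv rfl ?_⟩
  ring

lemma exists_hasWirtingerDerivAt_rowForm (h : IsNullLift X A B C D z) : ∃ P : ℂ,
    HasWirtingerDerivAt (rowForm A B) P 0 z :=
  ⟨_, .of_hasDerivAt ((h.analytic_A.mul h.analytic_B.deriv).sub
    (h.analytic_A.deriv.mul h.analytic_B)).differentiableAt.hasDerivAt⟩

lemma deriv_fderiv_line {p₁ q₁ p₂ q₂ : ℂ → ℂ} {P₁ Q₁ P₂ Q₂ P₃ Q₃ P₄ Q₄ : ℂ}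
    (hX : ∀ᶠ u in 𝓝 z, ∀ e : ℂ, fderiv ℝ X u e =
      (p₁ u * e + q₁ u * conj e, (p₂ u * e + q₂ u * conj e).re))
    (h₁ : HasWirtingerDerivAt p₁ P₁ Q₁ z) (h₂ : HasWirtingerDerivAt q₁ P₂ Q₂ z)
    (h₃ : HasWirtingerDerivAt p₂ P₃ Q₃ z) (h₄ : HasWirtingerDerivAt q₂ P₄ Q₄ z) (e : ℂ) :
    deriv (fun t : ℝ => fderiv ℝ X (z + t * e) e) 0 =
      ((P₁ * e + Q₁ * conj e) * e + (P₂ * e + Q₂ * conj e) * conj e,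
        ((P₃ * e + Q₃ * conj e) * e + (P₄ * e + Q₄ * conj e) * conj e).re) := by
  have ht : Filter.Tendsto (fun t : ℝ => z + t * e) (𝓝 0) (𝓝 z) := by
    have : Continuous (fun t : ℝ => z + t * e) := by fun_prop
    simpa using this.tendsto 0
  have heq := (ht.eventually hX).mono fun t ht => ht e
  rw [Filter.EventuallyEq.deriv_eq heq]
  refine HasDerivAt.deriv (HasDerivAt.prodMk ?_ ?_)
  · exact ((h₁.hasDerivAt_line e).mul_const e).add ((h₂.hasDerivAt_line e).mul_const (conj e))
  · exact Complex.reCLM.hasFDerivAt.comp_hasDerivAt (0 : ℝ)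
      (((h₃.hasDerivAt_line e).mul_const e).add ((h₄.hasDerivAt_line e).mul_const (conj e)))

end IsNullLift

/-- First and second order data of a conformal immersion of mean curvature one at a point,
in terms of the spinors `p`, `q`. -/
structure HasSpinors (X : ℂ → ℂ × ℝ) (p q z : ℂ) : Prop where
  height_pos : 0 < (X z).2
  ne_zero : 0 < Complex.normSq p + Complex.normSq q
  fderiv_apply : ∀ e : ℂ, fderiv ℝ X z e =
    (((X z).2 : ℂ) ^ 2 * (q ^ 2 * e - conj p ^ 2 * conj e),
      -2 * (X z).2 ^ 2 * (p * q * e).re)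
  laplacian : covAccel X z 1 + covAccel X z Complex.I =
    (2 * (X z).2 ^ 3 * (Complex.normSq p + Complex.normSq q)) •
      ((2 * conj p * q, Complex.normSq q - Complex.normSq p) : ℂ × ℝ)

/-- With `(a, b)` the spinor of the lift, the new spinors are `p = aA + bB` and `q = b Ā - a B̄`.
They arise from `(a, b)` by a similarity of factor `(|A|² + |B|²)^(1/2)`, up to conjugations, and in
terms of `p`, `q` and the height the second row of the lift disappears. -/
lemma IsNullLift.exists_hasSpinors {X : ℂ → ℂ × ℝ} {A B C D : ℂ → ℂ} {z : ℂ}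
    (h : IsNullLift X A B C D z) : ∃ p q, HasSpinors X p q z := by
  obtain ⟨a, b, hab, eA, eB, eC, eD⟩ := h.exists_spinor
  have hdet := h.det_eq.self_of_nhds
  obtain ⟨f1, f2, f3⟩ := spinor_formulas hdet eA eB eC eD
  set p := a * A z + b * B z with hp
  set q := b * conj (A z) - a * conj (B z) with hq
  have hX := h.eq_explicit.self_of_nhds
  have hw : (X z).2 = (height A B z).re := by rw [hX]
  have hwc : ((X z).2 : ℂ) = height A B z := by rw [hw, ← height_eq_ofReal]
  have hpos : 0 < (X z).2 := hw ▸ height_re_pos hdet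
  have hpq : p * conj p + q * conj q =
      (a * conj a + b * conj b) * (A z * conj (A z) + B z * conj (B z)) := by
    simp only [hp, hq, map_add, map_sub, map_mul, Complex.conj_conj]; ring
  have hfd : ∀ e : ℂ, fderiv ℝ X z e = (((X z).2 : ℂ) ^ 2 * (q ^ 2 * e - conj p ^ 2 * conj e),
      -2 * (X z).2 ^ 2 * (p * q * e).re) := by
    intro e
    rw [h.fderiv_apply.self_of_nhds e, f1, f2, f3, ← hwc]
    ext1
    · simp only [map_neg, map_pow]; ring
    · have : -((X z).2 : ℂ) ^ 2 * (p * q) * e + -((X z).2 : ℂ) ^ 2 * conj (p * q) * conj e =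
          ((-(X z).2 ^ 2 : ℝ) : ℂ) * (p * q * e + conj (p * q * e)) := by
        simp only [map_mul]; push_cast; ring
      simp only
      rw [this, Complex.re_ofReal_mul, Complex.add_conj, Complex.ofReal_re]; ring
  have hS : 0 < Complex.normSq p + Complex.normSq q := by
    have h1 := hpq
    rw [mul_conj_row, mul_conj_row, mul_conj_row] at h1
    have h2 : Complex.normSq p + Complex.normSq q = (Complex.normSq a + Complex.normSq b) *
        (Complex.normSq (A z) + Complex.normSq (B z)) := by exact_mod_cast h1
    rw [h2]
    refine mul_pos ?_ (normSq_row_pos hdet)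
    rcases hab with h0 | h0
    · exact add_pos_of_pos_of_nonneg (Complex.normSq_pos.2 h0) (Complex.normSq_nonneg _)
    · exact add_pos_of_nonneg_of_pos (Complex.normSq_nonneg _) (Complex.normSq_pos.2 h0)
  refine ⟨p, q, hpos, hS, hfd, ?_⟩
  obtain ⟨P₁, g1⟩ := h.exists_hasWirtingerDerivAt_horizontalDeriv
  obtain ⟨P₂, g2⟩ := h.exists_hasWirtingerDerivAt_rowForm
  obtain ⟨P₃, g3⟩ := h.exists_hasWirtingerDerivAt_slope
  have gh := hasWirtingerDerivAt_height h.analytic_A h.analytic_B hdet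
  have gh2 : HasWirtingerDerivAt (fun u => height A B u ^ 2)
      (-2 * height A B z ^ 3 * slope A B z) (-2 * height A B z ^ 3 * conj (slope A B z)) z := by
    simp only [pow_two]
    exact (gh.mul gh).congr_deriv (by ring) (by ring)
  have hacc := deriv_fderiv_line h.fderiv_apply (gh2.mul g1) (gh2.mul g2.conj_comp)
    (gh2.neg.mul g3) (gh2.neg.mul g3.conj_comp)
  -- The second derivatives bring in `|a|² + |b|²`; this expresses it by `p`, `q` and the height
  -- alone.
  have hSw : ((Complex.normSq p + Complex.normSq q : ℝ) : ℂ) * height A B z =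
      a * conj a + b * conj b := by
    rw [← mul_conj_row, hpq, mul_assoc, mul_comm (_ + _) (height A B z), height_mul hdet, mul_one]
  have hQ1 : 2 * (conj (A z) * conj (deriv A z) * (deriv C z * A z - C z * deriv A z)) +
      (conj (deriv A z) * conj (B z) + conj (A z) * conj (deriv B z)) *
      (deriv C z * B z + deriv D z * A z - (C z * deriv B z + D z * deriv A z)) +
      2 * (conj (B z) * conj (deriv B z) * (deriv D z * B z - D z * deriv B z)) =
      2 * q * conj p * (a * conj a + b * conj b) := by
    rw [eA, eB, eC, eD]
    simp only [map_mul, map_neg]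
    linear_combination (2 * q * conj p * (a * conj a + b * conj b)) * hdet
  have hQ3 : deriv A z * conj (deriv A z) + deriv B z * conj (deriv B z) =
      (a * conj a + b * conj b) * (p * conj p) := by
    rw [eA, eB]; simp only [map_mul, map_neg]; ring
  rw [hQ1, f1, f2, f3, hQ3, ← hSw, ← hwc] at hacc
  have hw0 : ((X z).2 : ℂ) ≠ 0 := by exact_mod_cast hpos.ne'
  have hw1 : (X z).2 ≠ 0 := hpos.ne'
  simp only [covAccel, christoffel, hacc, hfd, Complex.star_def, map_one, Complex.conj_I]
  -- Everything is now expressed by the height, `p`, `q`, their conjugates and the unspecified `P₁`,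
  -- `P₂`, `P₃`. With real parts written as `(x + x̄)/2`, each component is a polynomial identity
  -- modulo `I² = -1`, in which the `Pᵢ` cancel.
  clear_value p q
  clear hacc hQ1 hQ3 f1 f2 f3 eA eB eC eD hSw gh gh2 g1 g2 g3 hwc hw hfd
  generalize (X z).2 = w at *
  ext1
  · simp only [Prod.fst_add, Prod.smul_fst, Complex.real_smul, Complex.ofReal_div,
      Complex.ofReal_mul, Complex.ofReal_pow, Complex.re_eq_add_conj, Complex.ofReal_add,
      Complex.normSq_eq_conj_mul_self, Complex.ofReal_neg, Complex.ofReal_ofNat, map_neg, map_mul,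
      map_pow, map_zero, Complex.conj_I, Complex.conj_conj, mul_one]
    field_simp
    ring_nf
    simp only [Complex.I_sq]
    ring
  · apply Complex.ofReal_injective
    simp only [Prod.snd_add, Prod.smul_snd, smul_eq_mul, Complex.ofReal_div,
      Complex.ofReal_mul, Complex.ofReal_pow, Complex.re_eq_add_conj, Complex.ofReal_add,
      Complex.ofReal_sub, map_sub, map_add, Complex.conj_ofReal,
      Complex.normSq_eq_conj_mul_self, Complex.ofReal_neg, Complex.ofReal_ofNat, map_neg, map_mul,
      map_pow, map_zero, map_ofNat, Complex.conj_I, Complex.conj_conj, mul_one]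
    field_simp
    ring_nf
    simp only [Complex.I_sq]
    ring

namespace HasSpinors

variable {X : ℂ → ℂ × ℝ} {p q z : ℂ}

/-- The surface is conformally parametrized. -/
lemma hypInner_fderiv (h : HasSpinors X p q z) (e f : ℂ) :
    hypInner (X z) (fderiv ℝ X z e) (fderiv ℝ X z f) =
      ((X z).2 * (Complex.normSq p + Complex.normSq q)) ^ 2 * (star e * f).re := by
  have hw := h.height_pos.ne'
  rw [hypInner, h.fderiv_apply, h.fderiv_apply]
  generalize (X z).2 = w at *
  rw [div_eq_iff (pow_ne_zero 2 hw)]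
  apply Complex.ofReal_injective
  simp only [Complex.star_def, Complex.re_eq_add_conj, Complex.ofReal_mul, Complex.ofReal_pow,
    Complex.ofReal_add, Complex.ofReal_neg, Complex.ofReal_ofNat, map_mul, map_sub, map_pow,
    Complex.conj_conj, Complex.conj_ofReal, Complex.normSq_eq_conj_mul_self]
  ring

/-- The vector `(2 p̄ q, |q|² - |p|²)` has Euclidean length `|p|² + |q|²`, so the mean curvature
vector has Euclidean length equal to the height, that is, hyperbolic length one. -/
lemma meanCurvatureVector_eq (h : HasSpinors X p q z) : meanCurvatureVector X z =
    ((X z).2 / (Complex.normSq p + Complex.normSq q)) •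
      ((2 * conj p * q, Complex.normSq q - Complex.normSq p) : ℂ × ℝ) := by
  have hw := h.height_pos.ne'
  have hS := h.ne_zero.ne'
  rw [meanCurvatureVector, h.hypInner_fderiv, h.laplacian, smul_smul]
  congr 1
  simp only [star_one, mul_one, Complex.one_re]
  field_simp

/-- The mean curvature vector gives the tangent plane the direct orientation. -/
lemma det3_meanCurvatureVector (h : HasSpinors X p q z) (e f : ℂ) :
    det3 (fderiv ℝ X z e) (fderiv ℝ X z f) (-meanCurvatureVector X z) =
      -((X z).2 ^ 5 * (Complex.normSq p + Complex.normSq q) ^ 2) * (star e * f).im := by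
  have hw := h.height_pos.ne'
  have hS := h.ne_zero.ne'
  rw [h.meanCurvatureVector_eq, h.fderiv_apply, h.fderiv_apply, det3, Matrix.det_fin_three]
  generalize (X z).2 = w at *
  have hk := div_mul_cancel₀ w hS
  generalize w / (Complex.normSq p + Complex.normSq q) = k at *
  simp only [Matrix.of_apply, Matrix.cons_val', Matrix.cons_val_zero, Matrix.cons_val_one,
    Matrix.cons_val_fin_one, Matrix.cons_val, Prod.fst_neg, Prod.snd_neg, Prod.smul_fst,
    Prod.smul_snd, smul_eq_mul, Complex.neg_re, Complex.neg_im, Complex.smul_re, Complex.smul_im,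
    Complex.star_def, ← Complex.ofReal_pow, Complex.re_ofReal_mul, Complex.im_ofReal_mul]
  simp only [pow_two, Complex.mul_re, Complex.mul_im, Complex.sub_re, Complex.sub_im,
    Complex.conj_re, Complex.conj_im, Complex.re_ofNat, Complex.im_ofNat, Complex.normSq_apply]
    at hk ⊢
  linear_combination (-w ^ 4 * (p.re * p.re + p.im * p.im + (q.re * q.re + q.im * q.im)) ^ 2 *
    (e.re * f.im - e.im * f.re)) * hk

end HasSpinors

/-! ### Killing fields -/

/-- The Killing field of hyperbolic space given by the infinitesimal isometry `N ↦ ξ N + N ξ*`,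
for a matrix `ξ` of trace zero. -/
def killingField (ξ : Matrix (Fin 2) (Fin 2) ℂ) (p : ℂ × ℝ) : ℂ × ℝ :=
  (ξ 1 0 - 2 * ξ 0 0 * p.1 - ξ 0 1 * p.1 ^ 2 + p.2 ^ 2 * conj (ξ 0 1),
    -2 * p.2 * (ξ 0 0 + ξ 0 1 * p.1).re)

/-- The trace of `ξ (dF) F⁻¹` in terms of the coefficients of `D dC - C dD`, `C dB - D dA` and
`B dA - A dB`. -/
def pairing (ξ : Matrix (Fin 2) (Fin 2) ℂ) (f₀ f₁ f₂ : ℂ) : ℂ :=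
  f₀ * ξ 0 1 - 2 * f₁ * ξ 0 0 - f₂ * ξ 1 0

/-- The flux density of a Killing field for a tangent map with given Wirtinger derivatives. -/
lemma flux_density_aux (ξ : Matrix (Fin 2) (Fin 2) ℂ) (p : ℂ × ℝ) (hp : p.2 ≠ 0)
    (H L s e : ℂ) :
    -hypInner p (p.2 ^ 2 * H * (Complex.I * e) + p.2 ^ 2 * conj L * conj (Complex.I * e),
        (-(p.2 : ℂ) ^ 2 * s * (Complex.I * e) +
          -(p.2 : ℂ) ^ 2 * conj s * conj (Complex.I * e)).re) (killingField ξ p) -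
      hypInner p (killingField (Complex.I • ξ) p) (p.2 ^ 2 * H * e + p.2 ^ 2 * conj L * conj e,
        (-(p.2 : ℂ) ^ 2 * s * e + -(p.2 : ℂ) ^ 2 * conj s * conj e).re) =
    2 * (e * (L * (ξ 1 0 - 2 * ξ 0 0 * p.1 - ξ 0 1 * p.1 ^ 2) + p.2 ^ 2 * H * ξ 0 1 +
      2 * p.2 * s * (ξ 0 0 + ξ 0 1 * p.1))).im := by
  obtain ⟨x, w⟩ := p
  simp only at hp
  have hw : (w : ℂ) ≠ 0 := by exact_mod_cast hp
  have him (a : ℂ) : (a.im : ℂ) = -Complex.I * (a - conj a) / 2 := by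
    rw [Complex.sub_conj]; push_cast; linear_combination (a.im : ℂ) * Complex.I_sq
  apply Complex.ofReal_injective
  simp only [hypInner, killingField, Matrix.smul_apply, smul_eq_mul, Complex.star_def,
    Complex.ofReal_sub, Complex.ofReal_neg, Complex.ofReal_div, Complex.ofReal_add,
    Complex.ofReal_mul, Complex.ofReal_pow, Complex.ofReal_ofNat, him, Complex.re_eq_add_conj,
    map_add, map_sub, map_mul, map_neg, map_pow, map_ofNat, Complex.conj_conj, Complex.conj_I,
    Complex.conj_ofReal]
  field_simp
  ring

open IsNullLift in
/-- The flux density is the imaginary part of a holomorphic form. -/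
lemma IsNullLift.flux_density {X : ℂ → ℂ × ℝ} {A B C D : ℂ → ℂ} {z : ℂ}
    (h : IsNullLift X A B C D z) (ξ : Matrix (Fin 2) (Fin 2) ℂ) (e : ℂ) :
    -hypInner (X z) (fderiv ℝ X z (Complex.I * e)) (killingField ξ (X z)) -
      hypInner (X z) (killingField (Complex.I • ξ) (X z)) (fderiv ℝ X z e) =
    2 * (e * pairing ξ (D z * deriv C z - C z * deriv D z) (C z * deriv B z - D z * deriv A z)
      (B z * deriv A z - A z * deriv B z)).im := by
  have hdet := h.det_eq.self_of_nhds
  have hw := height_mul hdet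
  have hX := h.eq_explicit.self_of_nhds
  have hw1 : (X z).2 = (height A B z).re := by rw [hX]
  have hwc : ((X z).2 : ℂ) = height A B z := by rw [hw1, ← height_eq_ofReal]
  have hz : (X z).1 = (conj (A z) * C z + conj (B z) * D z) * (X z).2 := by
    rw [hwc]; rw [hX]
  rw [← hwc] at hw
  have hw0 : (X z).2 ≠ 0 := hw1 ▸ (height_re_pos hdet).ne'
  have hd := h.deriv_det
  rw [h.fderiv_apply.self_of_nhds, h.fderiv_apply.self_of_nhds, ← hwc, flux_density_aux ξ _ hw0]
  congr 3
  -- The conjugates of the entries are eliminated by three relations: `w (|A|² + |B|²) = 1`, the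
  -- determinant relation and its derivative. `key` is the multiple of the determinant relation that
  -- is needed.
  have key : (2 * ξ 0 0 * (X z).2 * slope A B z + ξ 0 1 * (X z).2 ^ 2 * (horizontalDeriv A B C D z +
      2 * slope A B z * (conj (A z) * C z + conj (B z) * D z))) *
      (A z * D z - B z * C z - 1) = 0 := by rw [hdet]; ring
  simp only [slope, horizontalDeriv] at key
  rw [pairing, hz, rowForm, slope, horizontalDeriv]
  linear_combination (2 * ξ 0 0 * (D z * deriv A z - C z * deriv B z) +
      ξ 0 1 * ((X z).2 * (A z * conj (A z) + B z * conj (B z)) + 1) *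
        (D z * deriv C z - C z * deriv D z)) * hw - key +
    ξ 0 1 * (X z).2 ^ 2 * (A z * conj (A z) + B z * conj (B z)) *
      (conj (A z) * C z + conj (B z) * D z) * hd

open MeasureTheory Set

/-! ### Stokes' theorem -/

section Stokes

variable {V W : Type*} [NormedAddCommGroup V] [NormedSpace ℝ V] [NormedAddCommGroup W]
  [NormedSpace ℝ W]

/-- The exterior derivative of a one-form. -/
def extDeriv₂ (a : V → V →L[ℝ] W) (p u v : V) : W :=
  fderiv ℝ a p u v - fderiv ℝ a p v u

lemma extDeriv₂_lincomb (a : V → V →L[ℝ] W) (p u v : V) (α β γ δ : ℝ) :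
    extDeriv₂ a p (α • u + β • v) (γ • u + δ • v) = (α * δ - β * γ) • extDeriv₂ a p u v := by
  simp only [extDeriv₂, map_add, map_smul, add_apply,
    smul_apply]
  module

/-- The coefficient of the pulled back form contains `dh`, hence the need for `h` of class `C²`. The
first summand carries the second derivative of `h`, the second one the derivative of the form. -/
lemma hasFDerivAt_pullback {U : Set V} (hU : IsOpen U) {a : V → V →L[ℝ] W}
    (ha : ContDiffOn ℝ 1 a U) {h : ℝ × ℝ → V} (hh : ContDiff ℝ 2 h) {x : ℝ × ℝ} (hx : h x ∈ U)
    (v : ℝ × ℝ) : HasFDerivAt (fun y => a (h y) (fderiv ℝ h y v))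
      ((a (h x)).comp ((fderiv ℝ (fderiv ℝ h) x).flip v) +
        ((fderiv ℝ a (h x)).comp (fderiv ℝ h x)).flip (fderiv ℝ h x v)) x := by
  have h1 : HasFDerivAt (fun y => a (h y)) ((fderiv ℝ a (h x)).comp (fderiv ℝ h x)) x :=
    ((ha.differentiableOn one_ne_zero).differentiableAt (hU.mem_nhds hx)).hasFDerivAt.comp x
      (hh.differentiable two_ne_zero x).hasFDerivAt
  have h2 : HasFDerivAt (fderiv ℝ h) (fderiv ℝ (fderiv ℝ h) x) x :=
    ((hh.fderiv_right (m := 1) (by norm_num)).differentiable one_ne_zero x).hasFDerivAt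
  have h3 : HasFDerivAt (fun y => fderiv ℝ h y v) ((fderiv ℝ (fderiv ℝ h) x).flip v) x := by
    refine (h2.clm_apply (hasFDerivAt_const v x)).congr_fderiv ?_
    ext <;> simp
  exact h1.clm_apply h3

lemma continuousOn_pullback {U : Set V} {a : V → V →L[ℝ] W}
    (ha : ContDiffOn ℝ 1 a U) {h : ℝ × ℝ → V} (hh : ContDiff ℝ 2 h) {S : Set (ℝ × ℝ)}
    (hS : MapsTo h S U) (v : ℝ × ℝ) : ContinuousOn (fun y => a (h y) (fderiv ℝ h y v)) S :=
  (ha.continuousOn.comp hh.continuous.continuousOn hS).clm_apply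
    ((hh.continuous_fderiv two_ne_zero).clm_apply continuous_const).continuousOn

lemma continuousOn_extDeriv₂ {U : Set V} (hU : IsOpen U) {a : V → V →L[ℝ] W}
    (ha : ContDiffOn ℝ 1 a U) {T : Type*} [TopologicalSpace T] {h u v : T → V} {S : Set T}
    (hh : ContinuousOn h S) (hu : ContinuousOn u S) (hv : ContinuousOn v S)
    (hS : MapsTo h S U) : ContinuousOn (fun y => extDeriv₂ a (h y) (u y) (v y)) S := by
  have h1 : ContinuousOn (fun y => fderiv ℝ a (h y)) S :=
    (ha.continuousOn_fderiv_of_isOpen hU le_rfl).comp hh hS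
  exact ((h1.clm_apply hu).clm_apply hv).sub ((h1.clm_apply hv).clm_apply hu)

/-- Stokes' theorem for a map of a rectangle. -/
lemma stokes_rectangle {U : Set V} (hU : IsOpen U) {a : V → V →L[ℝ] W}
    (ha : ContDiffOn ℝ 1 a U) {h : ℝ × ℝ → V} (hh : ContDiff ℝ 2 h) (a₁ b₁ a₂ b₂ : ℝ)
    (hS : MapsTo h (uIcc a₁ b₁ ×ˢ uIcc a₂ b₂) U) :
    (∫ x in a₁..b₁, ∫ y in a₂..b₂,
      extDeriv₂ a (h (x, y)) (fderiv ℝ h (x, y) (1, 0)) (fderiv ℝ h (x, y) (0, 1))) =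
    (∫ x in a₁..b₁, a (h (x, a₂)) (fderiv ℝ h (x, a₂) (1, 0))) -
      (∫ x in a₁..b₁, a (h (x, b₂)) (fderiv ℝ h (x, b₂) (1, 0))) +
      (∫ y in a₂..b₂, a (h (b₁, y)) (fderiv ℝ h (b₁, y) (0, 1))) -
      ∫ y in a₂..b₂, a (h (a₁, y)) (fderiv ℝ h (a₁, y) (0, 1)) := by
  have hsub : Ioo (min a₁ b₁) (max a₁ b₁) ×ˢ Ioo (min a₂ b₂) (max a₂ b₂) ⊆
      uIcc a₁ b₁ ×ˢ uIcc a₂ b₂ := prod_mono Ioo_subset_Icc_self Ioo_subset_Icc_self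
  -- The divergence of the field `(a(∂₂h), -a(∂₁h))`: the second derivatives of `h` cancel by
  -- symmetry, and what remains is the pullback of `da`.
  have key (x : ℝ × ℝ) : ((a (h x)).comp ((fderiv ℝ (fderiv ℝ h) x).flip (0, 1)) +
        ((fderiv ℝ a (h x)).comp (fderiv ℝ h x)).flip (fderiv ℝ h x (0, 1))) (1, 0) +
      (-((a (h x)).comp ((fderiv ℝ (fderiv ℝ h) x).flip (1, 0)) +
        ((fderiv ℝ a (h x)).comp (fderiv ℝ h x)).flip (fderiv ℝ h x (1, 0)))) (0, 1) =
      extDeriv₂ a (h x) (fderiv ℝ h x (1, 0)) (fderiv ℝ h x (0, 1)) := by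
    have hs := (hh.contDiffAt (x := x)).isSymmSndFDerivAt (by simp)
    simp only [add_apply, ContinuousLinearMap.comp_apply,
      ContinuousLinearMap.flip_apply, neg_apply, extDeriv₂]
    rw [hs.eq (1, 0) (0, 1)]
    abel
  have := integral2_divergence_prod_of_hasFDerivAt (fun y => a (h y) (fderiv ℝ h y (0, 1)))
    (fun y => -(a (h y) (fderiv ℝ h y (1, 0)))) _ _ a₁ a₂ b₁ b₂
    (continuousOn_pullback ha hh hS _) (continuousOn_pullback ha hh hS _).neg
    (fun x hx => hasFDerivAt_pullback hU ha hh (hS (hsub hx)) _)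
    (fun x hx => (hasFDerivAt_pullback hU ha hh (hS (hsub hx)) _).neg) (by
      simp only [key]
      refine ContinuousOn.integrableOn_compact (isCompact_uIcc.prod isCompact_uIcc) ?_
      exact continuousOn_extDeriv₂ hU ha hh.continuous.continuousOn
        ((hh.continuous_fderiv two_ne_zero).clm_apply continuous_const).continuousOn
        ((hh.continuous_fderiv two_ne_zero).clm_apply continuous_const).continuousOn hS)
  simp only [key] at this
  rw [this]
  simp only [intervalIntegral.integral_neg]
  abel

end Stokes

lemma hasDerivAt_slice_left {V : Type*} [NormedAddCommGroup V] [NormedSpace ℝ V] {h : ℝ × ℝ → V}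
    (hh : Differentiable ℝ h) (s t : ℝ) :
    HasDerivAt (fun s => h (s, t)) (fderiv ℝ h (s, t) (1, 0)) s :=
  (hh (s, t)).hasFDerivAt.comp_hasDerivAt s ((hasDerivAt_id s).prodMk (hasDerivAt_const s t))

lemma hasDerivAt_slice_right {V : Type*} [NormedAddCommGroup V] [NormedSpace ℝ V] {h : ℝ × ℝ → V}
    (hh : Differentiable ℝ h) (s t : ℝ) :
    HasDerivAt (fun t => h (s, t)) (fderiv ℝ h (s, t) (0, 1)) t :=
  (hh (s, t)).hasFDerivAt.comp_hasDerivAt t ((hasDerivAt_const t s).prodMk (hasDerivAt_id t))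

/-- The integral of a holomorphic form over closed curves is invariant under free homotopies. -/
lemma integral_eq_of_homotopy {U : Set ℂ} (hU : IsOpen U) {f : ℂ → ℂ}
    (hf : DifferentiableOn ℂ f U) {h : ℝ × ℝ → ℂ} (hh : ContDiff ℝ 2 h) {T : ℝ}
    (hS : ∀ s ∈ Icc (0 : ℝ) 1, ∀ t, h (s, t) ∈ U ∧ h (s, t + T) = h (s, t)) :
    ∫ t in (0 : ℝ)..T, f (h (0, t)) * deriv (fun t => h (0, t)) t =
      ∫ t in (0 : ℝ)..T, f (h (1, t)) * deriv (fun t => h (1, t)) t := by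
  set a : ℂ → ℂ →L[ℝ] ℂ := fun z => f z • ContinuousLinearMap.id ℝ ℂ with ha
  have hd := hh.differentiable two_ne_zero
  have hac : ContDiffOn ℝ 1 a U :=
    ((hf.contDiffOn (n := 1) hU).restrict_scalars ℝ).smul contDiffOn_const
  -- The derivative of `f` is complex linear, so `d(f dz)(u, v) = f' u v - f' v u = 0`.
  have hclosed : ∀ p ∈ U, ∀ u v, extDeriv₂ a p u v = 0 := by
    intro p hp u v
    have h1 := ((hf.differentiableAt (hU.mem_nhds hp)).hasDerivAt.complexToReal_fderiv).smul_const
      (ContinuousLinearMap.id ℝ ℂ)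
    rw [extDeriv₂, show fderiv ℝ a p = _ from h1.fderiv]
    simp only [ContinuousLinearMap.smulRight_apply, smul_apply,
      ContinuousLinearMap.id_apply, smul_eq_mul, one_apply_eq_self]
    ring
  have hst := stokes_rectangle hU hac hh 0 1 0 T (fun x hx =>
    (hS x.1 (by simpa [uIcc_of_le zero_le_one] using hx.1) x.2).1)
  have h0 : (∫ x in (0:ℝ)..1, ∫ y in (0:ℝ)..T,
      extDeriv₂ a (h (x, y)) (fderiv ℝ h (x, y) (1, 0)) (fderiv ℝ h (x, y) (0, 1))) = 0 := by
    rw [intervalIntegral.integral_congr (g := fun _ => 0)]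
    · simp
    · intro x hx
      simp only
      rw [intervalIntegral.integral_congr (g := fun _ => 0)]
      · simp
      · intro y hy
        exact hclosed _ (hS x (by simpa [uIcc_of_le zero_le_one] using hx) y).1 _ _
  -- Periodicity is only assumed for `s` in `[0, 1]`, so the `s`-derivatives on the two edges are
  -- compared at interior points, which suffices for the integrals.
  have hedge : (∫ x in (0:ℝ)..1, a (h (x, 0)) (fderiv ℝ h (x, 0) (1, 0))) =
      ∫ x in (0:ℝ)..1, a (h (x, T)) (fderiv ℝ h (x, T) (1, 0)) := by
    rw [intervalIntegral.integral_of_le zero_le_one, intervalIntegral.integral_of_le zero_le_one,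
      integral_Ioc_eq_integral_Ioo, integral_Ioc_eq_integral_Ioo]
    refine setIntegral_congr_fun measurableSet_Ioo fun x hx => ?_
    have hper : ∀ s ∈ Icc (0 : ℝ) 1, h (s, T) = h (s, 0) := fun s hs => by
      simpa using (hS s hs 0).2
    have hloc : (fun s => h (s, T)) =ᶠ[𝓝 x] fun s => h (s, 0) :=
      Filter.eventually_of_mem (Icc_mem_nhds hx.1 hx.2) hper
    rw [hper x (Ioo_subset_Icc_self hx), ← (hasDerivAt_slice_left hd x T).deriv,
      ← (hasDerivAt_slice_left hd x 0).deriv, hloc.deriv_eq]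
  rw [h0, hedge, sub_self, zero_add, eq_comm, sub_eq_zero] at hst
  simp only [(hasDerivAt_slice_right hd _ _).deriv]
  simpa [ha] using hst.symm

/-- Stokes' theorem for a map of the closed unit disk. -/
lemma stokes_disk {V : Type*} [NormedAddCommGroup V] [NormedSpace ℝ V] {U : Set V}
    (hU : IsOpen U) {a : V → V →L[ℝ] ℝ} (ha : ContDiffOn ℝ 1 a U) {K : ℂ → V}
    (hK : ContDiff ℝ 2 K) (hS : MapsTo K (Metric.closedBall 0 1) U) :
    ∫ z in Metric.closedBall (0 : ℂ) 1,
      extDeriv₂ a (K z) (fderiv ℝ K z 1) (fderiv ℝ K z Complex.I) =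
    ∫ t in (0 : ℝ)..(2 * Real.pi), a (K (Complex.exp (t * Complex.I)))
      (deriv (fun t : ℝ => K (Complex.exp (t * Complex.I))) t) := by
  -- Polar coordinates turn the disk into a rectangle. The angle runs over `[-π, π]` to agree with
  -- the target of `polarCoord`, and the Jacobian `r` matches the pullback of the two-form (`hω`).
  set m : ℝ × ℝ → ℂ := fun p => p.1 * Complex.exp (p.2 * Complex.I) with hm
  have hmc : ContDiff ℝ 2 m := by
    have h1 : ContDiff ℝ 2 (fun p : ℝ × ℝ => (p.1 : ℂ)) :=
      Complex.ofRealCLM.contDiff.comp contDiff_fst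
    have h2 : ContDiff ℝ 2 (fun p : ℝ × ℝ => (p.2 : ℂ)) :=
      Complex.ofRealCLM.contDiff.comp contDiff_snd
    exact h1.mul (h2.mul contDiff_const).cexp
  have hκ : ContDiff ℝ 2 (K ∘ m) := hK.comp hmc
  have hκd := hκ.differentiable two_ne_zero
  have hKd := hK.differentiable two_ne_zero
  have hr (r θ : ℝ) : fderiv ℝ (K ∘ m) (r, θ) (1, 0) =
      fderiv ℝ K (m (r, θ)) (Complex.exp (θ * Complex.I)) := by
    have h1 : HasDerivAt (fun s => m (s, θ)) (Complex.exp (θ * Complex.I)) r := by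
      simpa using (Complex.ofRealCLM.hasDerivAt (x := r)).mul_const (Complex.exp (θ * Complex.I))
    exact (hasDerivAt_slice_left hκd r θ).unique ((hKd _).hasFDerivAt.comp_hasDerivAt r h1)
  have hθ (r θ : ℝ) : fderiv ℝ (K ∘ m) (r, θ) (0, 1) =
      fderiv ℝ K (m (r, θ)) (r * (Complex.exp (θ * Complex.I) * Complex.I)) := by
    have h1 : HasDerivAt (fun t : ℝ => m (r, t))
        (r * (Complex.exp (θ * Complex.I) * Complex.I)) θ := by
      have := (((Complex.ofRealCLM.hasDerivAt (x := θ)).mul_const Complex.I).cexp).const_mul (r : ℂ)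
      simpa using this
    exact (hasDerivAt_slice_right hκd r θ).unique ((hKd _).hasFDerivAt.comp_hasDerivAt θ h1)
  have hlin (z e : ℂ) : fderiv ℝ K z e =
      e.re • fderiv ℝ K z 1 + e.im • fderiv ℝ K z Complex.I := by
    conv_lhs => rw [show e = e.re • (1 : ℂ) + e.im • Complex.I by simp [Complex.re_add_im]]
    rw [map_add, map_smul, map_smul]
  have hω (r θ : ℝ) : extDeriv₂ a ((K ∘ m) (r, θ)) (fderiv ℝ (K ∘ m) (r, θ) (1, 0))
      (fderiv ℝ (K ∘ m) (r, θ) (0, 1)) = r • extDeriv₂ a (K (m (r, θ)))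
        (fderiv ℝ K (m (r, θ)) 1) (fderiv ℝ K (m (r, θ)) Complex.I) := by
    rw [hr, hθ, hlin _ (Complex.exp _), hlin _ (r * _), extDeriv₂_lincomb]
    congr 1
    simp only [Complex.mul_re, Complex.mul_im, Complex.exp_ofReal_mul_I_re,
      Complex.exp_ofReal_mul_I_im, Complex.ofReal_re, Complex.ofReal_im, Complex.I_re, Complex.I_im]
    linear_combination r * Real.cos_sq_add_sin_sq θ
  have hball (r θ : ℝ) (h0 : 0 ≤ r) : m (r, θ) ∈ Metric.closedBall (0 : ℂ) 1 ↔ r ≤ 1 := by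
    simp [hm, Complex.norm_exp_ofReal_mul_I, abs_of_nonneg h0]
  have hmaps : MapsTo (K ∘ m) (uIcc 0 1 ×ˢ uIcc (-Real.pi) Real.pi) U := by
    rintro ⟨r, θ⟩ ⟨hx, -⟩
    rw [uIcc_of_le zero_le_one] at hx
    exact hS ((hball r θ hx.1).2 hx.2)
  have hst := stokes_rectangle hU ha hκ 0 1 (-Real.pi) Real.pi hmaps
  have hpi : -Real.pi ≤ Real.pi := by linarith [Real.pi_pos]
  set ω : ℂ → ℝ := fun z => extDeriv₂ a (K z) (fderiv ℝ K z 1) (fderiv ℝ K z Complex.I) with hωdef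
  have hleft : ∫ z in Metric.closedBall (0 : ℂ) 1, ω z =
      ∫ r in (0 : ℝ)..1, ∫ θ in (-Real.pi)..Real.pi, r • ω (m (r, θ)) := by
    rw [← integral_indicator Metric.isClosed_closedBall.measurableSet,
      ← Complex.integral_comp_polarCoord_symm, polarCoord_target]
    have hsets : ∫ p in Ioi (0 : ℝ) ×ˢ Ioo (-Real.pi) Real.pi,
        p.1 • (Metric.closedBall (0 : ℂ) 1).indicator ω (Complex.polarCoord.symm p) =
        ∫ p in Ioc (0 : ℝ) 1 ×ˢ Ioo (-Real.pi) Real.pi, p.1 • ω (m p) := by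
      rw [← integral_indicator (measurableSet_Ioi.prod measurableSet_Ioo),
        ← integral_indicator (measurableSet_Ioc.prod measurableSet_Ioo)]
      congr 1
      ext ⟨r, θ⟩
      have hsymm : Complex.polarCoord.symm (r, θ) = m (r, θ) := by
        rw [Complex.polarCoord_symm_apply, hm]
        simp [Complex.exp_mul_I]
      by_cases h0 : 0 < r
      · by_cases h1 : r ≤ 1
        · simp [indicator, hsymm, hball r θ h0.le, h0, h1, -Metric.mem_closedBall]
        · simp [indicator, hsymm, hball r θ h0.le, h0, h1, -Metric.mem_closedBall]
      · simp [indicator, h0]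
    rw [hsets, Measure.volume_eq_prod, setIntegral_prod,
      intervalIntegral.integral_of_le zero_le_one]
    · simp_rw [intervalIntegral.integral_of_le hpi, integral_Ioc_eq_integral_Ioo]
    · rw [← Measure.volume_eq_prod]
      refine IntegrableOn.mono_set (t := Icc 0 1 ×ˢ Icc (-Real.pi) Real.pi) ?_
        (prod_mono Ioc_subset_Icc_self Ioo_subset_Icc_self)
      refine ContinuousOn.integrableOn_compact (isCompact_Icc.prod isCompact_Icc) ?_
      refine continuousOn_fst.smul ?_
      have hc : ContinuousOn ω (Metric.closedBall 0 1) :=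
        continuousOn_extDeriv₂ hU ha hK.continuous.continuousOn
          ((hK.continuous_fderiv two_ne_zero).clm_apply continuous_const).continuousOn
          ((hK.continuous_fderiv two_ne_zero).clm_apply continuous_const).continuousOn hS
      exact hc.comp hmc.continuous.continuousOn fun p hp => (hball p.1 p.2 hp.1.1).2 hp.1.2
  have hexp : Complex.exp (((-Real.pi : ℝ) : ℂ) * Complex.I) =
      Complex.exp ((Real.pi : ℂ) * Complex.I) := by
    push_cast; rw [neg_mul, Complex.exp_neg, Complex.exp_pi_mul_I]; norm_num
  have hmpi (r : ℝ) : m (r, -Real.pi) = m (r, Real.pi) := by simp only [hm]; rw [hexp]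
  -- Of the four edges only `r = 1` survives: `r = 0` is collapsed to a point, and the edges `θ =
  -- ±π` have the same image and cancel.
  have hbd : ∫ y in (-Real.pi)..Real.pi,
      a ((K ∘ m) (0, y)) (fderiv ℝ (K ∘ m) (0, y) (0, 1)) = 0 := by
    simp [hθ]
  have hbd2 : ∫ x in (0:ℝ)..1, a ((K ∘ m) (x, -Real.pi)) (fderiv ℝ (K ∘ m) (x, -Real.pi) (1, 0)) =
      ∫ x in (0:ℝ)..1, a ((K ∘ m) (x, Real.pi)) (fderiv ℝ (K ∘ m) (x, Real.pi) (1, 0)) := by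
    simp only [hr, Function.comp, hmpi, hexp]
  rw [hbd, hbd2, sub_self, zero_add, sub_zero] at hst
  simp only [hω] at hst
  rw [hleft, hst]
  have hfun : (fun y => a ((K ∘ m) (1, y)) (fderiv ℝ (K ∘ m) (1, y) (0, 1))) = fun t : ℝ =>
      a (K (Complex.exp (t * Complex.I)))
        (deriv (fun t : ℝ => K (Complex.exp (t * Complex.I))) t) := by
    ext t
    have h1 : (fun t : ℝ => K (Complex.exp (t * Complex.I))) = fun t => (K ∘ m) (1, t) := by
      ext t
      simp [hm]
    rw [h1, (hasDerivAt_slice_right hκd 1 t).deriv]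
    simp [hm]
  -- Periodicity moves the boundary integral from `[-π, π]` to `[0, 2π]`.
  have hper : Function.Periodic (fun y => a ((K ∘ m) (1, y)) (fderiv ℝ (K ∘ m) (1, y) (0, 1)))
      (2 * Real.pi) := by
    intro t
    have h1 : Complex.exp (((t + 2 * Real.pi : ℝ) : ℂ) * Complex.I) =
        Complex.exp (t * Complex.I) := by
      push_cast; rw [add_mul, Complex.exp_periodic]
    beta_reduce
    rw [hθ, hθ]
    simp only [Function.comp, hm, h1]
  rw [← hfun]
  have := hper.intervalIntegral_add_eq (-Real.pi) 0
  rw [zero_add, show -Real.pi + 2 * Real.pi = Real.pi by ring] at this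
  exact this

/-! ### A potential for the flux of a Killing field through surfaces -/

/-- Half of the one-form dual to the Killing field of `i ξ`. -/
def killingPotential (ξ : Matrix (Fin 2) (Fin 2) ℂ) (p : ℂ × ℝ) : ℂ × ℝ →L[ℝ] ℝ :=
  (2 * p.2 ^ 2)⁻¹ • ((killingField (Complex.I • ξ) p).1.re •
      Complex.reCLM.comp (ContinuousLinearMap.fst ℝ ℂ ℝ) +
    (killingField (Complex.I • ξ) p).1.im • Complex.imCLM.comp (ContinuousLinearMap.fst ℝ ℂ ℝ) +
    (killingField (Complex.I • ξ) p).2 • ContinuousLinearMap.snd ℝ ℂ ℝ)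

lemma killingPotential_apply (ξ : Matrix (Fin 2) (Fin 2) ℂ) (p v : ℂ × ℝ) :
    killingPotential ξ p v = hypInner p (killingField (Complex.I • ξ) p) v / 2 := by
  simp [killingPotential, hypInner]
  ring

lemma isOpen_halfSpace : IsOpen halfSpace := isOpen_lt continuous_const continuous_snd

lemma contDiff_killingField (ξ : Matrix (Fin 2) (Fin 2) ℂ) :
    ContDiff ℝ 1 (killingField ξ) := by
  have h2 : ContDiff ℝ 1 (fun p : ℂ × ℝ => (p.2 : ℂ)) :=
    Complex.ofRealCLM.contDiff.comp contDiff_snd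
  refine ContDiff.prodMk ?_ ?_
  · exact ((contDiff_const.sub (contDiff_const.mul contDiff_fst)).sub
      (contDiff_const.mul (contDiff_fst.pow 2))).add ((h2.pow 2).mul contDiff_const)
  · exact (contDiff_const.mul contDiff_snd).mul
      (Complex.reCLM.contDiff.comp (contDiff_const.add (contDiff_const.mul contDiff_fst)))

lemma contDiffOn_killingPotential (ξ : Matrix (Fin 2) (Fin 2) ℂ) :
    ContDiffOn ℝ 1 (killingPotential ξ) halfSpace := by
  have hY := contDiff_killingField (Complex.I • ξ)
  have h1 : ContDiffOn ℝ 1 (fun p : ℂ × ℝ => (2 * p.2 ^ 2)⁻¹) halfSpace :=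
    (contDiff_const.mul (contDiff_snd.pow 2)).contDiffOn.inv fun p hp =>
      mul_ne_zero two_ne_zero (pow_ne_zero 2 (ne_of_gt hp))
  refine h1.smul (ContDiff.contDiffOn ?_)
  exact (((Complex.reCLM.contDiff.comp hY.fst).smul contDiff_const).add
    ((Complex.imCLM.contDiff.comp hY.fst).smul contDiff_const)).add
      (hY.snd.smul contDiff_const)

lemma hasDerivAt_killingField_line (ξ : Matrix (Fin 2) (Fin 2) ℂ) (p u : ℂ × ℝ) :
    HasDerivAt (fun t : ℝ => killingField ξ (p + t • u))
      (-2 * ξ 0 0 * u.1 - 2 * ξ 0 1 * p.1 * u.1 + 2 * p.2 * u.2 * conj (ξ 0 1),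
        -2 * u.2 * (ξ 0 0 + ξ 0 1 * p.1).re - 2 * p.2 * (ξ 0 1 * u.1).re) 0 := by
  have e1 : HasDerivAt (fun t : ℝ => (p + t • u).1) u.1 0 := by
    simpa using ((Complex.ofRealCLM.hasDerivAt (x := (0:ℝ))).mul_const u.1).const_add p.1
  have e2 : HasDerivAt (fun t : ℝ => (p + t • u).2) u.2 0 := by
    simpa using ((hasDerivAt_id (0 : ℝ)).mul_const u.2).const_add p.2
  have k1 := (((hasDerivAt_const (0 : ℝ) (ξ 1 0)).sub
    (e1.const_mul (2 * ξ 0 0))).sub ((e1.pow 2).const_mul (ξ 0 1))).add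
    ((e2.ofReal_comp.pow 2).mul_const (conj (ξ 0 1)))
  have k2 := (e2.const_mul (-2)).mul (Complex.reCLM.hasFDerivAt.comp_hasDerivAt (0 : ℝ)
    ((e1.const_mul (ξ 0 1)).const_add (ξ 0 0)))
  refine (k1.prodMk k2).congr_deriv ?_
  ext1
  · simp; ring
  · simp; ring

/-- Restriction to the line `p + t u` and evaluation on a fixed `v` reduce this to the quotient rule
in one real variable; the value is then identified by uniqueness of the derivative. -/
lemma fderiv_killingPotential (ξ : Matrix (Fin 2) (Fin 2) ℂ) {p : ℂ × ℝ} (hp : p ∈ halfSpace)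
    (u v : ℂ × ℝ) : fderiv ℝ (killingPotential ξ) p u v =
      (((-2 * (Complex.I * ξ 0 0) * u.1 - 2 * (Complex.I * ξ 0 1) * p.1 * u.1 +
        2 * p.2 * u.2 * conj (Complex.I * ξ 0 1) : ℂ)) * conj v.1).re / (2 * p.2 ^ 2) +
      (-2 * u.2 * (Complex.I * ξ 0 0 + Complex.I * ξ 0 1 * p.1).re -
        2 * p.2 * (Complex.I * ξ 0 1 * u.1).re) * v.2 / (2 * p.2 ^ 2) -
      (((killingField (Complex.I • ξ) p).1 * conj v.1).re +
        (killingField (Complex.I • ξ) p).2 * v.2) * u.2 / p.2 ^ 3 := by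
  have hp0 : p.2 ≠ 0 := ne_of_gt hp
  have hd : HasFDerivAt (killingPotential ξ) (fderiv ℝ (killingPotential ξ) p)
      (p + (0 : ℝ) • u) := by
    rw [zero_smul, add_zero]
    exact (((contDiffOn_killingPotential ξ).differentiableOn one_ne_zero).differentiableAt
      (isOpen_halfSpace.mem_nhds hp)).hasFDerivAt
  have hline : HasDerivAt (fun t : ℝ => p + t • u) u 0 := by
    simpa using ((hasDerivAt_id (0 : ℝ)).smul_const u).const_add p
  have h0 : HasDerivAt (fun t : ℝ => killingPotential ξ (p + t • u))
      (fderiv ℝ (killingPotential ξ) p u) 0 :=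
    HasFDerivAt.comp_hasDerivAt (l := killingPotential ξ) (f := fun t : ℝ => p + t • u)
      (0 : ℝ) hd hline
  have h1 : HasDerivAt (fun t : ℝ => killingPotential ξ (p + t • u) v)
      (fderiv ℝ (killingPotential ξ) p u v) 0 :=
    (ContinuousLinearMap.apply ℝ ℝ v).hasFDerivAt.comp_hasDerivAt (0 : ℝ) h0
  refine h1.unique ?_
  have e2 : HasDerivAt (fun t : ℝ => (p + t • u).2) u.2 0 := by
    simpa using ((hasDerivAt_id (0 : ℝ)).mul_const u.2).const_add p.2
  have hY := hasDerivAt_killingField_line (Complex.I • ξ) p u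
  have hY1 : HasDerivAt (fun t : ℝ => (killingField (Complex.I • ξ) (p + t • u)).1) _ 0 := hY.fst
  have hY2 : HasDerivAt (fun t : ℝ => (killingField (Complex.I • ξ) (p + t • u)).2) _ 0 := hY.snd
  have k1 : HasDerivAt (fun t : ℝ =>
      ((killingField (Complex.I • ξ) (p + t • u)).1 * conj v.1).re) _ 0 :=
    Complex.reCLM.hasFDerivAt.comp_hasDerivAt (0 : ℝ) (hY1.mul_const (conj v.1))
  have k3 := (k1.add (hY2.mul_const v.2)).div ((e2.pow 2).const_mul 2) (by simpa using hp0)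
  have heq : ∀ t : ℝ, killingPotential ξ (p + t • u) v =
      (((killingField (Complex.I • ξ) (p + t • u)).1 * conj v.1).re +
        (killingField (Complex.I • ξ) (p + t • u)).2 * v.2) / (2 * (p + t • u).2 ^ 2) := by
    intro t
    rw [killingPotential_apply, hypInner, div_div, mul_comm _ (2 : ℝ), Complex.star_def]
    congr 2
    simp only [Complex.mul_re, Complex.conj_re, Complex.conj_im]; ring
  refine (k3.congr_of_eventuallyEq (Filter.Eventually.of_forall heq)).congr_deriv ?_
  simp only [Matrix.smul_apply, smul_eq_mul, zero_smul, add_zero, Complex.reCLM_apply, Pi.add_apply,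
    Pi.pow_apply]
  field_simp
  push_cast
  ring

/-- The contraction of the volume form by a Killing field is exact. -/
lemma extDeriv₂_killingPotential (ξ : Matrix (Fin 2) (Fin 2) ℂ) {p : ℂ × ℝ} (hp : p ∈ halfSpace)
    (u v : ℂ × ℝ) :
    extDeriv₂ (killingPotential ξ) p u v = volForm p (killingField ξ p) u v := by
  have hp0 : p.2 ≠ 0 := ne_of_gt hp
  rw [extDeriv₂, fderiv_killingPotential ξ hp, fderiv_killingPotential ξ hp, volForm, det3,
    Matrix.det_fin_three]
  simp [killingField, pow_two, Complex.mul_re, Complex.mul_im]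
  field_simp
  ring

/-! ### Isometries and their one-parameter groups -/

lemma toMinkowski_apply (p : ℂ × ℝ) : toMinkowski p =
    !![(p.2 : ℂ)⁻¹, (p.2 : ℂ)⁻¹ * conj p.1; (p.2 : ℂ)⁻¹ * p.1,
      (p.2 : ℂ)⁻¹ * (p.1 * conj p.1 + (p.2 : ℂ) ^ 2)] := by
  rw [toMinkowski, Complex.mul_conj, Complex.normSq_eq_norm_sq]
  ext i j
  fin_cases i <;> fin_cases j <;> simp

lemma ofMinkowski_toMinkowski {p : ℂ × ℝ} (hp : p ∈ halfSpace) :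
    ofMinkowski (toMinkowski p) = p := by
  have h0 : (p.2 : ℂ) ≠ 0 := by exact_mod_cast (ne_of_gt hp)
  rw [toMinkowski_apply, ofMinkowski]
  ext1
  · simp; field_simp
  · simp [← Complex.ofReal_inv]

/-- The first entry of `G N G*`, where `N` is the Hermitian matrix of a point. -/
lemma conj_toMinkowski_zero_zero (G : Matrix (Fin 2) (Fin 2) ℂ) (p : ℂ × ℝ) (hp : p ∈ halfSpace) :
    (G * toMinkowski p * Gᴴ) 0 0 =
      (((Complex.normSq (G 0 0 + G 0 1 * p.1) +
        Complex.normSq (G 0 1) * p.2 ^ 2) / p.2 : ℝ) : ℂ) := by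
  have h0 : (p.2 : ℂ) ≠ 0 := by exact_mod_cast (ne_of_gt hp)
  push_cast
  rw [← Complex.mul_conj, ← Complex.mul_conj, toMinkowski_apply]
  simp [Matrix.mul_apply, Fin.sum_univ_two]
  field_simp
  ring

lemma conj_toMinkowski_pos {G : Matrix (Fin 2) (Fin 2) ℂ} (hG : G.det = 1) {p : ℂ × ℝ}
    (hp : p ∈ halfSpace) : 0 < ((G * toMinkowski p * Gᴴ) 0 0).re := by
  rw [conj_toMinkowski_zero_zero G p hp, Complex.ofReal_re]
  have hp' : 0 < p.2 := hp
  refine div_pos ?_ hp'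
  by_cases h1 : G 0 1 = 0
  · have h2 : G 0 0 ≠ 0 := by
      intro h2; rw [Matrix.det_fin_two, h1, h2] at hG; simp at hG
    simpa [h1] using h2
  · have := Complex.normSq_pos.2 h1
    have := Complex.normSq_nonneg (G 0 0 + G 0 1 * p.1)
    positivity

/-- `ofMinkowski` reads only the first column. Hermitian symmetry restores the entry above the
diagonal and the determinant restores the last one. -/
lemma toMinkowski_ofMinkowski {N : Matrix (Fin 2) (Fin 2) ℂ} (hN : N.IsHermitian) (hd : N.det = 1)
    (h0 : 0 < (N 0 0).re) : toMinkowski (ofMinkowski N) = N := by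
  have e00 : ((N 0 0).re : ℂ) = N 0 0 := by
    have := hN.apply 0 0
    exact Complex.conj_eq_iff_re.1 this
  have e01 : conj (N 1 0) = N 0 1 := hN.apply 0 1
  have hne : N 0 0 ≠ 0 := by rw [← e00]; exact_mod_cast h0.ne'
  rw [Matrix.det_fin_two] at hd
  rw [toMinkowski_apply, ofMinkowski]
  have hc : conj (N 0 0) = N 0 0 := hN.apply 0 0
  ext i j
  fin_cases i <;> fin_cases j <;> simp [e00, e01, hc]
  · field_simp
  · field_simp
  · field_simp
    linear_combination -hd

lemma toMinkowski_isHermitian (p : ℂ × ℝ) : (toMinkowski p).IsHermitian := by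
  rw [toMinkowski_apply]
  ext i j
  fin_cases i <;> fin_cases j <;> simp [mul_comm]

lemma toMinkowski_det {p : ℂ × ℝ} (hp : p ∈ halfSpace) : (toMinkowski p).det = 1 := by
  have h0 : (p.2 : ℂ) ≠ 0 := by exact_mod_cast (ne_of_gt hp)
  rw [toMinkowski_apply, Matrix.det_fin_two]
  simp
  field_simp
  ring

/-- The isometry `N ↦ G N G*` in the half-space. -/
def act (G : Matrix (Fin 2) (Fin 2) ℂ) (p : ℂ × ℝ) : ℂ × ℝ := ofMinkowski (G * toMinkowski p * Gᴴ)

lemma toMinkowski_act {G : Matrix (Fin 2) (Fin 2) ℂ} (hG : G.det = 1) {p : ℂ × ℝ}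
    (hp : p ∈ halfSpace) : toMinkowski (act G p) = G * toMinkowski p * Gᴴ := by
  refine toMinkowski_ofMinkowski ?_ ?_ (conj_toMinkowski_pos hG hp)
  · exact Matrix.isHermitian_mul_mul_conjTranspose _ (toMinkowski_isHermitian p)
  · rw [Matrix.det_mul, Matrix.det_mul, Matrix.det_conjTranspose, hG, toMinkowski_det hp]; simp

lemma act_mem {G : Matrix (Fin 2) (Fin 2) ℂ} (hG : G.det = 1) {p : ℂ × ℝ}
    (hp : p ∈ halfSpace) : act G p ∈ halfSpace :=
  inv_pos.2 (conj_toMinkowski_pos hG hp)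

lemma act_act (G : Matrix (Fin 2) (Fin 2) ℂ) {G' : Matrix (Fin 2) (Fin 2) ℂ} (hG' : G'.det = 1)
    {p : ℂ × ℝ} (hp : p ∈ halfSpace) : act G (act G' p) = act (G * G') p := by
  rw [act, toMinkowski_act hG' hp, act]
  simp only [Matrix.conjTranspose_mul, Matrix.mul_assoc]

/-- A Killing field is the velocity of a curve of isometries. -/
lemma hasDerivAt_act {a b c d : ℝ → ℂ} {x y z : ℂ} (ha : HasDerivAt a x 0) (hb : HasDerivAt b y 0)
    (hc : HasDerivAt c z 0) (hd : HasDerivAt d (-x) 0) (ha0 : a 0 = 1) (hb0 : b 0 = 0)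
    (hc0 : c 0 = 0) (hd0 : d 0 = 1) {p : ℂ × ℝ} (hp : p ∈ halfSpace) :
    HasDerivAt (fun u => act !![a u, b u; c u, d u] p) (killingField !![x, y; z, -x] p) 0 := by
  have h0 : (p.2 : ℂ) ≠ 0 := by exact_mod_cast (ne_of_gt hp)
  have h0' : p.2 ≠ 0 := ne_of_gt hp
  have e00 : ∀ u, (!![a u, b u; c u, d u] * toMinkowski p * (!![a u, b u; c u, d u])ᴴ) 0 0 =
      (a u * (p.2 : ℂ)⁻¹ + b u * ((p.2 : ℂ)⁻¹ * p.1)) * star (a u) +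
      (a u * ((p.2 : ℂ)⁻¹ * conj p.1) +
        b u * ((p.2 : ℂ)⁻¹ * (p.1 * conj p.1 + (p.2 : ℂ) ^ 2))) * star (b u) := by
    intro u; rw [toMinkowski_apply]; simp [Matrix.mul_apply, Fin.sum_univ_two]
  have e10 : ∀ u, (!![a u, b u; c u, d u] * toMinkowski p * (!![a u, b u; c u, d u])ᴴ) 1 0 =
      (c u * (p.2 : ℂ)⁻¹ + d u * ((p.2 : ℂ)⁻¹ * p.1)) * star (a u) +
      (c u * ((p.2 : ℂ)⁻¹ * conj p.1) +
        d u * ((p.2 : ℂ)⁻¹ * (p.1 * conj p.1 + (p.2 : ℂ) ^ 2))) * star (b u) := by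
    intro u; rw [toMinkowski_apply]; simp [Matrix.mul_apply, Fin.sum_univ_two]
  have k0 := ((((ha.mul_const (p.2 : ℂ)⁻¹).add (hb.mul_const ((p.2 : ℂ)⁻¹ * p.1))).mul ha.star).add
    (((ha.mul_const ((p.2 : ℂ)⁻¹ * conj p.1)).add
      (hb.mul_const ((p.2 : ℂ)⁻¹ * (p.1 * conj p.1 + (p.2 : ℂ) ^ 2)))).mul hb.star))
  have k1 := ((((hc.mul_const (p.2 : ℂ)⁻¹).add (hd.mul_const ((p.2 : ℂ)⁻¹ * p.1))).mul ha.star).add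
    (((hc.mul_const ((p.2 : ℂ)⁻¹ * conj p.1)).add
      (hd.mul_const ((p.2 : ℂ)⁻¹ * (p.1 * conj p.1 + (p.2 : ℂ) ^ 2)))).mul hb.star))
  have k0' := k0.congr_of_eventuallyEq (Filter.Eventually.of_forall e00)
  have k1' := k1.congr_of_eventuallyEq (Filter.Eventually.of_forall e10)
  have v0 : (!![a 0, b 0; c 0, d 0] * toMinkowski p * (!![a 0, b 0; c 0, d 0])ᴴ) 0 0 =
      (p.2 : ℂ)⁻¹ := by
    rw [e00]; simp [ha0, hb0]
  have v1 : (!![a 0, b 0; c 0, d 0] * toMinkowski p * (!![a 0, b 0; c 0, d 0])ᴴ) 1 0 =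
      (p.2 : ℂ)⁻¹ * p.1 := by
    rw [e10]; simp [ha0, hb0, hc0, hd0]
  have hre := (Complex.reCLM.hasFDerivAt.comp_hasDerivAt (0 : ℝ) k0').inv
    (by simp only [Function.comp]; rw [v0]; simpa [← Complex.ofReal_inv] using h0')
  have hdiv := k1'.div k0' (by rw [v0]; exact inv_ne_zero h0)
  refine (hdiv.prodMk hre).congr_deriv ?_
  ext1
  · simp only [v0, v1, killingField]
    simp [ha0, hb0, hc0, hd0]
    field_simp
    ring
  · simp only [Function.comp, v0, killingField]
    simp [ha0, hb0, ← Complex.ofReal_inv]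
    field_simp
    ring

/-- The isometries along the geodesic from `0` to `∞` and around it. -/
def axial (κ : ℂ) (t : ℝ) : Matrix (Fin 2) (Fin 2) ℂ :=
  !![Complex.exp (-(κ * t / 2)), 0; 0, Complex.exp (κ * t / 2)]

lemma axial_det (κ : ℂ) (t : ℝ) : (axial κ t).det = 1 := by
  rw [axial, Matrix.det_fin_two]; simp [← Complex.exp_add]

lemma axial_add (κ : ℂ) (s t : ℝ) : axial κ (s + t) = axial κ s * axial κ t := by
  rw [axial, axial, axial]
  ext i j
  fin_cases i <;> fin_cases j <;> simp [← Complex.exp_add] <;> ring_nf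

/-- A complex rate `κ` treats translations (`κ = 1`) and rotations (`κ = i`) at once. The negative
exponent comes first in `axial` because the boundary action is `ζ ↦ (δ ζ + γ)/(β ζ + α)`. -/
lemma act_axial (κ : ℂ) (t : ℝ) {p : ℂ × ℝ} (hp : p ∈ halfSpace) :
    act (axial κ t) p = (Complex.exp (κ * t) * p.1, Real.exp (κ.re * t) * p.2) := by
  have h0 : (p.2 : ℂ) ≠ 0 := by exact_mod_cast (ne_of_gt hp)
  have e00 : (axial κ t * toMinkowski p * (axial κ t)ᴴ) 0 0 =
      ((Real.exp (κ.re * t) * p.2)⁻¹ : ℝ) := by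
    rw [conj_toMinkowski_zero_zero _ _ hp]
    have h1 : (-(κ * t / 2)).re = -(κ.re * t / 2) := by simp
    simp only [axial, Matrix.of_apply, Matrix.cons_val', Matrix.cons_val_zero, Matrix.cons_val_one,
      Matrix.cons_val_fin_one, zero_mul, add_zero, map_zero, Complex.normSq_eq_norm_sq,
      Complex.norm_exp, h1]
    rw [← Real.exp_nat_mul, mul_inv, ← Real.exp_neg, div_eq_mul_inv]
    congr 3
    push_cast; ring
  have e10 : (axial κ t * toMinkowski p * (axial κ t)ᴴ) 1 0 =
      Complex.exp (κ * t / 2) * Complex.exp (-(conj κ * t / 2)) * p.1 / p.2 := by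
    rw [toMinkowski_apply, axial]
    simp [Matrix.mul_apply, Fin.sum_univ_two, ← Complex.exp_conj, Complex.conj_ofNat]
    field_simp
  rw [act, ofMinkowski, e00, e10, Complex.ofReal_re, inv_inv]
  ext1
  · simp only
    push_cast
    rw [div_inv_eq_mul]
    have h2 : Complex.exp (κ * t) = Complex.exp (κ * t / 2) * Complex.exp (-(conj κ * t / 2)) *
        Complex.exp (κ.re * t) := by
      rw [← Complex.exp_add, ← Complex.exp_add]
      congr 1
      rw [Complex.re_eq_add_conj]; ring
    rw [h2]; field_simp
  · rfl

/-- The infinitesimal generator of the translations along the image of the geodesic from `0` to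
`∞` under the isometry given by `P`. -/
def axialGenerator (P : Matrix (Fin 2) (Fin 2) ℂ) : Matrix (Fin 2) (Fin 2) ℂ :=
  !![-(P 0 0 * P 1 1 + P 0 1 * P 1 0) / 2, P 0 0 * P 0 1;
    -(P 1 0 * P 1 1), (P 0 0 * P 1 1 + P 0 1 * P 1 0) / 2]

/-- The translations (`κ = 1`) along, and rotations (`κ = i`) about, the image of the geodesic
from `0` to `∞`. -/
def axialFlow (P : Matrix.SpecialLinearGroup (Fin 2) ℂ) (κ : ℂ) (t : ℝ) (p : ℂ × ℝ) : ℂ × ℝ :=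
  isometry P (act (axial κ t) (isometry P⁻¹ p))

lemma isometry_eq_act (P : Matrix.SpecialLinearGroup (Fin 2) ℂ) :
    isometry P = act (P : Matrix (Fin 2) (Fin 2) ℂ) := rfl

lemma axialFlow_eq (P : Matrix.SpecialLinearGroup (Fin 2) ℂ) (κ : ℂ) (t : ℝ) {p : ℂ × ℝ}
    (hp : p ∈ halfSpace) : axialFlow P κ t p =
      act ((P : Matrix (Fin 2) (Fin 2) ℂ) * axial κ t *
        ((P⁻¹ : Matrix.SpecialLinearGroup (Fin 2) ℂ) : Matrix (Fin 2) (Fin 2) ℂ)) p := by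
  rw [axialFlow, isometry_eq_act, isometry_eq_act, act_act _ (axial_det κ t)
    (act_mem (Matrix.SpecialLinearGroup.det_coe _) hp),
    act_act _ (Matrix.SpecialLinearGroup.det_coe _) hp]

lemma axialFlow_mem (P : Matrix.SpecialLinearGroup (Fin 2) ℂ) (κ : ℂ) (t : ℝ) {p : ℂ × ℝ}
    (hp : p ∈ halfSpace) : axialFlow P κ t p ∈ halfSpace :=
  act_mem (Matrix.SpecialLinearGroup.det_coe _) (act_mem (axial_det κ t)
    (act_mem (Matrix.SpecialLinearGroup.det_coe _) hp))

lemma axialFlow_add (P : Matrix.SpecialLinearGroup (Fin 2) ℂ) (κ : ℂ) (s t : ℝ) {p : ℂ × ℝ}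
    (hp : p ∈ halfSpace) : axialFlow P κ (s + t) p = axialFlow P κ s (axialFlow P κ t p) := by
  have hi : ((P⁻¹ : Matrix.SpecialLinearGroup (Fin 2) ℂ) : Matrix (Fin 2) (Fin 2) ℂ) *
      (P : Matrix (Fin 2) (Fin 2) ℂ) = 1 := by
    rw [← Matrix.SpecialLinearGroup.coe_mul]; simp
  rw [axialFlow_eq P κ s (axialFlow_mem P κ t hp), axialFlow_eq P κ t hp, axialFlow_eq P κ _ hp,
    act_act _ (by rw [Matrix.det_mul, Matrix.det_mul, axial_det, Matrix.SpecialLinearGroup.det_coe,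
      Matrix.SpecialLinearGroup.det_coe]; simp) hp, axial_add]
  congr 1
  simp only [Matrix.mul_assoc]
  rw [← Matrix.mul_assoc _ (P : Matrix (Fin 2) (Fin 2) ℂ) (axial κ t * _), hi, Matrix.one_mul]

/-- By the group law it suffices to differentiate at time zero from the point reached at time `t`.
There the flow is the action of `P (axial κ u) P⁻¹`, a curve through the identity with velocity `κ P
diag(-1/2, 1/2) P⁻¹`. -/
lemma hasDerivAt_axialFlow (P : Matrix.SpecialLinearGroup (Fin 2) ℂ) (κ : ℂ) (t : ℝ) {p : ℂ × ℝ}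
    (hp : p ∈ halfSpace) : HasDerivAt (fun s => axialFlow P κ s p)
      (killingField (κ • axialGenerator P) (axialFlow P κ t p)) t := by
  have hq := axialFlow_mem P κ t hp
  set q := axialFlow P κ t p with hqdef
  have hdet : P 0 0 * P 1 1 - P 0 1 * P 1 0 = 1 := by
    rw [← Matrix.det_fin_two]; exact P.det_coe
  have hlin : HasDerivAt (fun u : ℝ => κ * u / 2) (κ / 2) 0 := by
    simpa using ((Complex.ofRealCLM.hasDerivAt (x := (0 : ℝ))).const_mul κ).div_const 2
  have hm : HasDerivAt (fun u : ℝ => Complex.exp (-(κ * u / 2))) (-(κ / 2)) 0 := by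
    simpa using hlin.neg.cexp
  have hpl : HasDerivAt (fun u : ℝ => Complex.exp (κ * u / 2)) (κ / 2) 0 := by
    simpa using hlin.cexp
  have hE : ∀ u : ℝ, axialFlow P κ u q = act
      !![P 0 0 * P 1 1 * Complex.exp (-(κ * u / 2)) - P 0 1 * P 1 0 * Complex.exp (κ * u / 2),
        P 0 0 * P 0 1 * Complex.exp (κ * u / 2) - P 0 0 * P 0 1 * Complex.exp (-(κ * u / 2));
        P 1 0 * P 1 1 * Complex.exp (-(κ * u / 2)) - P 1 0 * P 1 1 * Complex.exp (κ * u / 2),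
        P 0 0 * P 1 1 * Complex.exp (κ * u / 2) -
          P 0 1 * P 1 0 * Complex.exp (-(κ * u / 2))] q := by
    intro u
    rw [axialFlow_eq P κ u hq]
    congr 1
    rw [Matrix.SpecialLinearGroup.coe_inv, Matrix.adjugate_fin_two, axial]
    ext i j
    fin_cases i <;> fin_cases j <;> simp [Matrix.mul_apply, Fin.sum_univ_two] <;> ring
  have h0 : HasDerivAt (fun u => axialFlow P κ u q) (killingField (κ • axialGenerator P) q) 0 := by
    refine HasDerivAt.congr_of_eventuallyEq ?_ (Filter.Eventually.of_forall hE)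
    refine (hasDerivAt_act (x := -(κ * (P 0 0 * P 1 1 + P 0 1 * P 1 0) / 2))
      (y := κ * (P 0 0 * P 0 1)) (z := -(κ * (P 1 0 * P 1 1))) ?_ ?_ ?_ ?_ ?_ ?_ ?_ ?_
      hq).congr_deriv ?_
    · exact ((hm.const_mul _).sub (hpl.const_mul _)).congr_deriv (by ring)
    · exact ((hpl.const_mul _).sub (hm.const_mul _)).congr_deriv (by ring)
    · exact ((hm.const_mul _).sub (hpl.const_mul _)).congr_deriv (by ring)
    · exact ((hpl.const_mul _).sub (hm.const_mul _)).congr_deriv (by ring)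
    · simpa using hdet
    · simp
    · simp
    · simpa using hdet
    · congr 1
      ext i j
      fin_cases i <;> fin_cases j <;> simp [axialGenerator] <;> ring
  have h1 : HasDerivAt (fun s => axialFlow P κ (s - t) q)
      (killingField (κ • axialGenerator P) q) t := by
    exact HasDerivAt.comp_sub_const t t (by rwa [sub_self])
  refine h1.congr_of_eventuallyEq (Filter.Eventually.of_forall fun s => ?_)
  simp only
  rw [hqdef, ← axialFlow_add P κ _ _ hp, sub_add_cancel]

lemma act_one {p : ℂ × ℝ} (hp : p ∈ halfSpace) : act 1 p = p := by
  rw [act, Matrix.one_mul, Matrix.conjTranspose_one, Matrix.mul_one, ofMinkowski_toMinkowski hp]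

lemma axialFlow_zero (P : Matrix.SpecialLinearGroup (Fin 2) ℂ) (κ : ℂ) {p : ℂ × ℝ}
    (hp : p ∈ halfSpace) : axialFlow P κ 0 p = p := by
  have h1 : axial κ 0 = 1 := by
    rw [axial]; ext i j; fin_cases i <;> fin_cases j <;> simp
  rw [axialFlow_eq P κ 0 hp, h1, Matrix.mul_one, ← Matrix.SpecialLinearGroup.coe_mul]
  simp [act_one hp]

/-- On the half-space, `Y` is the Killing field of `κ` times the infinitesimal translation along
the geodesic from `C` to `D`. -/
def IsAxialField (κ : ℂ) (C D : OnePoint ℂ) (Y : ℂ × ℝ → ℂ × ℝ) : Prop :=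
  ∃ P : Matrix.SpecialLinearGroup (Fin 2) ℂ,
    boundaryMap P ((0 : ℂ) : OnePoint ℂ) = C ∧ boundaryMap P OnePoint.infty = D ∧
    ∀ p ∈ halfSpace, Y p = killingField (κ • axialGenerator P) p

/-- A flow determines its generator on the half-space by differentiation at time zero. This removes
the flow from the definition of the fields and leaves an explicit matrix. -/
lemma isAxialField_iff (κ : ℂ) (C D : OnePoint ℂ) (Y : ℂ × ℝ → ℂ × ℝ) :
    IsAxialField κ C D Y ↔ ∃ Φ : ℝ → ℂ × ℝ → ℂ × ℝ,
      (∃ P : Matrix.SpecialLinearGroup (Fin 2) ℂ,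
        boundaryMap P ((0 : ℂ) : OnePoint ℂ) = C ∧ boundaryMap P OnePoint.infty = D ∧
        ∀ t : ℝ, ∀ p ∈ halfSpace, Φ t p = axialFlow P κ t p) ∧ Generates Y Φ := by
  constructor
  · rintro ⟨P, hC, hD, hY⟩
    refine ⟨axialFlow P κ, ⟨P, hC, hD, fun _ _ _ => rfl⟩, fun t p hp => ?_⟩
    rw [hY _ (axialFlow_mem P κ t hp)]
    exact hasDerivAt_axialFlow P κ t hp
  · rintro ⟨Φ, ⟨P, hC, hD, hΦ⟩, hY⟩
    refine ⟨P, hC, hD, fun p hp => ?_⟩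
    have h1 := hY 0 p hp
    rw [funext fun s => hΦ s p hp, hΦ 0 p hp, axialFlow_zero P κ hp] at h1
    have h2 := hasDerivAt_axialFlow P κ 0 hp
    rw [axialFlow_zero P κ hp] at h2
    exact h1.unique h2

lemma isTranslationField_iff (C D : OnePoint ℂ) (Y : ℂ × ℝ → ℂ × ℝ) :
    IsTranslationField C D Y ↔ IsAxialField 1 C D Y := by
  rw [isAxialField_iff]
  refine exists_congr fun Φ => and_congr_left fun _ => exists_congr fun P =>
    and_congr_right fun _ => and_congr_right fun _ => forall_congr' fun t => forall_congr' fun p =>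
    forall_congr' fun hp => ?_
  have hq := act_mem (Matrix.SpecialLinearGroup.det_coe P⁻¹) hp
  rw [axialFlow, act_axial _ _ (p := isometry P⁻¹ p) hq]
  have : Real.exp t • isometry P⁻¹ p = (Complex.exp (1 * t) * (isometry P⁻¹ p).1,
      Real.exp ((1 : ℂ).re * t) * (isometry P⁻¹ p).2) := by
    ext1 <;> simp
  rw [this]

lemma isRotationField_iff (C D : OnePoint ℂ) (Y : ℂ × ℝ → ℂ × ℝ) :
    IsRotationField C D Y ↔ IsAxialField Complex.I C D Y := by
  rw [isAxialField_iff]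
  refine exists_congr fun Φ => and_congr_left fun _ => exists_congr fun P =>
    and_congr_right fun _ => and_congr_right fun _ => forall_congr' fun t => forall_congr' fun p =>
    forall_congr' fun hp => ?_
  have hq := act_mem (Matrix.SpecialLinearGroup.det_coe P⁻¹) hp
  rw [axialFlow, act_axial _ _ (p := isometry P⁻¹ p) hq]
  simp [mul_comm]

/-! ### Endpoints of geodesics and the flux polynomial -/

lemma exists_boundaryMap {C D : OnePoint ℂ} (h : C ≠ D) :
    ∃ P : Matrix.SpecialLinearGroup (Fin 2) ℂ,
      boundaryMap P ((0 : ℂ) : OnePoint ℂ) = C ∧ boundaryMap P OnePoint.infty = D := by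
  have h0 (P : Matrix.SpecialLinearGroup (Fin 2) ℂ) :
      boundaryMap P ((0 : ℂ) : OnePoint ℂ) = sphereDiv (P 1 0) (P 0 0) := by
    change sphereDiv _ _ = _; simp
  have h1 (P : Matrix.SpecialLinearGroup (Fin 2) ℂ) :
      boundaryMap P OnePoint.infty = sphereDiv (P 1 1) (P 0 1) := rfl
  -- `P` sends `0` to `γ/α` and `∞` to `δ/β`: its columns are homogeneous coordinates of the two
  -- endpoints, scaled so that the determinant is one.
  simp only [h0, h1]
  induction C using OnePoint.rec with
  | infty =>
    induction D using OnePoint.rec with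
    | infty => exact absurd rfl h
    | coe d => exact ⟨⟨!![0, 1; -1, d], by simp [Matrix.det_fin_two]⟩, by simp [sphereDiv],
        by simp [sphereDiv]⟩
  | coe c =>
    induction D using OnePoint.rec with
    | infty => exact ⟨⟨!![1, 0; c, 1], by simp [Matrix.det_fin_two]⟩, by simp [sphereDiv],
        by simp [sphereDiv]⟩
    | coe d =>
      have hcd : d - c ≠ 0 := sub_ne_zero.2 fun hcd => h (by rw [hcd])
      refine ⟨⟨!![1, 1 / (d - c); c, d / (d - c)], ?_⟩, by simp [sphereDiv], ?_⟩
      · simp [Matrix.det_fin_two]; field_simp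
      · simp [sphereDiv, hcd]

/-- The polynomial of an end with the given residues. -/
def fluxPolynomial (φ₀ φ₁ φ₂ : ℂ) : MvPolynomial (Fin 2) ℂ :=
  MvPolynomial.C φ₂ * (MvPolynomial.X 0 * MvPolynomial.X 1) +
    MvPolynomial.C φ₁ * (MvPolynomial.X 0 + MvPolynomial.X 1) + MvPolynomial.C φ₀

lemma eval2_fluxPolynomial (φ₀ φ₁ φ₂ c d : ℂ) :
    eval2 (fluxPolynomial φ₀ φ₁ φ₂) c d = φ₂ * (c * d) + φ₁ * (c + d) + φ₀ := by
  simp [eval2, fluxPolynomial]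

lemma tendsto_quotient (a b c : ℂ) :
    Filter.Tendsto (fun d => (a * d + b) / (c - d)) (Bornology.cobounded ℂ) (𝓝 (-a)) := by
  have h1 : Filter.Tendsto (fun d : ℂ => (c - d)⁻¹) (Bornology.cobounded ℂ) (𝓝 0) :=
    Filter.tendsto_inv₀_cobounded.comp (tendsto_const_sub_cobounded c)
  -- Division with remainder: `(a d + b)/(c - d) = (b + a c)/(c - d) - a` for `d ≠ c`.
  have h2 := (h1.const_mul (b + a * c)).add_const (-a)
  simp only [mul_zero, zero_add] at h2
  refine h2.congr' ?_
  have : ∀ᶠ d in Bornology.cobounded ℂ, d ≠ c := by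
    have : ({c}ᶜ : Set ℂ) ∈ Bornology.cobounded ℂ :=
      Bornology.isBounded_def.1 Bornology.isBounded_singleton
    filter_upwards [this] with d hd using hd
  filter_upwards [this] with d hd
  have : c - d ≠ 0 := sub_ne_zero.2 hd.symm
  field_simp
  ring

/-- For finite endpoints `C - D = -1/(αβ)`, so the quotient is `-(φ₂ γδ + φ₁ (αδ + βγ) + φ₀ αβ)`.
This is polynomial in the entries of `P`, and it is also the limit when `α` or `β` vanishes, that
is, when an endpoint is `∞`. -/
lemma hasQuotient_fluxPolynomial (φ₀ φ₁ φ₂ : ℂ) (P : Matrix.SpecialLinearGroup (Fin 2) ℂ)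
    {C D : OnePoint ℂ} (hC : boundaryMap P ((0 : ℂ) : OnePoint ℂ) = C)
    (hD : boundaryMap P OnePoint.infty = D) :
    HasQuotient (fluxPolynomial φ₀ φ₁ φ₂) C D (-pairing (axialGenerator P) φ₀ φ₁ φ₂) := by
  have h0 : boundaryMap P ((0 : ℂ) : OnePoint ℂ) = sphereDiv (P 1 0) (P 0 0) := by
    change sphereDiv _ _ = _; simp
  have h1 : boundaryMap P OnePoint.infty = sphereDiv (P 1 1) (P 0 1) := rfl
  have hdet : P 0 0 * P 1 1 - P 0 1 * P 1 0 = 1 := by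
    rw [← Matrix.det_fin_two]; exact P.det_coe
  rw [← hC, ← hD, h0, h1]
  have hpair : pairing (axialGenerator P) φ₀ φ₁ φ₂ = φ₀ * (P 0 0 * P 0 1) +
      φ₁ * (P 0 0 * P 1 1 + P 0 1 * P 1 0) + φ₂ * (P 1 0 * P 1 1) := by
    simp [pairing, axialGenerator]; ring
  rw [hpair]
  generalize P 0 0 = α at *
  generalize P 0 1 = β at *
  generalize P 1 0 = γ at *
  generalize P 1 1 = δ at *
  -- `α = 0` means `C = ∞` and `β = 0` means `D = ∞`; the determinant excludes both together.
  by_cases hα : α = 0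
  · have hβ : β ≠ 0 := by rintro rfl; simp [hα] at hdet
    have hβγ : β * γ = -1 := by rw [hα] at hdet; linear_combination -hdet
    simp only [sphereDiv, hα, hβ, if_true, if_false]
    change Filter.Tendsto (fun c => eval2 _ c (δ / β) / (c - δ / β)) _ _
    simp only [eval2_fluxPolynomial]
    have := (tendsto_quotient (φ₂ * (δ / β) + φ₁) (φ₁ * (δ / β) + φ₀) (δ / β)).neg
    rw [neg_neg] at this
    convert this using 1
    · ext c
      rw [← neg_sub c, div_neg, neg_neg]; congr 1; ring
    · congr 1
      have hγ : γ = -1 / β := by field_simp; linear_combination hβγ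
      rw [hγ]; field_simp; ring
  · by_cases hβ : β = 0
    · have hαδ : α * δ = 1 := by rw [hβ] at hdet; linear_combination hdet
      simp only [sphereDiv, hα, hβ, if_true, if_false]
      change Filter.Tendsto (fun d => eval2 _ (γ / α) d / (γ / α - d)) _ _
      simp only [eval2_fluxPolynomial]
      have := tendsto_quotient (φ₂ * (γ / α) + φ₁) (φ₁ * (γ / α) + φ₀) (γ / α)
      convert this using 1
      · ext c
        congr 1; ring
      · congr 1
        have hδ : δ = 1 / α := by field_simp; linear_combination hαδ
        rw [hδ]; field_simp; ring
    · simp only [sphereDiv, hα, hβ, if_false]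
      change _ ≠ _ ∧ eval2 _ (γ / α) (δ / β) / (γ / α - δ / β) = _
      have hsub : γ / α - δ / β = -1 / (α * β) := by
        field_simp; linear_combination -hdet
      refine ⟨fun h => ?_, ?_⟩
      · rw [h, sub_self, eq_comm, div_eq_zero_iff] at hsub
        simp [hα, hβ] at hsub
      · rw [hsub, eval2_fluxPolynomial]; field_simp; ring

lemma HasQuotient.unique {P : MvPolynomial (Fin 2) ℂ} {C D : OnePoint ℂ} {v v' : ℂ}
    (h : HasQuotient P C D v) (h' : HasQuotient P C D v') : v = v' := by
  induction C using OnePoint.rec with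
  | infty =>
    induction D using OnePoint.rec with
    | infty => exact h.elim
    | coe d => exact tendsto_nhds_unique (f := fun c => eval2 P c d / (c - d)) h h'
  | coe c =>
    induction D using OnePoint.rec with
    | infty => exact tendsto_nhds_unique (f := fun d => eval2 P c d / (c - d)) h h'
    | coe d => exact h.2.symm.trans h'.2

/-! ### Residues -/

/-- Cauchy's theorem on annuli makes the circle integral independent of the radius. Nothing is
assumed on the singularity at `0`, which may be essential. -/
lemma exists_residue {Ω : Set ℂ} {h : ℂ → ℂ} (hΩ : IsOpen Ω)
    (hh : DifferentiableOn ℂ h (Ω \ {0})) :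
    ∃ a, ∀ r : ℝ, 0 < r → Metric.closedBall (0 : ℂ) r ⊆ Ω →
      (∮ z in C(0, r), h z) = 2 * Real.pi * Complex.I * a := by
  have hopen : IsOpen (Ω \ {0}) := hΩ.sdiff isClosed_singleton
  have hpi : (2 * Real.pi * Complex.I : ℂ) ≠ 0 := Complex.two_pi_I_ne_zero
  have main : ∀ r R : ℝ, 0 < r → r ≤ R → Metric.closedBall (0 : ℂ) R ⊆ Ω →
      (∮ z in C(0, R), h z) = ∮ z in C(0, r), h z := by
    intro r R hr hrR hR
    have hmem : ∀ z ∈ Metric.closedBall (0 : ℂ) R \ Metric.ball 0 r, z ∈ Ω \ {0} := by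
      rintro z ⟨hz, hz'⟩
      refine ⟨hR hz, fun h0 => hz' ?_⟩
      rw [mem_singleton_iff.1 h0]; exact Metric.mem_ball_self hr
    refine Complex.circleIntegral_eq_of_differentiable_on_annulus_off_countable hr hrR
      countable_empty (hh.continuousOn.mono hmem) fun z hz => ?_
    refine hh.differentiableAt (hopen.mem_nhds (hmem z ⟨Metric.ball_subset_closedBall hz.1.1, ?_⟩))
    exact fun h => hz.1.2 (Metric.ball_subset_closedBall h)
  by_cases hex : ∃ r : ℝ, 0 < r ∧ Metric.closedBall (0 : ℂ) r ⊆ Ω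
  · obtain ⟨r₀, h0, hr0⟩ := hex
    refine ⟨(2 * Real.pi * Complex.I)⁻¹ * ∮ z in C(0, r₀), h z, fun r hr hrΩ => ?_⟩
    rw [mul_inv_cancel_left₀ hpi]
    rcases le_total r r₀ with hle | hle
    · exact (main r r₀ hr hle hr0).symm
    · exact main r₀ r h0 hle hrΩ
  -- Without a closed disk in `Ω` the condition is vacuous and any value will do.
  · push Not at hex
    exact ⟨0, fun r hr hrΩ => absurd hrΩ (hex r hr)⟩

lemma exists_closedBall_subset {Ω : Set ℂ} (hΩ : IsOpen Ω) (h0 : (0 : ℂ) ∈ Ω) :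
    ∃ r : ℝ, 0 < r ∧ Metric.closedBall (0 : ℂ) r ⊆ Ω :=
  Metric.nhds_basis_closedBall.mem_iff.1 (hΩ.mem_nhds h0)

/-- `a` is the residue of the form `h(z) dz`, computed on circles in `Ω`. -/
def IsResidueOn (Ω : Set ℂ) (h : ℂ → ℂ) (a : ℂ) : Prop :=
  ∀ r : ℝ, 0 < r → Metric.closedBall (0 : ℂ) r ⊆ Ω →
      (∮ z in C(0, r), h z) = 2 * Real.pi * Complex.I * a

lemma IsResidueOn.hasResidue {Ω : Set ℂ} {h : ℂ → ℂ} {a : ℂ} (hΩ : IsOpen Ω) (h0 : (0 : ℂ) ∈ Ω)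
    (ha : IsResidueOn Ω h a) : HasResidue h a := by
  obtain ⟨r₀, hr0, hsub⟩ := exists_closedBall_subset hΩ h0
  have : Ioo (0 : ℝ) r₀ ∈ 𝓝[>] (0 : ℝ) := Ioo_mem_nhdsGT hr0
  filter_upwards [this] with r hr
  rw [ha r hr.1 ((Metric.closedBall_subset_closedBall hr.2.le).trans hsub),
    inv_mul_cancel_left₀ Complex.two_pi_I_ne_zero]

lemma circleMap_zero_eq (r t : ℝ) : circleMap 0 r t = r * Complex.exp (t * Complex.I) := by
  simp [circleMap]

/-- For `σ = -1` the substitution `t ↦ -t` moves the interval to `[-2π, 0]`, and periodicity moves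
it back. -/
lemma integral_circle_sign (h : ℂ → ℂ) (r : ℝ) {σ : ℝ} (hσ : σ = 1 ∨ σ = -1) :
    (∫ t in (0 : ℝ)..(2 * Real.pi), h (r * Complex.exp (σ * t * Complex.I)) *
      deriv (fun t : ℝ => (r : ℂ) * Complex.exp (σ * t * Complex.I)) t) =
      σ * ∮ z in C(0, r), h z := by
  have hfun : (fun t : ℝ => (r : ℂ) * Complex.exp (σ * t * Complex.I)) =
      fun t : ℝ => circleMap 0 r (σ * t) := by
    ext t; rw [circleMap_zero_eq]; push_cast; rfl
  have hd (t : ℝ) : deriv (fun t : ℝ => circleMap 0 r (σ * t)) t =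
      σ * deriv (circleMap 0 r) (σ * t) := by
    have h1 := ((differentiable_circleMap 0 r) (σ * t)).hasDerivAt
    have h2 : HasDerivAt (fun t : ℝ => σ * t) σ t := by simpa using (hasDerivAt_id t).const_mul σ
    rw [show (fun t : ℝ => circleMap 0 r (σ * t)) = circleMap 0 r ∘ fun t => σ * t from rfl,
      (h1.scomp t h2).deriv, Complex.real_smul]
  have hfun' (t : ℝ) : (r : ℂ) * Complex.exp (σ * t * Complex.I) = circleMap 0 r (σ * t) :=
    congrFun hfun t
  rw [hfun]
  simp only [hfun', hd, circleIntegral]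
  set g : ℝ → ℂ := fun θ => deriv (circleMap 0 r) θ • h (circleMap 0 r θ) with hg
  have hper : Function.Periodic g (2 * Real.pi) := by
    intro θ
    have h2 : (circleMap (0:ℂ) r) (θ + 2 * Real.pi) = circleMap 0 r θ := periodic_circleMap 0 r θ
    simp only [hg, deriv_circleMap, h2]
  have : ∀ t, h (circleMap 0 r (σ * t)) * (σ * deriv (circleMap 0 r) (σ * t)) = σ * g (σ * t) := by
    intro t; simp only [hg, smul_eq_mul]; ring
  simp only [this]
  rw [intervalIntegral.integral_const_mul]
  congr 1
  rcases hσ with rfl | rfl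
  · simp
  · simp only [neg_one_mul]
    rw [intervalIntegral.integral_comp_neg (fun t => g t)]
    have := hper.intervalIntegral_add_eq (-(2 * Real.pi)) 0
    simpa using this

/-- The integral of a form over a loop around the end. -/
lemma IsEndLoop.integral_eq {Ω : Set ℂ} {h : ℂ → ℂ} {a : ℂ} {σ : ℝ} {c : ℝ → ℂ}
    (hc : IsEndLoop Ω σ c) (hσ : σ = 1 ∨ σ = -1) (hΩ : IsOpen Ω)
    (hh : DifferentiableOn ℂ h (Ω \ {0})) (ha : IsResidueOn Ω h a) :
    ∫ t in (0 : ℝ)..(2 * Real.pi), h (c t) * deriv c t = σ * (2 * Real.pi * Complex.I * a) := by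
  obtain ⟨r, hr, hrΩ, H, hH, hHt, hH0, hH1⟩ := hc.homotopic
  have h1 := integral_eq_of_homotopy (hΩ.sdiff isClosed_singleton) hh hH hHt
  simp only [hH0, hH1] at h1
  rw [← ha r hr hrΩ, ← integral_circle_sign h r hσ, ← h1]

lemma IsEndLoop.mem {Ω : Set ℂ} {σ : ℝ} {c : ℝ → ℂ} (hc : IsEndLoop Ω σ c) (t : ℝ) :
    c t ∈ Ω \ {0} := by
  obtain ⟨r, hr, hrΩ, H, hH, hHt, hH0, hH1⟩ := hc.homotopic
  rw [← hH0]; exact (hHt 0 ⟨le_rfl, zero_le_one⟩ t).1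

/-! ### The forms of an end -/

/-- Two lifts of the same surface define the same forms. -/
lemma IsNullLift.forms_unique {X : ℂ → ℂ × ℝ} {A B C D A' B' C' D' : ℂ → ℂ} {z : ℂ}
    (h : IsNullLift X A B C D z) (h' : IsNullLift X A' B' C' D' z) :
    D z * deriv C z - C z * deriv D z = D' z * deriv C' z - C' z * deriv D' z ∧
    C z * deriv B z - D z * deriv A z = C' z * deriv B' z - D' z * deriv A' z ∧
    B z * deriv A z - A z * deriv B z = B' z * deriv A' z - A' z * deriv B' z := by
  have key (ξ : Matrix (Fin 2) (Fin 2) ℂ) :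
      pairing ξ (D z * deriv C z - C z * deriv D z) (C z * deriv B z - D z * deriv A z)
        (B z * deriv A z - A z * deriv B z) =
      pairing ξ (D' z * deriv C' z - C' z * deriv D' z) (C' z * deriv B' z - D' z * deriv A' z)
        (B' z * deriv A' z - A' z * deriv B' z) := by
    -- The left side of `flux_density` depends only on `X`. The direction `1` compares the imaginary
    -- parts of the pairings and the direction `i` their real parts; suitable `ξ` then isolate each
    -- form.
    have h1 := (h.flux_density ξ 1).symm.trans (h'.flux_density ξ 1)
    have h2 := (h.flux_density ξ Complex.I).symm.trans (h'.flux_density ξ Complex.I)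
    simp only [Complex.I_mul_im, one_mul] at h1 h2
    exact Complex.ext (by linarith) (by linarith)
  refine ⟨?_, ?_, ?_⟩
  · simpa [pairing] using key !![0, 1; 0, 0]
  · simpa [pairing] using key !![1, 0; 0, 0]
  · have := key !![0, 0; 1, 0]
    simp only [pairing, Matrix.of_apply, Matrix.cons_val', Matrix.cons_val_zero,
      Matrix.cons_val_one,
      Matrix.cons_val_fin_one] at this
    linear_combination -this

lemma IsNullLift.eventually_isNullLift {X : ℂ → ℂ × ℝ} {A B C D : ℂ → ℂ} {z : ℂ}
    (h : IsNullLift X A B C D z) : ∀ᶠ u in 𝓝 z, IsNullLift X A B C D u := by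
  filter_upwards [h.analytic_A.eventually_analyticAt, h.analytic_B.eventually_analyticAt,
    h.analytic_C.eventually_analyticAt, h.analytic_D.eventually_analyticAt,
    h.det_eq.eventually_nhds, h.null.eventually_nhds, h.immersed.eventually_nhds,
    h.eq_X.eventually_nhds] with u h1 h2 h3 h4 h5 h6 h7 h8
  exact ⟨h1, h2, h3, h4, h5, h6, h7, h8⟩

namespace BryantEnd

variable (E : BryantEnd)

lemma isOpen_log : IsOpen {s | Complex.exp s ∈ E.Ω} := E.isOpen_Ω.preimage Complex.continuous_exp

lemma analyticAt_F {s : ℂ} (hs : Complex.exp s ∈ E.Ω) (i j : Fin 2) :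
    AnalyticAt ℂ (fun s => E.F s i j) s :=
  (E.holomorphic_F i j).analyticAt (E.isOpen_log.mem_nhds hs)

/-- The lift is `F` composed with a branch of the logarithm around `z` that takes the principal
value at `z` itself, so its forms agree at `z` with `logFormCoeff`. -/
lemma exists_isNullLift {z : ℂ} (hz : z ∈ E.Ω \ {0}) : ∃ A B C D : ℂ → ℂ,
    IsNullLift E.X A B C D z ∧
    D z * deriv C z - C z * deriv D z = logFormCoeff E.form0 z ∧
    C z * deriv B z - D z * deriv A z = logFormCoeff E.form1 z ∧
    B z * deriv A z - A z * deriv B z = logFormCoeff E.form2 z := by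
  have hz0 : z ≠ 0 := hz.2
  -- This branch is holomorphic near every `z ≠ 0`, also on the negative axis, where the principal
  -- branch jumps.
  set ℓ : ℂ → ℂ := fun u => Complex.log z + Complex.log (u / z) with hℓ
  have hslit : ∀ᶠ u in 𝓝 z, u / z ∈ Complex.slitPlane := by
    have hc : ContinuousAt (fun u : ℂ => u / z) z := (continuous_id.div_const z).continuousAt
    refine hc.eventually_mem (Complex.isOpen_slitPlane.mem_nhds ?_)
    rw [div_self hz0]; exact Complex.one_mem_slitPlane
  have hgood : ∀ᶠ u in 𝓝 z, u ∈ E.Ω ∧ u ≠ 0 ∧ u / z ∈ Complex.slitPlane :=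
    (E.isOpen_Ω.eventually_mem hz.1).and ((isOpen_ne.eventually_mem hz0).and hslit)
  have hexp : ∀ u, u ≠ 0 → Complex.exp (ℓ u) = u := by
    intro u hu
    simp only [hℓ]
    rw [Complex.exp_add, Complex.exp_log hz0, Complex.exp_log (div_ne_zero hu hz0)]
    field_simp
  have hℓd : ∀ u, u ≠ 0 → u / z ∈ Complex.slitPlane → HasDerivAt ℓ u⁻¹ u := by
    intro u hu hs
    have := (((hasDerivAt_id u).div_const z).clog hs).const_add (Complex.log z)
    refine this.congr_deriv ?_
    simp only [id]
    field_simp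
  have hℓz : ℓ z = Complex.log z := by simp [hℓ, hz0]
  have hℓa : AnalyticAt ℂ ℓ z := by
    rw [Complex.analyticAt_iff_eventually_differentiableAt]
    filter_upwards [hgood] with u hu
    exact (hℓd u hu.2.1 hu.2.2).differentiableAt
  have hder : ∀ i j, ∀ᶠ u in 𝓝 z, deriv (fun u => E.F (ℓ u) i j) u =
      matDeriv E.F (ℓ u) i j * u⁻¹ := by
    intro i j
    filter_upwards [hgood] with u hu
    have h1 := (E.analyticAt_F (s := ℓ u) (by rw [hexp u hu.2.1]; exact hu.1) i j).differentiableAt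
    exact (h1.hasDerivAt.comp u (hℓd u hu.2.1 hu.2.2)).deriv
  have hana : ∀ i j, AnalyticAt ℂ (fun u => E.F (ℓ u) i j) z := by
    intro i j
    exact (E.analyticAt_F (s := ℓ z) (by rw [hexp z hz0]; exact hz.1) i j).comp hℓa
  refine ⟨fun u => E.F (ℓ u) 0 0, fun u => E.F (ℓ u) 0 1, fun u => E.F (ℓ u) 1 0,
    fun u => E.F (ℓ u) 1 1, ⟨hana _ _, hana _ _, hana _ _, hana _ _, ?_, ?_, ?_, ?_⟩, ?_, ?_, ?_⟩
  · filter_upwards [hgood] with u hu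
    rw [← Matrix.det_fin_two]
    exact E.det_F _ (by rw [hexp u hu.2.1]; exact hu.1)
  · filter_upwards [hgood, hder 0 0, hder 0 1, hder 1 0, hder 1 1] with u hu h1 h2 h3 h4
    rw [h1, h2, h3, h4]
    have := E.null_F (ℓ u) (by rw [hexp u hu.2.1]; exact hu.1)
    rw [Matrix.det_fin_two] at this
    linear_combination u⁻¹ ^ 2 * this
  · filter_upwards [hgood, hder 0 0, hder 0 1, hder 1 0, hder 1 1] with u hu h1 h2 h3 h4
    rw [h1, h2, h3, h4]
    rintro ⟨k1, k2, k3, k4⟩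
    have hu' := inv_ne_zero hu.2.1
    apply E.immersion_F (ℓ u) (by rw [hexp u hu.2.1]; exact hu.1)
    ext i j
    fin_cases i <;> fin_cases j
    · exact (mul_eq_zero.1 k1).resolve_right hu'
    · exact (mul_eq_zero.1 k2).resolve_right hu'
    · exact (mul_eq_zero.1 k3).resolve_right hu'
    · exact (mul_eq_zero.1 k4).resolve_right hu'
  · filter_upwards [hgood] with u hu
    have := E.X_exp (ℓ u) (by rw [hexp u hu.2.1]; exact hu.1)
    rw [hexp u hu.2.1] at this
    rw [this, ← Matrix.eta_fin_two]
  · rw [(hder 1 0).self_of_nhds, (hder 1 1).self_of_nhds, logFormCoeff, form0]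
    simp only [hℓz]
    ring
  · rw [(hder 0 1).self_of_nhds, (hder 0 0).self_of_nhds, logFormCoeff, form1]
    simp only [hℓz]
    ring
  · rw [(hder 0 1).self_of_nhds, (hder 0 0).self_of_nhds, logFormCoeff, form2]
    simp only [hℓz]
    ring

/-- `logFormCoeff` uses the principal logarithm and could jump across the cut. By `forms_unique` it
agrees near `z` with the forms of a single holomorphic lift, because both lifts represent the same
single-valued surface. -/
lemma differentiableAt_forms {z : ℂ} (hz : z ∈ E.Ω \ {0}) :
    DifferentiableAt ℂ (logFormCoeff E.form0) z ∧ DifferentiableAt ℂ (logFormCoeff E.form1) z ∧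
      DifferentiableAt ℂ (logFormCoeff E.form2) z := by
  obtain ⟨A, B, C, D, h, -⟩ := E.exists_isNullLift hz
  have hopen : IsOpen (E.Ω \ {0}) := E.isOpen_Ω.sdiff isClosed_singleton
  have hev : ∀ᶠ u in 𝓝 z,
      logFormCoeff E.form0 u = D u * deriv C u - C u * deriv D u ∧
      logFormCoeff E.form1 u = C u * deriv B u - D u * deriv A u ∧
      logFormCoeff E.form2 u = B u * deriv A u - A u * deriv B u := by
    filter_upwards [h.eventually_isNullLift, hopen.eventually_mem hz] with u hu huΩ
    obtain ⟨A', B', C', D', h', e0, e1, e2⟩ := E.exists_isNullLift huΩ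
    rw [← e0, ← e1, ← e2]
    exact h'.forms_unique hu
  have hA := h.analytic_A.differentiableAt
  have hB := h.analytic_B.differentiableAt
  have hC := h.analytic_C.differentiableAt
  have hD := h.analytic_D.differentiableAt
  have hA' := h.analytic_A.deriv.differentiableAt
  have hB' := h.analytic_B.deriv.differentiableAt
  have hC' := h.analytic_C.deriv.differentiableAt
  have hD' := h.analytic_D.deriv.differentiableAt
  refine ⟨?_, ?_, ?_⟩
  · exact ((hD.mul hC').sub (hC.mul hD')).congr_of_eventuallyEq (hev.mono fun u hu => hu.1)
  · exact ((hC.mul hB').sub (hD.mul hA')).congr_of_eventuallyEq (hev.mono fun u hu => hu.2.1)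
  · exact ((hB.mul hA').sub (hA.mul hB')).congr_of_eventuallyEq (hev.mono fun u hu => hu.2.2)

/-- The inverse is the adjugate, so three entries are the forms by definition. The last one follows
because the derivative of `det F = 1` makes the trace vanish. -/
lemma mulInv_apply {s : ℂ} (hs : Complex.exp s ∈ E.Ω) :
    matDeriv E.F s * (E.F s)⁻¹ = !![-E.form1 s, -E.form2 s; E.form0 s, E.form1 s] := by
  have hdet := E.det_F s hs
  have hd : matDeriv E.F s 0 0 * E.F s 1 1 + E.F s 0 0 * matDeriv E.F s 1 1 -
      (matDeriv E.F s 0 1 * E.F s 1 0 + E.F s 0 1 * matDeriv E.F s 1 0) = 0 := by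
    have hF (i j) := (E.analyticAt_F hs i j).differentiableAt.hasDerivAt
    have h1 := (((hF 0 0).mul (hF 1 1)).sub ((hF 0 1).mul (hF 1 0))).deriv
    have h2 : ((fun s => E.F s 0 0) * (fun s => E.F s 1 1) -
        (fun s => E.F s 0 1) * (fun s => E.F s 1 0)) =ᶠ[𝓝 s] fun _ => (1 : ℂ) := by
      filter_upwards [E.isOpen_log.eventually_mem hs] with u hu
      have := E.det_F u hu
      rwa [Matrix.det_fin_two] at this
    rw [h2.deriv_eq, deriv_const] at h1
    exact h1.symm
  rw [Matrix.inv_def, hdet, Ring.inverse_one, one_smul, Matrix.adjugate_fin_two]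
  ext i j
  fin_cases i <;> fin_cases j <;>
    simp [Matrix.mul_apply, Fin.sum_univ_two, form0, form1, form2]
  · ring
  · ring
  · ring
  · linear_combination hd

lemma exists_residues : ∃ r₀ r₁ r₂ : ℂ, IsResidueOn E.Ω (logFormCoeff E.form0) r₀ ∧
    IsResidueOn E.Ω (logFormCoeff E.form1) r₁ ∧ IsResidueOn E.Ω (logFormCoeff E.form2) r₂ := by
  obtain ⟨r₀, h₀⟩ := exists_residue E.isOpen_Ω (h := logFormCoeff E.form0) fun z hz =>
    (E.differentiableAt_forms hz).1.differentiableWithinAt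
  obtain ⟨r₁, h₁⟩ := exists_residue E.isOpen_Ω (h := logFormCoeff E.form1) fun z hz =>
    (E.differentiableAt_forms hz).2.1.differentiableWithinAt
  obtain ⟨r₂, h₂⟩ := exists_residue E.isOpen_Ω (h := logFormCoeff E.form2) fun z hz =>
    (E.differentiableAt_forms hz).2.2.differentiableWithinAt
  exact ⟨r₀, r₁, r₂, h₀, h₁, h₂⟩

lemma integral_forms {c : ℝ → ℂ} {σ : ℝ} (hc : IsEndLoop E.Ω σ c) (hσ : σ = 1 ∨ σ = -1)
    {r₀ r₁ r₂ : ℂ} (h₀ : IsResidueOn E.Ω (logFormCoeff E.form0) r₀)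
    (h₁ : IsResidueOn E.Ω (logFormCoeff E.form1) r₁)
    (h₂ : IsResidueOn E.Ω (logFormCoeff E.form2) r₂) :
    (∫ t in (0 : ℝ)..(2 * Real.pi), logFormCoeff E.form0 (c t) * deriv c t) =
      σ * (2 * Real.pi * Complex.I * r₀) ∧
    (∫ t in (0 : ℝ)..(2 * Real.pi), logFormCoeff E.form1 (c t) * deriv c t) =
      σ * (2 * Real.pi * Complex.I * r₁) ∧
    (∫ t in (0 : ℝ)..(2 * Real.pi), logFormCoeff E.form2 (c t) * deriv c t) =
      σ * (2 * Real.pi * Complex.I * r₂) :=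
  ⟨hc.integral_eq hσ E.isOpen_Ω
      (fun _ hz => (E.differentiableAt_forms hz).1.differentiableWithinAt) h₀,
    hc.integral_eq hσ E.isOpen_Ω
      (fun _ hz => (E.differentiableAt_forms hz).2.1.differentiableWithinAt) h₁,
    hc.integral_eq hσ E.isOpen_Ω
      (fun _ hz => (E.differentiableAt_forms hz).2.2.differentiableWithinAt) h₂⟩

/-- The flux matrix in terms of the residues. -/
lemma hasFluxMatrix {r₀ r₁ r₂ : ℂ} (h₀ : IsResidueOn E.Ω (logFormCoeff E.form0) r₀)
    (h₁ : IsResidueOn E.Ω (logFormCoeff E.form1) r₁)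
    (h₂ : IsResidueOn E.Ω (logFormCoeff E.form2) r₂) :
    E.HasFluxMatrix !![r₁, r₂; -r₀, -r₁] := by
  intro c hc i j
  obtain ⟨i0, i1, i2⟩ := E.integral_forms hc (Or.inl rfl) h₀ h₁ h₂
  simp only [Complex.ofReal_one, one_mul] at i0 i1 i2
  have hcoeff (t : ℝ) : logFormCoeff (fun s => (matDeriv E.F s * (E.F s)⁻¹) i j) (c t) =
      (!![-logFormCoeff E.form1 (c t), -logFormCoeff E.form2 (c t);
        logFormCoeff E.form0 (c t), logFormCoeff E.form1 (c t)] : Matrix _ _ ℂ) i j := by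
    have hm := hc.mem t
    have hexp : Complex.exp (Complex.log (c t)) ∈ E.Ω := by
      rw [Complex.exp_log hm.2]; exact hm.1
    simp only [logFormCoeff, E.mulInv_apply hexp]
    fin_cases i <;> fin_cases j <;> simp [neg_div]
  simp only [hcoeff]
  have hpi := Complex.two_pi_I_ne_zero
  fin_cases i <;> fin_cases j <;>
    simp only [Fin.zero_eta, Fin.mk_one, Fin.isValue, Matrix.of_apply, Matrix.cons_val',
      Matrix.cons_val_zero, Matrix.cons_val_one, Matrix.cons_val_fin_one, neg_mul,
      intervalIntegral.integral_neg, i0, i1, i2, neg_neg, mul_neg]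
    <;> rw [inv_mul_cancel_left₀ hpi]

end BryantEnd

/-! ### Regularity of the surface -/

open IsNullLift in
lemma IsNullLift.contDiffAt {X : ℂ → ℂ × ℝ} {A B C D : ℂ → ℂ} {z : ℂ}
    (h : IsNullLift X A B C D z) : ContDiffAt ℝ 2 X z := by
  have hA : ContDiffAt ℝ 2 A z := h.analytic_A.contDiffAt.restrict_scalars ℝ
  have hB : ContDiffAt ℝ 2 B z := h.analytic_B.contDiffAt.restrict_scalars ℝ
  have hC : ContDiffAt ℝ 2 C z := h.analytic_C.contDiffAt.restrict_scalars ℝ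
  have hD : ContDiffAt ℝ 2 D z := h.analytic_D.contDiffAt.restrict_scalars ℝ
  have hA' : ContDiffAt ℝ 2 (fun u => conj (A u)) z :=
    (Complex.conjCLE : ℂ →L[ℝ] ℂ).contDiff.contDiffAt.comp z hA
  have hB' : ContDiffAt ℝ 2 (fun u => conj (B u)) z :=
    (Complex.conjCLE : ℂ →L[ℝ] ℂ).contDiff.contDiffAt.comp z hB
  have hw : ContDiffAt ℝ 2 (height A B) z :=
    ((hA.mul hA').add (hB.mul hB')).inv (mul_conj_row_ne_zero h.det_eq.self_of_nhds)
  refine ContDiffAt.congr_of_eventuallyEq ?_ h.eq_explicit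
  exact (((hA'.mul hC).add (hB'.mul hD)).mul hw).prodMk
    (Complex.reCLM.contDiff.contDiffAt.comp z hw)

namespace BryantEnd

variable (E : BryantEnd)

lemma contDiffAt_X {z : ℂ} (hz : z ∈ E.Ω \ {0}) : ContDiffAt ℝ 2 E.X z := by
  obtain ⟨A, B, C, D, h, -⟩ := E.exists_isNullLift hz
  exact h.contDiffAt

lemma exists_hasSpinors {z : ℂ} (hz : z ∈ E.Ω \ {0}) : ∃ p q, HasSpinors E.X p q z := by
  obtain ⟨A, B, C, D, h, -⟩ := E.exists_isNullLift hz
  exact h.exists_hasSpinors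

lemma X_mem {z : ℂ} (hz : z ∈ E.Ω \ {0}) : E.X z ∈ halfSpace := by
  obtain ⟨p, q, h⟩ := E.exists_hasSpinors hz
  exact h.height_pos

lemma flux_density {z : ℂ} (hz : z ∈ E.Ω \ {0}) (ξ : Matrix (Fin 2) (Fin 2) ℂ) (e : ℂ) :
    -hypInner (E.X z) (fderiv ℝ E.X z (Complex.I * e)) (killingField ξ (E.X z)) -
      hypInner (E.X z) (killingField (Complex.I • ξ) (E.X z)) (fderiv ℝ E.X z e) =
    2 * (e * pairing ξ (logFormCoeff E.form0 z) (logFormCoeff E.form1 z)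
      (logFormCoeff E.form2 z)).im := by
  obtain ⟨A, B, C, D, h, e0, e1, e2⟩ := E.exists_isNullLift hz
  rw [← e0, ← e1, ← e2]; exact h.flux_density ξ e

lemma deriv_X_comp {c : ℝ → ℂ} {t : ℝ} (hc : DifferentiableAt ℝ c t) (hz : c t ∈ E.Ω \ {0}) :
    deriv (fun u => E.X (c u)) t = fderiv ℝ E.X (c t) (deriv c t) :=
  (((E.contDiffAt_X hz).differentiableAt two_ne_zero).hasFDerivAt.comp_hasDerivAt t
    hc.hasDerivAt).deriv

end BryantEnd

/-! ### The conormal and the evaluation of the flux integral -/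

lemma hypInner_smul_left (p u v : ℂ × ℝ) (k : ℝ) : hypInner p (k • u) v = k * hypInner p u v := by
  simp [hypInner]; ring

lemma hypInner_neg_left (p u v : ℂ × ℝ) : hypInner p (-u) v = -hypInner p u v := by
  simp [hypInner]; ring

lemma continuous_hypInner {P U V : ℝ → ℂ × ℝ} (hP : Continuous P) (hU : Continuous U)
    (hV : Continuous V) (h0 : ∀ t, P t ∈ halfSpace) :
    Continuous fun t => hypInner (P t) (U t) (V t) := by
  unfold hypInner
  refine Continuous.div ?_ (hP.snd.pow 2) fun t => pow_ne_zero 2 (ne_of_gt (h0 t))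
  exact (Complex.continuous_re.comp (hU.fst.star.mul hV.fst)).add (hU.snd.mul hV.snd)

lemma HasSpinors.hypNorm_fderiv {X : ℂ → ℂ × ℝ} {p q z : ℂ} (h : HasSpinors X p q z) (e : ℂ) :
    hypNorm (X z) (fderiv ℝ X z e) =
      (X z).2 * (Complex.normSq p + Complex.normSq q) * ‖e‖ := by
  have h1 : (star e * e).re = ‖e‖ ^ 2 := by
    rw [Complex.star_def, ← Complex.normSq_eq_conj_mul_self, Complex.ofReal_re,
      Complex.normSq_eq_norm_sq]
  rw [hypNorm, h.hypInner_fderiv, h1, ← mul_pow, Real.sqrt_sq]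
  have := h.height_pos
  have := h.ne_zero
  positivity

/-- A vector orthogonal to `e` and pointing to its right is a multiple of `-i e`. -/
lemma eq_of_orthogonal {e v : ℂ} (hre : (star v * e).re = 0)
    (him : (star e * v).im < 0) : (‖e‖ : ℂ) * v = -(Complex.I * e) * ‖v‖ := by
  have h1 : star e * v = -Complex.I * (‖e‖ * ‖v‖ : ℝ) := by
    have h2 : (star e * v).re = 0 := by
      rw [← hre]; simp only [Complex.star_def, Complex.mul_re, Complex.conj_re, Complex.conj_im]
      ring
    have h3 : ‖star e * v‖ = -(star e * v).im := by
      have h4 : star e * v = ((star e * v).im : ℂ) * Complex.I := by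
        apply Complex.ext
        · rw [h2]; simp
        · simp
      conv_lhs => rw [h4]
      rw [norm_mul, Complex.norm_I, mul_one, Complex.norm_real, Real.norm_eq_abs, abs_of_neg him]
    rw [norm_mul, norm_star] at h3
    apply Complex.ext
    · rw [h2]; simp
    · rw [h3]; simp
  have he : (‖e‖ : ℂ) ≠ 0 := by
    intro h0
    have : e = 0 := by simpa using h0
    simp [this] at him
  have h5 : e * star e = (‖e‖ : ℂ) ^ 2 := by
    rw [Complex.star_def, Complex.mul_conj, Complex.normSq_eq_norm_sq]; push_cast; rfl
  apply mul_left_cancel₀ he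
  push_cast at h1
  linear_combination e * h1 - v * h5

namespace BryantEnd

variable {E : BryantEnd}

/-- The orientation convention forces the loop to turn negatively, and determines the conormal. -/
lemma IsFluxConfig.sign_and_conormal {σ : ℝ} {c : ℝ → ℂ} {η : ℝ → ℂ × ℝ} {K : ℂ → ℂ × ℝ}
    (h : E.IsFluxConfig σ c η K) (t : ℝ) : σ = -1 ∧
      hypNorm (E.X (c t)) (deriv (fun u => E.X (c u)) t) • η t =
        -fderiv ℝ E.X (c t) (Complex.I * deriv c t) := by
  have hz := h.loop.mem t
  obtain ⟨p, q, hs⟩ := E.exists_hasSpinors hz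
  obtain ⟨v, hv, hη⟩ := h.conormal_side t
  have hX := E.deriv_X_comp (h.loop.contDiff.differentiable two_ne_zero t) hz
  have ho := h.conormal_orthogonal t
  have hu := h.conormal_unit t
  have hor := h.orientation t
  have hw := hs.height_pos
  have hS := hs.ne_zero
  rw [hη, hX, hs.hypInner_fderiv] at ho
  rw [hη, hs.hypNorm_fderiv] at hu
  rw [hη, hX, hs.det3_meanCurvatureVector] at hor
  -- In the basis `(dX(c'), dX(v), -H)` the determinant is a negative multiple of `Im (c̄' v)`, so a
  -- direct basis puts `v` to the right of `c`. The conormal points to the puncture, hence the loop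
  -- turns negatively.
  have him : (star (deriv c t) * v).im < 0 := by
    by_contra! hge
    have : 0 ≤ (E.X (c t)).2 ^ 5 * (Complex.normSq p + Complex.normSq q) ^ 2 *
      (star (deriv c t) * v).im := by positivity
    linarith
  have hσ : σ = -1 := by
    rcases h.sign with h1 | h1
    · rw [h1] at hv; linarith
    · exact h1
  have hre : (star v * deriv c t).re = 0 := by
    rcases mul_eq_zero.1 ho with h1 | h1
    · exact absurd h1 (by positivity)
    · exact h1
  refine ⟨hσ, ?_⟩
  rw [hη, hX, hs.hypNorm_fderiv, ← map_smul, ← map_neg]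
  congr 1
  have h1 := eq_of_orthogonal hre him
  have h2 : (((E.X (c t)).2 * (Complex.normSq p + Complex.normSq q) * ‖v‖ : ℝ) : ℂ) = 1 := by
    rw [hu]; simp
  push_cast at h2
  rw [Complex.real_smul]
  push_cast
  linear_combination ((E.X (c t)).2 * (Complex.normSq p + Complex.normSq q) : ℂ) * h1 -
    Complex.I * deriv c t * h2

/-- The flux of a Killing field in terms of the residues. -/
lemma IsFluxConfig.fluxIntegral_eq {σ : ℝ} {c : ℝ → ℂ} {η : ℝ → ℂ × ℝ} {K : ℂ → ℂ × ℝ}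
    (h : E.IsFluxConfig σ c η K) {Y : ℂ × ℝ → ℂ × ℝ} {ξ : Matrix (Fin 2) (Fin 2) ℂ}
    (hY : ∀ p ∈ halfSpace, Y p = killingField ξ p)
    {r₀ r₁ r₂ : ℂ} (h₀ : IsResidueOn E.Ω (logFormCoeff E.form0) r₀)
    (h₁ : IsResidueOn E.Ω (logFormCoeff E.form1) r₁)
    (h₂ : IsResidueOn E.Ω (logFormCoeff E.form2) r₂) :
    E.fluxIntegral c η K Y = (-pairing ξ (4 * Real.pi * r₀) (4 * Real.pi * r₁)
      (4 * Real.pi * r₂)).re := by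
  have hσ := (h.sign_and_conormal 0).1
  have hmem := h.loop.mem
  have hcd := h.loop.contDiff
  have hcdiff := hcd.differentiable two_ne_zero
  have hc' : Continuous (deriv c) := hcd.continuous_deriv one_le_two
  have hXmem (t : ℝ) : E.X (c t) ∈ halfSpace := E.X_mem (hmem t)
  have hXc : Continuous fun t => E.X (c t) := continuous_iff_continuousAt.2 fun t =>
    (E.contDiffAt_X (hmem t)).continuousAt.comp hcd.continuous.continuousAt
  have hdX : Continuous fun t => fderiv ℝ E.X (c t) := continuous_iff_continuousAt.2 fun t =>
    ContinuousAt.comp (g := fderiv ℝ E.X)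
      ((E.contDiffAt_X (hmem t)).fderiv_right (m := 1) (by norm_num)).continuousAt
      hcd.continuous.continuousAt
  have hYc (ξ) : Continuous fun t => killingField ξ (E.X (c t)) :=
    (contDiff_killingField ξ).continuous.comp hXc
  have hg1 : Continuous fun t => -hypInner (E.X (c t))
      (fderiv ℝ E.X (c t) (Complex.I * deriv c t)) (killingField ξ (E.X (c t))) :=
    (continuous_hypInner hXc (hdX.clm_apply (continuous_const.mul hc')) (hYc _) hXmem).neg
  have hg2 : Continuous fun t => hypInner (E.X (c t)) (killingField (Complex.I • ξ) (E.X (c t)))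
      (fderiv ℝ E.X (c t) (deriv c t)) :=
    continuous_hypInner hXc (hYc _) (hdX.clm_apply hc') hXmem
  -- The length element times the conormal is `-dX(i c')`, which removes the normalisation of `η`.
  have hline : (∫ t in (0 : ℝ)..(2 * Real.pi), hypInner (E.X (c t)) (η t) (Y (E.X (c t))) *
      hypNorm (E.X (c t)) (deriv (fun u => E.X (c u)) t)) =
      ∫ t in (0 : ℝ)..(2 * Real.pi), -hypInner (E.X (c t))
        (fderiv ℝ E.X (c t) (Complex.I * deriv c t)) (killingField ξ (E.X (c t))) := by
    congr 1; ext t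
    rw [hY _ (hXmem t), mul_comm, ← hypInner_smul_left, (h.sign_and_conormal t).2,
      hypInner_neg_left]
  -- The factor `2` in the flux cancels the `1/2` in `killingPotential`.
  have hdisk : 2 * (∫ z in Metric.closedBall (0 : ℂ) 1,
      volForm (K z) (Y (K z)) (fderiv ℝ K z 1) (fderiv ℝ K z Complex.I)) =
      ∫ t in (0 : ℝ)..(2 * Real.pi), hypInner (E.X (c t))
        (killingField (Complex.I • ξ) (E.X (c t))) (fderiv ℝ E.X (c t) (deriv c t)) := by
    have h1 := stokes_disk isOpen_halfSpace (contDiffOn_killingPotential ξ) h.disk_contDiff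
      h.disk_mapsTo
    rw [setIntegral_congr_fun (g := fun z => extDeriv₂ (killingPotential ξ) (K z) (fderiv ℝ K z 1)
      (fderiv ℝ K z Complex.I)) Metric.isClosed_closedBall.measurableSet, h1,
      ← intervalIntegral.integral_const_mul]
    · congr 1; ext t
      have hb : (fun t : ℝ => K (Complex.exp (t * Complex.I))) = fun t => E.X (c t) :=
        funext h.disk_boundary
      rw [hb, h.disk_boundary, E.deriv_X_comp (hcdiff t) (hmem t), killingPotential_apply]
      ring
    · intro z hz
      simp only
      rw [extDeriv₂_killingPotential ξ (h.disk_mapsTo hz), hY _ (h.disk_mapsTo hz)]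
  have hf0 : Continuous fun t => logFormCoeff E.form0 (c t) * deriv c t :=
    (continuous_iff_continuousAt.2 fun t =>
      ContinuousAt.comp (g := logFormCoeff E.form0)
        (E.differentiableAt_forms (hmem t)).1.continuousAt hcd.continuous.continuousAt).mul hc'
  have hf1 : Continuous fun t => logFormCoeff E.form1 (c t) * deriv c t :=
    (continuous_iff_continuousAt.2 fun t =>
      ContinuousAt.comp (g := logFormCoeff E.form1)
        (E.differentiableAt_forms (hmem t)).2.1.continuousAt hcd.continuous.continuousAt).mul hc'
  have hf2 : Continuous fun t => logFormCoeff E.form2 (c t) * deriv c t :=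
    (continuous_iff_continuousAt.2 fun t =>
      ContinuousAt.comp (g := logFormCoeff E.form2)
        (E.differentiableAt_forms (hmem t)).2.2.continuousAt hcd.continuous.continuousAt).mul hc'
  set f : ℝ → ℂ := fun t => ξ 0 1 * (logFormCoeff E.form0 (c t) * deriv c t) -
    2 * ξ 0 0 * (logFormCoeff E.form1 (c t) * deriv c t) -
    ξ 1 0 * (logFormCoeff E.form2 (c t) * deriv c t) with hf
  have hfc : Continuous f := ((continuous_const.mul hf0).sub (continuous_const.mul hf1)).sub
    (continuous_const.mul hf2)
  -- The minus sign is `σ = -1`. With the factor `2` of the flux density, `2 Im(-2πi x) = -4π Re x`,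
  -- which is the origin of the constant `4π`.
  have hfint : ∫ t in (0 : ℝ)..(2 * Real.pi), f t =
      -(2 * Real.pi * Complex.I * pairing ξ r₀ r₁ r₂) := by
    obtain ⟨i0, i1, i2⟩ := E.integral_forms h.loop h.sign h₀ h₁ h₂
    rw [hf, intervalIntegral.integral_sub, intervalIntegral.integral_sub,
      intervalIntegral.integral_const_mul, intervalIntegral.integral_const_mul,
      intervalIntegral.integral_const_mul, i0, i1, i2, hσ, pairing]
    · push_cast; ring
    · exact (continuous_const.mul hf0).intervalIntegrable _ _
    · exact (continuous_const.mul hf1).intervalIntegrable _ _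
    · exact ((continuous_const.mul hf0).sub (continuous_const.mul hf1)).intervalIntegrable _ _
    · exact (continuous_const.mul hf2).intervalIntegrable _ _
  rw [fluxIntegral, hline, hdisk, ← intervalIntegral.integral_sub (hg1.intervalIntegrable _ _)
    (hg2.intervalIntegrable _ _)]
  have hpt (t : ℝ) : -hypInner (E.X (c t)) (fderiv ℝ E.X (c t) (Complex.I * deriv c t))
      (killingField ξ (E.X (c t))) - hypInner (E.X (c t))
        (killingField (Complex.I • ξ) (E.X (c t))) (fderiv ℝ E.X (c t) (deriv c t)) =
      2 * Complex.imCLM (f t) := by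
    rw [E.flux_density (hmem t), Complex.imCLM_apply, hf]
    congr 2
    simp only [pairing]; ring
  simp only [hpt]
  rw [intervalIntegral.integral_const_mul,
    ContinuousLinearMap.intervalIntegral_comp_comm _ (hfc.intervalIntegrable _ _), hfint]
  have h1 : -pairing ξ (4 * Real.pi * r₀) (4 * Real.pi * r₁) (4 * Real.pi * r₂) =
      ((-(4 * Real.pi) : ℝ) : ℂ) * pairing ξ r₀ r₁ r₂ := by
    simp only [pairing]; push_cast; ring
  have h2 : -(2 * Real.pi * Complex.I * pairing ξ r₀ r₁ r₂) =
      ((-(2 * Real.pi) : ℝ) : ℂ) * (Complex.I * pairing ξ r₀ r₁ r₂) := by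
    push_cast; ring
  rw [h1, h2, Complex.imCLM_apply, Complex.im_ofReal_mul, Complex.I_mul_im, Complex.re_ofReal_mul]
  ring

end BryantEnd

/-! ### Existence of curves and disks -/

lemma isEndLoop_circle {Ω : Set ℂ} {r : ℝ} (hr : 0 < r) (hΩ : Metric.closedBall (0 : ℂ) r ⊆ Ω)
    {σ : ℝ} (hσ : σ = 1 ∨ σ = -1) :
    IsEndLoop Ω σ fun t : ℝ => (r : ℂ) * Complex.exp (σ * t * Complex.I) := by
  have hc : ContDiff ℝ 2 fun t : ℝ => (r : ℂ) * Complex.exp (σ * t * Complex.I) :=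
    contDiff_const.mul ((contDiff_const.mul Complex.ofRealCLM.contDiff).mul contDiff_const).cexp
  refine ⟨hc, r, hr, hΩ, fun p => (r : ℂ) * Complex.exp (σ * p.2 * Complex.I),
    hc.comp contDiff_snd, fun s _ t => ⟨⟨hΩ ?_, ?_⟩, ?_⟩, fun t => rfl, fun t => rfl⟩
  · rw [mem_closedBall_zero_iff, norm_mul, ← Complex.ofReal_mul, Complex.norm_exp_ofReal_mul_I]
    simp [abs_of_pos hr]
  · simp [hr.ne']
  · rcases hσ with rfl | rfl
    · push_cast
      rw [one_mul, one_mul, add_mul, Complex.exp_periodic]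
    · push_cast
      rw [show (-1 : ℂ) * (t + 2 * Real.pi) * Complex.I =
        -1 * t * Complex.I - 2 * Real.pi * Complex.I by ring, Complex.exp_periodic.sub_eq]

/-- A disk bounded by a closed curve in the half-space: a smoothed cone over the curve. -/
lemma exists_disk {X : ℂ → ℂ × ℝ} {r : ℝ}
    (hX : ∀ z : ℂ, ‖z‖ = r → ContDiffAt ℝ 2 X z ∧ X z ∈ halfSpace) (hr : 0 < r) :
    ∃ K : ℂ → ℂ × ℝ, ContDiff ℝ 2 K ∧ MapsTo K (Metric.closedBall 0 1) halfSpace ∧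
      ∀ z : ℂ, ‖z‖ = 1 → K z = X (r * conj z) := by
  -- The cutoff vanishes for `|z|² ≤ 1/2`, which hides the singularity at `0` of the radial
  -- projection `g`, and equals one on the unit circle. The conjugation in `g` makes the boundary
  -- run negatively, as the orientation of `Γ` requires.
  set χ : ℂ → ℝ := fun z => Real.smoothTransition (2 * Complex.normSq z - 1) with hχ
  set g : ℂ → ℂ := fun z => (r : ℂ) * conj z * ((‖z‖⁻¹ : ℝ) : ℂ) with hg
  have hgnorm : ∀ z : ℂ, z ≠ 0 → ‖g z‖ = r := by
    intro z hz
    have := norm_ne_zero_iff.2 hz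
    simp only [hg, norm_mul, Complex.norm_real, RCLike.norm_conj, norm_inv,
      Real.norm_eq_abs, abs_of_pos hr, abs_norm]
    field_simp
  have hnormSq : ContDiff ℝ 2 (fun z : ℂ => Complex.normSq z) := by
    simp only [Complex.normSq_apply]
    exact (Complex.reCLM.contDiff.mul Complex.reCLM.contDiff).add
      (Complex.imCLM.contDiff.mul Complex.imCLM.contDiff)
  have hχc : ContDiff ℝ 2 χ :=
    Real.smoothTransition.contDiff.comp ((contDiff_const.mul hnormSq).sub contDiff_const)
  have hgc : ∀ z : ℂ, z ≠ 0 → ContDiffAt ℝ 2 g z := by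
    intro z hz
    have h1 : ContDiffAt ℝ 2 (fun z : ℂ => conj z) z :=
      (Complex.conjCLE : ℂ →L[ℝ] ℂ).contDiff.contDiffAt
    have h2 : ContDiffAt ℝ 2 (fun z : ℂ => ((‖z‖⁻¹ : ℝ) : ℂ)) z :=
      Complex.ofRealCLM.contDiff.contDiffAt.comp z
        ((contDiffAt_norm ℝ hz).inv (norm_ne_zero_iff.2 hz))
    exact (contDiffAt_const.mul h1).mul h2
  have hp₀ : X (r : ℂ) ∈ halfSpace := (hX r (by simp [abs_of_pos hr])).2
  refine ⟨fun z => X r + χ z • (X (g z) - X r), ?_, ?_, ?_⟩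
  · rw [contDiff_iff_contDiffAt]
    intro z
    by_cases hz : z = 0
    · have h1 : ∀ᶠ u in 𝓝 z, Complex.normSq u < 1 / 2 := by
        refine (Complex.continuous_normSq.continuousAt).eventually_lt continuousAt_const ?_
        rw [hz]; simp
      refine ContDiffAt.congr_of_eventuallyEq (f := fun _ => X r) contDiffAt_const ?_
      filter_upwards [h1] with u hu
      have : χ u = 0 := Real.smoothTransition.zero_of_nonpos (by linarith)
      simp [this]
    · have h1 : ContDiffAt ℝ 2 (fun z => X (g z)) z :=
        ContDiffAt.comp z (hX _ (hgnorm z hz)).1 (hgc z hz)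
      exact contDiffAt_const.add (hχc.contDiffAt.smul (h1.sub contDiffAt_const))
  -- The half-space is convex, and `0 ≤ χ ≤ 1`.
  · intro z _
    change 0 < (X r + χ z • (X (g z) - X r)).2
    by_cases hz : z = 0
    · have : χ z = 0 := Real.smoothTransition.zero_of_nonpos (by simp [hz])
      rw [this, zero_smul, add_zero]; exact hp₀
    · have h1 : 0 < (X (g z)).2 := (hX _ (hgnorm z hz)).2
      have h2 : 0 < (X r).2 := hp₀
      have h3 : 0 ≤ χ z := Real.smoothTransition.nonneg _
      have h4 : χ z ≤ 1 := Real.smoothTransition.le_one _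
      simp only [Prod.snd_add, Prod.smul_snd, Prod.snd_sub, smul_eq_mul]
      rcases h4.eq_or_lt with h5 | h5
      · rw [h5]; linarith
      · nlinarith [mul_nonneg h3 h1.le, mul_pos (sub_pos.2 h5) h2]
  · intro z hz
    have h1 : Complex.normSq z = 1 := by rw [Complex.normSq_eq_norm_sq, hz]; norm_num
    have h2 : χ z = 1 := Real.smoothTransition.one_of_one_le (by rw [h1]; norm_num)
    simp [h2, hg, hz]

namespace BryantEnd

variable (E : BryantEnd)

/-- A small circle is traversed negatively, the only direction compatible with the orientation
convention. Its conormal is the image of `-i c'`, normalised. -/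
lemma exists_isFluxConfig : ∃ σ c η K, E.IsFluxConfig σ c η K := by
  obtain ⟨r, hr, hΩ⟩ := exists_closedBall_subset E.isOpen_Ω E.zero_mem_Ω
  have hmem : ∀ z : ℂ, ‖z‖ = r → z ∈ E.Ω \ {0} := by
    intro z hz
    refine ⟨hΩ (by simp [hz]), fun h0 => ?_⟩
    rw [mem_singleton_iff.1 h0, norm_zero] at hz
    exact hr.ne hz
  obtain ⟨K, hK, hKm, hKb⟩ := exists_disk (X := E.X)
    (fun z hz => ⟨E.contDiffAt_X (hmem z hz), E.X_mem (hmem z hz)⟩) hr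
  set c : ℝ → ℂ := fun t => (r : ℂ) * Complex.exp (((-1 : ℝ) : ℂ) * t * Complex.I) with hc
  have hloop : IsEndLoop E.Ω (-1) c := isEndLoop_circle hr hΩ (Or.inr rfl)
  have hd (t : ℝ) : deriv c t = -(Complex.I * c t) := by
    have h1 := ((((Complex.ofRealCLM.hasDerivAt (x := t)).const_mul ((-1 : ℝ) : ℂ)).mul_const
      Complex.I).cexp.const_mul (r : ℂ)).deriv
    simp only [Complex.ofRealCLM_apply] at h1
    rw [h1, hc]; push_cast; ring
  have hd0 (t : ℝ) : deriv c t ≠ 0 := by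
    rw [hd]; exact neg_ne_zero.2 (mul_ne_zero Complex.I_ne_zero (hloop.mem t).2)
  have hX (t : ℝ) := E.deriv_X_comp (hloop.contDiff.differentiable two_ne_zero t) (hloop.mem t)
  set k : ℝ → ℝ := fun t => (hypNorm (E.X (c t)) (fderiv ℝ E.X (c t) (deriv c t)))⁻¹ with hk
  set v : ℝ → ℂ := fun t => (k t : ℂ) * -(Complex.I * deriv c t) with hv
  have hnorm (t : ℝ) : 0 < hypNorm (E.X (c t)) (fderiv ℝ E.X (c t) (deriv c t)) := by
    obtain ⟨p, q, hs⟩ := E.exists_hasSpinors (hloop.mem t)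
    rw [hs.hypNorm_fderiv]
    have := hs.height_pos
    have := hs.ne_zero
    have := norm_pos_iff.2 (hd0 t)
    positivity
  have hkpos (t : ℝ) : 0 < k t := inv_pos.2 (hnorm t)
  have hsv (t : ℝ) : star (deriv c t) * v t = ((k t * Complex.normSq (deriv c t) : ℝ) : ℂ) *
      -Complex.I := by
    simp only [hv, Complex.star_def, Complex.ofReal_mul, Complex.normSq_eq_conj_mul_self]; ring
  have him (t : ℝ) : (star (deriv c t) * v t).im < 0 := by
    rw [hsv, Complex.im_ofReal_mul]
    have := mul_pos (hkpos t) (Complex.normSq_pos.2 (hd0 t))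
    simpa using this
  refine ⟨-1, c, fun t => fderiv ℝ E.X (c t) (v t), K, ⟨Or.inr rfl, hloop, hd0, ?_, ?_, ?_, ?_,
    hK, hKm, ?_⟩⟩
  · intro t
    exact ⟨v t, by linarith [him t], rfl⟩
  · intro t
    obtain ⟨p, q, hs⟩ := E.exists_hasSpinors (hloop.mem t)
    rw [hX, hs.hypInner_fderiv]
    have h1 : star (v t) * deriv c t = star (star (deriv c t) * v t) := by
      rw [StarMul.star_mul (star _), star_star]
    rw [h1, hsv]; simp
  · intro t
    obtain ⟨p, q, hs⟩ := E.exists_hasSpinors (hloop.mem t)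
    have h1 := hnorm t
    have h2 : k t * hypNorm (E.X (c t)) (fderiv ℝ E.X (c t) (deriv c t)) = 1 :=
      inv_mul_cancel₀ h1.ne'
    rw [hs.hypNorm_fderiv] at h2 ⊢
    rw [← h2]
    have : ‖v t‖ = k t * ‖deriv c t‖ := by
      simp only [hv]
      rw [norm_mul, norm_neg, norm_mul, Complex.norm_I, one_mul, Complex.norm_real,
        Real.norm_eq_abs, abs_of_pos (hkpos t)]
    rw [this]; ring
  · intro t
    obtain ⟨p, q, hs⟩ := E.exists_hasSpinors (hloop.mem t)
    rw [hX, hs.det3_meanCurvatureVector]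
    have := hs.height_pos
    have := hs.ne_zero
    exact mul_pos_of_neg_of_neg (by rw [neg_lt_zero]; positivity) (him t)
  · intro t
    rw [hKb _ (by rw [Complex.norm_exp_ofReal_mul_I]), ← Complex.exp_conj, hc]
    simp

/-! ### Representation of the fluxes by a polynomial, and uniqueness -/

/-- The flux of a Killing field in terms of the residues. -/
lemma hasFlux {Y : ℂ × ℝ → ℂ × ℝ} {ξ : Matrix (Fin 2) (Fin 2) ℂ}
    (hY : ∀ p ∈ halfSpace, Y p = killingField ξ p)
    {r₀ r₁ r₂ : ℂ} (h₀ : IsResidueOn E.Ω (logFormCoeff E.form0) r₀)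
    (h₁ : IsResidueOn E.Ω (logFormCoeff E.form1) r₁)
    (h₂ : IsResidueOn E.Ω (logFormCoeff E.form2) r₂) :
    E.HasFlux Y (-pairing ξ (4 * Real.pi * r₀) (4 * Real.pi * r₁) (4 * Real.pi * r₂)).re :=
  ⟨E.exists_isFluxConfig, fun _ _ _ _ h => h.fluxIntegral_eq hY h₀ h₁ h₂⟩

-- The existence clause of `HasFlux` is what keeps its universal clause from being vacuous.
variable {E} in
lemma HasFlux.unique {Y : ℂ × ℝ → ℂ × ℝ} {φ φ' : ℝ} (h : E.HasFlux Y φ) (h' : E.HasFlux Y φ') :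
    φ = φ' := by
  obtain ⟨σ, c, η, K, hcfg⟩ := h.1
  rw [← h.2 σ c η K hcfg, h'.2 σ c η K hcfg]

/-- A field may come from another isometry with the same endpoints; uniqueness of the quotient shows
that the value does not depend on this choice. For rotations the pairing is multiplied by `i`, which
turns the real part into minus the imaginary part. -/
lemma isFluxRepresentedBy {r₀ r₁ r₂ : ℂ} (h₀ : IsResidueOn E.Ω (logFormCoeff E.form0) r₀)
    (h₁ : IsResidueOn E.Ω (logFormCoeff E.form1) r₁)
    (h₂ : IsResidueOn E.Ω (logFormCoeff E.form2) r₂) :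
    E.IsFluxRepresentedBy
      (fluxPolynomial (4 * Real.pi * r₀) (4 * Real.pi * r₁) (4 * Real.pi * r₂)) := by
  intro C D hCD
  obtain ⟨P, hC, hD⟩ := exists_boundaryMap hCD
  refine ⟨_, hasQuotient_fluxPolynomial _ _ _ P hC hD, fun Y hY => ?_, fun Y hY => ?_⟩
  · obtain ⟨P', hC', hD', hY'⟩ := (isTranslationField_iff C D Y).1 hY
    rw [(hasQuotient_fluxPolynomial _ _ _ P hC hD).unique
      (hasQuotient_fluxPolynomial _ _ _ P' hC' hD')]
    rw [one_smul] at hY'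
    exact E.hasFlux hY' h₀ h₁ h₂
  · obtain ⟨P', hC', hD', hY'⟩ := (isRotationField_iff C D Y).1 hY
    rw [(hasQuotient_fluxPolynomial _ _ _ P hC hD).unique
      (hasQuotient_fluxPolynomial _ _ _ P' hC' hD')]
    convert E.hasFlux hY' h₀ h₁ h₂ using 1
    have : pairing (Complex.I • axialGenerator P'.1) (4 * Real.pi * r₀) (4 * Real.pi * r₁)
        (4 * Real.pi * r₂) = Complex.I * pairing (axialGenerator P'.1) (4 * Real.pi * r₀)
          (4 * Real.pi * r₁) (4 * Real.pi * r₂) := by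
      simp only [pairing, Matrix.smul_apply, smul_eq_mul]; ring
    rw [this, Complex.neg_im, Complex.neg_re, Complex.I_mul_re]

/-- The polynomial of an end is determined by the fluxes. -/
lemma IsFluxRepresentedBy.unique {E E' : BryantEnd} {P P' : MvPolynomial (Fin 2) ℂ}
    (h : E.IsFluxRepresentedBy P) (h' : E'.IsFluxRepresentedBy P')
    (hsame : ∀ C D : OnePoint ℂ, C ≠ D → ∀ Y, IsTranslationField C D Y ∨ IsRotationField C D Y →
      ∀ φ : ℝ, E.HasFlux Y φ → E'.HasFlux Y φ) : P = P' := by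
  have hval : ∀ c d : ℂ, c ≠ d → eval2 P c d = eval2 P' c d := by
    intro c d hcd
    have hCD : (c : OnePoint ℂ) ≠ (d : OnePoint ℂ) := fun h => hcd (OnePoint.coe_injective h)
    obtain ⟨v, hv, hT, hR⟩ := h c d hCD
    obtain ⟨v', hv', hT', hR'⟩ := h' c d hCD
    obtain ⟨Q, hC, hD⟩ := exists_boundaryMap hCD
    have hYT := (isTranslationField_iff _ _ _).2 (⟨Q, hC, hD, fun p _ => rfl⟩ :
      IsAxialField 1 c d (killingField ((1 : ℂ) • axialGenerator Q)))
    have hYR := (isRotationField_iff _ _ _).2 (⟨Q, hC, hD, fun p _ => rfl⟩ :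
      IsAxialField Complex.I c d (killingField (Complex.I • axialGenerator Q)))
    have e1 := (hsame _ _ hCD _ (Or.inl hYT) _ (hT _ hYT)).unique (hT' _ hYT)
    have e2 := (hsame _ _ hCD _ (Or.inr hYR) _ (hR _ hYR)).unique (hR' _ hYR)
    have hvv : v = v' := Complex.ext e1 (neg_injective e2)
    have hv1 : eval2 P c d / (c - d) = v := hv.2
    have hv1' : eval2 P' c d / (c - d) = v' := hv'.2
    rw [← hvv, ← hv1] at hv1'
    have hne : c - d ≠ 0 := sub_ne_zero.2 hcd
    exact ((div_left_inj' hne).1 hv1').symm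
  -- The fluxes only see `P` off the diagonal. The factor `X - Y` makes the product vanish
  -- everywhere, and it can be cancelled in a domain.
  have hprod : (P - P') * (MvPolynomial.X 0 - MvPolynomial.X 1) = 0 := by
    apply MvPolynomial.funext
    intro x
    have hx : x = ![x 0, x 1] := by ext i; fin_cases i <;> rfl
    by_cases h01 : x 0 = x 1
    · simp [h01]
    · have := hval (x 0) (x 1) h01
      rw [eval2, eval2, ← hx] at this
      simp [this]
  have hX : (MvPolynomial.X 0 - MvPolynomial.X 1 : MvPolynomial (Fin 2) ℂ) ≠ 0 := by
    intro h0
    have := congrArg (MvPolynomial.eval ![(1 : ℂ), 0]) h0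
    simp at this
  exact sub_eq_zero.1 ((mul_eq_zero.1 hprod).resolve_right hX)

variable {E} in
lemma HasFluxMatrix.unique {Φ Φ' : Matrix (Fin 2) (Fin 2) ℂ} (h : E.HasFluxMatrix Φ)
    (h' : E.HasFluxMatrix Φ') : Φ = Φ' := by
  obtain ⟨r, hr, hΩ⟩ := exists_closedBall_subset E.isOpen_Ω E.zero_mem_Ω
  have hloop := isEndLoop_circle hr hΩ (σ := 1) (Or.inl rfl)
  ext i j
  rw [← h _ hloop, ← h' _ hloop]

end BryantEnd

/-! ### Coefficients and symmetry of the flux polynomial, and the theorem -/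

lemma fluxPolynomial_injective {a b c a' b' c' : ℂ}
    (h : fluxPolynomial a b c = fluxPolynomial a' b' c') : a = a' ∧ b = b' ∧ c = c' := by
  have key (x y : ℂ) : c * (x * y) + b * (x + y) + a = c' * (x * y) + b' * (x + y) + a' := by
    rw [← eval2_fluxPolynomial, ← eval2_fluxPolynomial, h]
  have h0 := key 0 0
  have h1 := key 1 0
  have h2 := key 1 1
  simp only [mul_zero, mul_one, add_zero, zero_add] at h0 h1 h2
  refine ⟨h0, ?_, ?_⟩
  · linear_combination h1 - h0
  · linear_combination h2 - 2 * h1 + h0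

lemma fluxPolynomial_isSymmetric (a b c : ℂ) : (fluxPolynomial a b c).IsSymmetric := by
  intro e
  simp only [fluxPolynomial, map_add, map_mul, MvPolynomial.rename_C, MvPolynomial.rename_X]
  have he : (e 0 = 0 ∧ e 1 = 1) ∨ (e 0 = 1 ∧ e 1 = 0) := by
    have hne : e 0 ≠ e 1 := fun h => by simpa using e.injective h
    generalize e 0 = x at *
    generalize e 1 = y at *
    fin_cases x <;> fin_cases y <;> simp_all
  rcases he with ⟨h0, h1⟩ | ⟨h0, h1⟩ <;> rw [h0, h1]
  rw [mul_comm (MvPolynomial.X 1), add_comm (MvPolynomial.X 1)]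

lemma diagonal_fluxPolynomial (a b c : ℂ) : diagonal (fluxPolynomial a b c) =
    Polynomial.C c * Polynomial.X ^ 2 + Polynomial.C (2 * b) * Polynomial.X + Polynomial.C a := by
  have h2 : (Polynomial.C 2 : Polynomial ℂ) = 2 := rfl
  simp [diagonal, fluxPolynomial, h2]
  ring

end Bryant

end

theorem theorem3p3 (E : Bryant.BryantEnd) :
    ∃ r₀ r₁ r₂ φ₀ φ₁ φ₂ : ℂ,
      Bryant.HasResidue (Bryant.logFormCoeff E.form0) r₀ ∧
      Bryant.HasResidue (Bryant.logFormCoeff E.form1) r₁ ∧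
      Bryant.HasResidue (Bryant.logFormCoeff E.form2) r₂ ∧
      φ₀ = 4 * Real.pi * r₀ ∧ φ₁ = 4 * Real.pi * r₁ ∧ φ₂ = 4 * Real.pi * r₂ ∧
      (∃! P : MvPolynomial (Fin 2) ℂ, E.IsFluxRepresentedBy P) ∧
      (∀ P : MvPolynomial (Fin 2) ℂ, E.IsFluxRepresentedBy P →
        P.IsSymmetric ∧
        P = MvPolynomial.C φ₂ * (MvPolynomial.X 0 * MvPolynomial.X 1) +
          MvPolynomial.C φ₁ * (MvPolynomial.X 0 + MvPolynomial.X 1) + MvPolynomial.C φ₀ ∧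
        Bryant.diagonal P = Polynomial.C φ₂ * Polynomial.X ^ 2 +
          Polynomial.C (2 * φ₁) * Polynomial.X + Polynomial.C φ₀) ∧
      E.HasFluxMatrix ((1 / (4 * Real.pi) : ℂ) • !![φ₁, φ₂; -φ₀, -φ₁]) ∧
      (∀ (E' : Bryant.BryantEnd) (Φ Φ' : Matrix (Fin 2) (Fin 2) ℂ),
        E.HasFluxMatrix Φ → E'.HasFluxMatrix Φ' → (Φ = Φ' ↔ E.SameFluxes E')) := by
  obtain ⟨r₀, r₁, r₂, h₀, h₁, h₂⟩ := E.exists_residues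
  have hrep := E.isFluxRepresentedBy h₀ h₁ h₂
  have hmat := E.hasFluxMatrix h₀ h₁ h₂
  have hpi : (4 * Real.pi : ℂ) ≠ 0 := by exact_mod_cast (by positivity : 4 * Real.pi ≠ 0)
  -- Uniqueness of the polynomial is the comparison of an end with itself.
  have huniq : ∀ P, E.IsFluxRepresentedBy P →
      P = Bryant.fluxPolynomial (4 * Real.pi * r₀) (4 * Real.pi * r₁) (4 * Real.pi * r₂) :=
    fun P hP => hP.unique hrep fun _ _ _ _ _ _ h => h
  refine ⟨r₀, r₁, r₂, _, _, _, h₀.hasResidue E.isOpen_Ω E.zero_mem_Ω,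
    h₁.hasResidue E.isOpen_Ω E.zero_mem_Ω, h₂.hasResidue E.isOpen_Ω E.zero_mem_Ω, rfl, rfl, rfl,
    ⟨_, hrep, huniq⟩, fun P hP => ?_, ?_, fun E' Φ Φ' hΦ hΦ' => ?_⟩
  · obtain rfl := huniq P hP
    exact ⟨Bryant.fluxPolynomial_isSymmetric _ _ _, rfl, Bryant.diagonal_fluxPolynomial _ _ _⟩
  · convert hmat using 1
    ext i j
    fin_cases i <;> fin_cases j <;> simp <;> field_simp
  · obtain ⟨s₀, s₁, s₂, k₀, k₁, k₂⟩ := E'.exists_residues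
    rw [hΦ.unique hmat, hΦ'.unique (E'.hasFluxMatrix k₀ k₁ k₂)]
    constructor
    · intro heq
      have e0 : r₀ = s₀ := by simpa using congrFun (congrFun heq 1) 0
      have e1 : r₁ = s₁ := by simpa using congrFun (congrFun heq 0) 0
      have e2 : r₂ = s₂ := by simpa using congrFun (congrFun heq 0) 1
      subst e0 e1 e2
      -- With equal residues, both fluxes are given by the same expression in `ξ`, and each end has
      -- only one flux for `Y`.
      intro C D _ Y hY φ
      obtain ⟨ξ, hξ⟩ : ∃ ξ, ∀ p ∈ Bryant.halfSpace, Y p = Bryant.killingField ξ p := by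
        rcases hY with hY | hY
        · obtain ⟨P, -, -, hP⟩ := (Bryant.isTranslationField_iff C D Y).1 hY
          exact ⟨_, hP⟩
        · obtain ⟨P, -, -, hP⟩ := (Bryant.isRotationField_iff C D Y).1 hY
          exact ⟨_, hP⟩
      have f1 := E.hasFlux hξ h₀ h₁ h₂
      have f2 := E'.hasFlux hξ k₀ k₁ k₂
      exact ⟨fun h => h.unique f1 ▸ f2, fun h => h.unique f2 ▸ f1⟩
    · intro hsame
      -- Equal fluxes give equal polynomials, hence equal coefficients; dividing by `4π` recovers
      -- the residues.
      have hP := hrep.unique (E'.isFluxRepresentedBy k₀ k₁ k₂)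
        fun C D hCD Y hY φ => (hsame C D hCD Y hY φ).1
      obtain ⟨e0, e1, e2⟩ := Bryant.fluxPolynomial_injective hP
      rw [mul_left_cancel₀ hpi e0, mul_left_cancel₀ hpi e1, mul_left_cancel₀ hpi e2]
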